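/- **Conventions.** For integers $a\le b$ let $B^{k,l}$ with letters in $\{a,\dots,b\}$ be the set of semistandard tableaux of rectangular shape with $k$ rows and $l$ columns (rows weakly increasing, columns strictly increasing; $B^{0,l}$ has one element). The Kashiwara operators $e_i,f_i$ ($a\le i<b$) act on $B^{k,l}\otimes B^{k',l'}$ by the signature rule: read $x\otimes y$ as a word, first $x$ then $y$, each tableau column by column from right to left and each column from top to bottom; write $+$ for a letter $i$ and $-$ for a letter $i+1$; cancel adjacent pairs $+-$ successively until $-\cdots-+\cdots+$ remains; $e_i$ changes the rightmost remaining $-$ (a letter $i+1$) into $i$, $f_i$ changes the leftmost remaining $+$ (a letter $i$) into $i+1$, and the result is $0$ if there is no such sign. The combinatorial $R:B^{k,l}\otimes B^{k',l'}\to B^{k',l'}\otimes B^{k,l}$ is the bijection that commutes with the operators $e_i,f_i$, $a\le i<b$. (The affine combinatorial $R$ commutes with these operators as well; the bijection is unique in all cases used here, as stated below.) The energy function is $$H(x\otimes y)=d(x,y)-\min(k,k')\min(l,l'),$$ where $d(x,y)$ is the number of cells strictly east of the $\max(l,l')$-th column in the tableau obtained from $y$ by row-inserting the row word of $x$ (the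 rows from bottom to top, each read from left to right). **Box-ball system.** Let $1\le k<n$, let all letters be in $\{1,\dots,n\}$, let $1_k\in B^{k,1}$ be the column $(1,2,\dots,k)$ and $c_l=1_k^l\in B^{k,l}$ the tableau with all columns equal to $1_k$. For $p\in(B^{k,1})^{\otimes L}$, applying $R:B^{k,l}\otimes B^{k,1}\to B^{k,1}\otimes B^{k,l}$ successively $L$ times sends $c_l\otimes p$ to some $\tilde p\otimes c$, and $T_l(p)=\tilde p$. A soliton of length $d$ has an internal degree of freedom $u=(u_{<k},u_k)$, where $u_{<k}\in B^{k-1,d}$ has letters in $\{1,\dots,k\}$ and $u_k\in B^{1,d}$ has letters in $\{k+1,\dots,n\}$; $u$ is also regarded as the tableau in $B^{k,d}$ with first $k-1$ rows $u_{<k}$ and $k$-th row $u_k$. If its columns are $x^1,\dots,x^d$, the soliton is $x^d\otimes\cdots\otimes x^1\in(B^{k,1})^{\otimes d}$. For two solitons $u,v$, let $p_L(x,u;y,v)\in(B^{k,1})^{\otimes L}$ be the state in which $u$ begins after the first $x$ factors, $v$ begins after the first $y$ factors, and all other factors are $1_k$. **Theorem (scattering of two solitons).** Let $1\le k<n$,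 $1\le d_2<d_1$ and $l>d_2$. 1. There is exactly one combinatorial $R$ on each of $B^{k,l}\otimes B^{k,1}$ (letters $1,\dots,n$), $B^{k-1,d_1}\otimes B^{k-1,d_2}$ (letters $1,\dots,k$) and $B^{1,d_1}\otimes B^{1,d_2}$ (letters $k+1,\dots,n$). 2. Let $u$, $v$ be internal degrees of freedom of solitons of lengths $d_1$, $d_2$, and let $c_1,c_2\ge 0$ be integers with $c_2-c_1-d_1\ge d_2$. Define $\tilde u=(\tilde u_{<k},\tilde u_k)$ and $\tilde v=(\tilde v_{<k},\tilde v_k)$ by $$R(u_{<k}\otimes v_{<k})=\tilde v_{<k}\otimes\tilde u_{<k},\qquad R(u_k\otimes v_k)=\tilde v_k\otimes\tilde u_k,$$ and put $$\delta=2d_2+H(u_k\otimes v_k)+H(u_{<k}\otimes v_{<k}).$$ Then there is $t_0$ such that for every $t\ge t_0$ and all sufficiently large $L$ (depending on $t$), the carrier returns to $c_l$ at the end of each of the first $t$ time steps started from $p_L(c_1,u;c_2,v)$, and $$T_l^{\,t}\bigl(p_L(c_1,u;c_2,v)\bigr)=p_L\bigl(c_2-\delta+\min(d_2,l)\,t,\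 \tilde v;\ c_1+\delta+\min(d_1,l)\,t,\ \tilde u\bigr).$$ In other words, the scattering is $\zeta^{c_1}u\otimes\zeta^{c_2}v\to\zeta^{c_2-\delta}\tilde v\otimes\zeta^{c_1+\delta}\tilde u$: the internal degrees of freedom change by $R\times R$, and both phase shifts are equal to $\delta$. -/

import Mathlib

namespace BoxBall

/-! ### Rectangular semistandard tableaux -/

/-- The rectangular Young diagram with `k` rows and `l` columns. -/
def rect (k l : ℕ) : YoungDiagram where
  cells := Finset.range k ×ˢ Finset.range l
  isLowerSet := by
    rintro ⟨i, j⟩ ⟨i', j'⟩ ⟨h₁, h₂⟩ h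
    simp only [Finset.coe_product, Finset.coe_range, Set.mem_prod, Set.mem_Iio] at h ⊢
    exact ⟨lt_of_le_of_lt h₁ h.1, lt_of_le_of_lt h₂ h.2⟩

theorem mem_rect {k l i j : ℕ} : (i, j) ∈ rect k l ↔ i < k ∧ j < l := by
  rw [← YoungDiagram.mem_cells]
  simp [rect]

/-- `Tab a b k l` is the set `B^{k,l}` of semistandard tableaux with `k` rows and `l` columns and
letters in `{a, a + 1, …, b}`. Rows and columns are numbered from `0`. -/
def Tab (a b k l : ℕ) : Type :=
  {T : SemistandardYoungTableau (rect k l) // ∀ i < k, ∀ j < l, a ≤ T i j ∧ T i j ≤ b}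

/-- The entry in row `i` and column `j` (both numbered from `0`). -/
def Tab.entry {a b k l : ℕ} (T : Tab a b k l) (i j : ℕ) : ℕ := T.1 i j

/-- The tableau with prescribed entries. -/
def Tab.mk {a b k l : ℕ} (x : ℕ → ℕ → ℕ)
    (hx : ∀ i < k, ∀ j < l, a ≤ x i j ∧ x i j ≤ b)
    (hrow : ∀ i < k, ∀ j₁ j₂, j₁ < j₂ → j₂ < l → x i j₁ ≤ x i j₂)
    (hcol : ∀ j < l, ∀ i₁ i₂, i₁ < i₂ → i₂ < k → x i₁ j < x i₂ j) : Tab a b k l :=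
  ⟨{ entry := fun i j => if i < k ∧ j < l then x i j else 0
     row_weak' := by
      intro i j₁ j₂ hj h
      rw [mem_rect] at h
      rw [if_pos h, if_pos ⟨h.1, hj.trans h.2⟩]
      exact hrow i h.1 j₁ j₂ hj h.2
     col_strict' := by
      intro i₁ i₂ j hi h
      rw [mem_rect] at h
      rw [if_pos h, if_pos ⟨hi.trans h.1, h.2⟩]
      exact hcol j h.2 i₁ i₂ hi h.1
     zeros' := by
      intro i j h
      rw [mem_rect] at h
      exact if_neg h },
   by
    intro i hi j hj
    change a ≤ (if i < k ∧ j < l then x i j else 0) ∧ (if i < k ∧ j < l then x i j else 0) ≤ b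
    rw [if_pos ⟨hi, hj⟩]
    exact hx i hi j hj⟩

theorem Tab.entry_mk {a b k l : ℕ} (x : ℕ → ℕ → ℕ)
    (hx : ∀ i < k, ∀ j < l, a ≤ x i j ∧ x i j ≤ b)
    (hrow : ∀ i < k, ∀ j₁ j₂, j₁ < j₂ → j₂ < l → x i j₁ ≤ x i j₂)
    (hcol : ∀ j < l, ∀ i₁ i₂, i₁ < i₂ → i₂ < k → x i₁ j < x i₂ j) (i j : ℕ) :
    (Tab.mk x hx hrow hcol : Tab a b k l).entry i j = if i < k ∧ j < l then x i j else 0 :=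
  rfl

theorem Tab.entry_bounds {a b k l : ℕ} (T : Tab a b k l) {i j : ℕ} (hi : i < k) (hj : j < l) :
    a ≤ T.entry i j ∧ T.entry i j ≤ b := T.2 i hi j hj

theorem Tab.entry_row {a b k l : ℕ} (T : Tab a b k l) {i j₁ j₂ : ℕ} (hi : i < k) (hj : j₁ < j₂)
    (hj₂ : j₂ < l) : T.entry i j₁ ≤ T.entry i j₂ := T.1.row_weak hj (mem_rect.2 ⟨hi, hj₂⟩)

theorem Tab.entry_col {a b k l : ℕ} (T : Tab a b k l) {i₁ i₂ j : ℕ} (hi : i₁ < i₂)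
    (hi₂ : i₂ < k) (hj : j < l) : T.entry i₁ j < T.entry i₂ j :=
  T.1.col_strict hi (mem_rect.2 ⟨hi₂, hj⟩)

/-- The `j`-th column of a tableau, as an element of `B^{k,1}`. -/
def Tab.column {a b k l : ℕ} (T : Tab a b k l) (j : ℕ) (hj : j < l) : Tab a b k 1 :=
  Tab.mk (fun i _ => T.entry i j)
    (fun _ hi _ _ => T.entry_bounds hi hj)
    (fun _ _ _ _ _ _ => le_rfl)
    (fun _ _ _ _ hi hi₂ => T.entry_col hi hi₂ hj)

/-- The tableau `1_k^l`, all of whose columns are `(1, 2, …, k)`. -/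
def vacuum {n k : ℕ} (h : k ≤ n) (l : ℕ) : Tab 1 n k l :=
  Tab.mk (fun i _ => i + 1)
    (fun _ hi _ _ => ⟨Nat.le_add_left _ _, le_trans hi h⟩)
    (fun _ _ _ _ _ _ => le_rfl)
    (fun _ _ _ _ hi _ => Nat.add_lt_add_right hi 1)

/-! ### Kashiwara operators on words and tensor products -/

/-- One step of the reduction of the `i`-signature of a word. A letter `i` is a sign `+`, a letter
`i + 1` is a sign `-`; the stack `st` holds the not yet cancelled signs with their positions, the
latest one on top. A `-` arriving right after a `+` cancels it. -/
def signatureStep (i : ℕ) (st : List (ℕ × ℕ)) (p : ℕ × ℕ) : List (ℕ × ℕ) :=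
  if p.1 = i then p :: st
  else if p.1 = i + 1 then
    match st with
    | [] => [p]
    | q :: st' => if q.1 = i then st' else p :: q :: st'
  else st

/-- The reduced `i`-signature `- ⋯ - + ⋯ +` of a word, from left to right, as a list of pairs
(letter, position). -/
def reducedSignature (i : ℕ) (w : List ℕ) : List (ℕ × ℕ) :=
  (w.zipIdx.foldl (signatureStep i) []).reverse

/-- `e_i` on words: the rightmost `-` of the reduced signature becomes a `+`; `none` is the
zero of the crystal. -/
def eWord (i : ℕ) (w : List ℕ) : Option (List ℕ) :=
  (((reducedSignature i w).filter (fun p => p.1 = i + 1)).getLast?).map (fun p => w.set p.2 i)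

/-- `f_i` on words: the leftmost `+` of the reduced signature becomes a `-`. -/
def fWord (i : ℕ) (w : List ℕ) : Option (List ℕ) :=
  (((reducedSignature i w).filter (fun p => p.1 = i)).head?).map (fun p => w.set p.2 (i + 1))

/-- The reading word of a tableau used for the signature rule: the columns from right to left,
each of them from top to bottom. -/
def Tab.columnWord {a b k l : ℕ} (T : Tab a b k l) : List ℕ :=
  (List.range l).reverse.flatMap (fun j => (List.range k).map (fun i => T.entry i j))

/-- The reading word of `x ⊗ y`. -/
def tensorWord {a b k l k' l' : ℕ} (p : Tab a b k l × Tab a b k' l') : List ℕ :=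
  p.1.columnWord ++ p.2.columnWord

/-- An operation on words, transported to `B^{k,l} ⊗ B^{k',l'}` along the (injective) reading
word. -/
noncomputable def onTensor {a b k l k' l' : ℕ} (op : List ℕ → Option (List ℕ))
    (p : Tab a b k l × Tab a b k' l') : Option (Tab a b k l × Tab a b k' l') :=
  open Classical in
  if h : ∃ q : Tab a b k l × Tab a b k' l', op (tensorWord p) = some (tensorWord q)
  then some h.choose else none

/-- The Kashiwara operator `e_i` on `B^{k,l} ⊗ B^{k',l'}`. -/
noncomputable def kashiwaraE {a b k l k' l' : ℕ} (i : ℕ) :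
    Tab a b k l × Tab a b k' l' → Option (Tab a b k l × Tab a b k' l') :=
  onTensor (eWord i)

/-- The Kashiwara operator `f_i` on `B^{k,l} ⊗ B^{k',l'}`. -/
noncomputable def kashiwaraF {a b k l k' l' : ℕ} (i : ℕ) :
    Tab a b k l × Tab a b k' l' → Option (Tab a b k l × Tab a b k' l') :=
  onTensor (fWord i)

/-- `R : B^{k,l} ⊗ B^{k',l'} → B^{k',l'} ⊗ B^{k,l}` is a combinatorial `R` (letters in
`{a, …, b}`): a bijection which commutes with the Kashiwara operators `e_i`, `f_i`, `a ≤ i < b`.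
Commutation with the affine operators `e_0`, `f_0` is not required. The affine combinatorial `R` is
one of these bijections, and there is only one of them, since a tensor product of two rectangular
crystals is multiplicity free. -/
structure IsCombinatorialR {a b k l k' l' : ℕ}
    (R : Tab a b k l × Tab a b k' l' → Tab a b k' l' × Tab a b k l) : Prop where
  bijective : Function.Bijective R
  comm_e : ∀ i, a ≤ i → i < b → ∀ p, kashiwaraE i (R p) = (kashiwaraE i p).map R
  comm_f : ∀ i, a ≤ i → i < b → ∀ p, kashiwaraF i (R p) = (kashiwaraF i p).map R

/-! ### Row insertion and the energy function -/

/-- Insertion of a letter into a row: the leftmost larger letter is replaced and bumped out, or, if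
there is none, the new letter is put at the right end. -/
def bumpRow (c : ℕ) : List ℕ → List ℕ × Option ℕ
  | [] => ([c], none)
  | x :: r => if c < x then (c :: r, some x) else (x :: (bumpRow c r).1, (bumpRow c r).2)

/-- Row insertion of a letter into a tableau (the list of its rows, from top to bottom). -/
def insertLetter : List (List ℕ) → ℕ → List (List ℕ)
  | [], c => [[c]]
  | r :: T, c =>
    match bumpRow c r with
    | (r', none) => r' :: T
    | (r', some x) => r' :: insertLetter T x

/-- Row insertion of a word, from left to right. -/
def insertWord (T : List (List ℕ)) (w : List ℕ) : List (List ℕ) := w.foldl insertLetter T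

/-- The rows of a tableau, from top to bottom. -/
def Tab.rows {a b k l : ℕ} (T : Tab a b k l) : List (List ℕ) :=
  (List.range k).map (fun i => (List.range l).map (fun j => T.entry i j))

/-- The row word of a tableau: the rows from bottom to top, each of them from left to right. -/
def Tab.rowWord {a b k l : ℕ} (T : Tab a b k l) : List ℕ := T.rows.reverse.flatten

/-- The number of cells of `y ← row(x)` strictly east of the `max(l, l')`-th column. -/
def eastCells {a b k l k' l' : ℕ} (x : Tab a b k l) (y : Tab a b k' l') : ℕ :=
  ((insertWord y.rows x.rowWord).map (fun r => r.length - max l l')).sum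

/-- The energy function `H(x ⊗ y)`. -/
def energy {a b k l k' l' : ℕ} (x : Tab a b k l) (y : Tab a b k' l') : ℤ :=
  (eastCells x y : ℤ) - (min k k' : ℤ) * (min l l' : ℤ)

/-! ### The box-ball system -/

/-- The carrier `b ∈ B^{k,l}` runs through `b_1 ⊗ ⋯ ⊗ b_L` by repeated application of `R`:
`b ⊗ (b_1 ⊗ ⋯ ⊗ b_L) ↦ (b̃_1 ⊗ ⋯ ⊗ b̃_L) ⊗ b̃`. -/
def carry {B C : Type} (R : B × C → C × B) : B → List C → List C × B
  | b, [] => ([], b)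
  | b, c :: p => ((R (b, c)).1 :: (carry R (R (b, c)).2 p).1, (carry R (R (b, c)).2 p).2)

/-- The time evolution `T_l` on `(B^{k,1})^{⊗ L}`. -/
def timeEvolution {n k l : ℕ} (h : k ≤ n)
    (R : Tab 1 n k l × Tab 1 n k 1 → Tab 1 n k 1 × Tab 1 n k l)
    (p : List (Tab 1 n k 1)) : List (Tab 1 n k 1) :=
  (carry R (vacuum h l) p).1

/-- The state of the carrier after it has run through all of `p`, starting from `1_k^l`. -/
def finalCarrier {n k l : ℕ} (h : k ≤ n)
    (R : Tab 1 n k l × Tab 1 n k 1 → Tab 1 n k 1 × Tab 1 n k l)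
    (p : List (Tab 1 n k 1)) : Tab 1 n k l :=
  (carry R (vacuum h l) p).2

/-! ### Solitons -/

/-- The internal degree of freedom `u = (u_{<k}, u_k)` of a soliton of length `d`: a tableau in
`B^{k-1,d}` with letters in `{1, …, k}` and one in `B^{1,d}` with letters in `{k+1, …, n}`. -/
structure Soliton (n k d : ℕ) where
  upper : Tab 1 k (k - 1) d
  lower : Tab (k + 1) n 1 d

/-- The tableau in `B^{k,d}` whose first `k - 1` rows are `u_{<k}` and whose `k`-th row is `u_k`. -/
def Soliton.tableau {n k d : ℕ} (h : k ≤ n) (u : Soliton n k d) : Tab 1 n k d :=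
  Tab.mk (fun i j => if i < k - 1 then u.upper.entry i j else u.lower.entry 0 j)
    (by
      intro i _ j hj
      split_ifs with h₁
      · have := u.upper.entry_bounds h₁ hj
        omega
      · have := u.lower.entry_bounds Nat.zero_lt_one hj
        omega)
    (by
      intro i _ j₁ j₂ hj hj₂
      split_ifs with h₁
      · exact u.upper.entry_row h₁ hj hj₂
      · exact u.lower.entry_row Nat.zero_lt_one hj hj₂)
    (by
      intro j hj i₁ i₂ hi hi₂
      have h₁ : i₁ < k - 1 := by omega
      rw [if_pos h₁]
      split_ifs with h₂
      · exact u.upper.entry_col hi h₂ hj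
      · have := u.upper.entry_bounds h₁ hj
        have := u.lower.entry_bounds Nat.zero_lt_one hj
        omega)

/-- The local state at site `s` (sites are numbered from `0`) when a soliton `u` occupies the sites
`x, …, x + d₁ - 1`, a soliton `v` occupies the sites `y, …, y + d₂ - 1`, and all other sites are in
the vacuum state `1_k`. If the columns of the tableau `u` are `x^1, …, x^d` then the soliton is
`x^d ⊗ ⋯ ⊗ x^1`. -/
def twoSolitonSite {n k d₁ d₂ : ℕ} (h : k ≤ n) (x : ℤ) (u : Soliton n k d₁) (y : ℤ)
    (v : Soliton n k d₂) (s : ℕ) : Tab 1 n k 1 :=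
  if hx : x ≤ s ∧ s < x + d₁ then
    (u.tableau h).column (d₁ - 1 - ((s : ℤ) - x).toNat) (by omega)
  else if hy : y ≤ s ∧ s < y + d₂ then
    (v.tableau h).column (d₂ - 1 - ((s : ℤ) - y).toNat) (by omega)
  else vacuum h 1

/-- The state in `(B^{k,1})^{⊗ L}` with a soliton `u` preceded by `x` sites and a soliton `v`
preceded by `y` sites. -/
def twoSolitonState {n k d₁ d₂ : ℕ} (h : k ≤ n) (L : ℕ) (x : ℤ) (u : Soliton n k d₁) (y : ℤ)
    (v : Soliton n k d₂) : List (Tab 1 n k 1) :=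
  (List.range L).map (twoSolitonSite h x u y v)

/-- The phase shift `2 d₂ + H(u_k ⊗ v_k) + H(u_{<k} ⊗ v_{<k})`. -/
def phaseShift {n k d₁ d₂ : ℕ} (u : Soliton n k d₁) (v : Soliton n k d₂) : ℤ :=
  2 * (d₂ : ℤ) + energy u.lower v.lower + energy u.upper v.upper

end BoxBall

open BoxBall

/-! Everything is reduced to Knuth equivalence. A tensor product of tableaux is read as a word, and
the operators $e_i,f_i$ pass to Knuth classes (`Knuth.sim`). Highest weight words with the same
content are Knuth equivalent (`IsHighest.knuth`). On the three tensor products of the theorem a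
highest weight element is determined by its content, so a Knuth class meets each product at most
once. Hence there is exactly one combinatorial $R$, and $R(p)=q$ if and only if the words of $p$ and
$q$ are Knuth equivalent (`existsUnique_combinatorialR`). The cell count in the energy function also
depends on the Knuth class only and is unchanged by $e_i$ (`eastCells_eq`, `eastNum_eWord`).

Consequently a carrier running through a state commutes with every $e_i$ (`eWord_carry`). For $i\ne
k$ the vacuum columns have no uncancelled sign, so $e_i$ commutes with $T_l$ and acts on a
two-soliton state as it acts on $u\otimes v$: on $u_{<k}\otimes v_{<k}$ if $i<k$, on $u_k\otimes
v_k$ if $i>k$. The map $R\times R$ commutes with these operators and $\delta$ is invariant under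
them. It is therefore enough to treat pairs for which both tensor products are highest weight
elements (`scatters_of_isHighest`).

In such a pair all columns of $u$ are $P=(1,\dots,k-1,k+1)$, and $v$ is $Q^bM^rP^e$ in site order,
where the two bottom letters of $Q$ are $k,k+2$ and those of $M$ are $k-1,k+2$ or $k,k+1$. If $v_k$
has $\alpha$ letters $k+2$ and $v_{<k}$ has $\beta$ letters $k$, then $b=\min(\alpha,\beta)$ and
$r=|\alpha-\beta|$. Together with the vacuum $V$ and $W=(1,\dots,k-2,k+1,k+2)$ these columns suffice
for the whole evolution: the carrier always has the form $W^tQ^sM^rP^qV^p$, and its exchanges with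
the sites follow from 24 Knuth equivalences between triples of columns (`Column.knuth_rule`).

A time step maps a state $V^xP^{A-h}W^hV^gQ^{b-h}M^rP^BV^N$, with gap $g$ or overlap $h$, to a state
of the same form (`Run.step`). The parameters pass through three phases (`phase_step`): $A=d_1$
before the collision, a transition during which $A$ decreases, and $A=d_2$ afterwards. Comparison of
the positions gives the shift $2d_2-2b-r=2d_2-\alpha-\beta$. This is $\delta$, because the two
energies of a highest weight pair are $-\alpha$ and $-\beta$ (`energy_of_isHighest`). -/

namespace BoxBall

/-! ### The signature rule over an arbitrary alphabet -/

namespace Sig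

variable {α β : Type*}

/-- The number of uncancelled `-` signs; `s a` is `some true` for `+`, `some false` for `-`. -/
def ep (s : α → Option Bool) : List α → ℕ
  | [] => 0
  | a :: w => match s a with
    -- Truncated subtraction: a `+` cancels the first uncancelled `-` on its right, if there is one.
    | some true => ep s w - 1
    | some false => ep s w + 1
    | none => ep s w

/-- The number of uncancelled `+` signs. -/
def ph (s : α → Option Bool) : List α → ℕ
  | [] => 0
  | a :: w => match s a with
    | some true => ph s w + (1 - ep s w)
    | some false => ph s w
    | none => ph s w

/-- Apply `d` to the rightmost uncancelled `-`. -/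
def e (s : α → Option Bool) (d : α → α) : List α → Option (List α)
  | [] => none
  | a :: w => match s a with
    -- The new `+` removes the leftmost uncancelled `-`, so the rightmost one survives only if there
    -- are at least two.
    | some true => if 1 < ep s w then (e s d w).map (a :: ·) else none
    | some false => if 0 < ep s w then (e s d w).map (a :: ·) else some (d a :: w)
    | none => (e s d w).map (a :: ·)

/-- Apply `d` to the leftmost uncancelled `+`. -/
def f (s : α → Option Bool) (d : α → α) : List α → Option (List α)
  | [] => none
  | a :: w => match s a with
    | some true => if ep s w = 0 then some (d a :: w) else (f s d w).map (a :: ·)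
    | some false => (f s d w).map (a :: ·)
    | none => (f s d w).map (a :: ·)

variable (s : α → Option Bool) (d : α → α)

/-- The `+` signs left over in `u` cancel against the `-` signs left over in `v`. This and the next
lemmas are the tensor product rule for crystals. -/
theorem ep_append (u v : List α) : ep s (u ++ v) = ep s u + (ep s v - ph s u) := by
  induction u with
  | nil => simp [ep, ph]
  | cons a u ih =>
    simp only [List.cons_append, ep, ph, ih]
    split <;> omega

theorem ph_append (u v : List α) : ph s (u ++ v) = ph s v + (ph s u - ep s v) := by
  induction u with
  | nil => simp [ph]
  | cons a u ih =>
    simp only [List.cons_append, ph, ih, ep_append]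
    split <;> omega

theorem e_eq_none {w : List α} : e s d w = none ↔ ep s w = 0 := by
  induction w with
  | nil => simp [e, ep]
  | cons a w ih =>
    simp only [e, ep]
    split
    · split_ifs <;> simp [ih] <;> omega
    · split_ifs <;> simp [ih]; omega
    · simp [ih]

theorem f_eq_none {w : List α} : f s d w = none ↔ ph s w = 0 := by
  induction w with
  | nil => simp [f, ph]
  | cons a w ih =>
    simp only [f, ph]
    split
    · split_ifs <;> simp [ih] <;> omega
    · simp [ih]
    · simp [ih]

/-- The rightmost surviving `-` lies in `v` exactly if `v` has more uncancelled `-` than `u` has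
uncancelled `+`. -/
theorem e_append (u v : List α) : e s d (u ++ v) =
    if ph s u < ep s v then (e s d v).map (u ++ ·) else (e s d u).map (· ++ v) := by
  induction u with
  | nil =>
    simp only [List.nil_append, ph, e]
    by_cases h : 0 < ep s v
    · simp [h]
    · have : e s d v = none := (e_eq_none s d).2 (by omega)
      simp [h, this]
  | cons a u ih =>
    rcases h : s a with _ | _ | _ <;> simp only [List.cons_append, e, ph, ep_append, ih, h]
    · split_ifs <;> simp [Function.comp_def]
    · split_ifs <;> first | omega | simp [Function.comp_def]
    · split_ifs <;> first | omega | simp [Function.comp_def]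

theorem f_append (u v : List α) : f s d (u ++ v) =
    if ep s v < ph s u then (f s d u).map (· ++ v) else (f s d v).map (u ++ ·) := by
  induction u with
  | nil => simp [ph]
  | cons a u ih =>
    rcases h : s a with _ | _ | _ <;> simp only [List.cons_append, f, ph, ep_append, ih, h]
    · split_ifs <;> simp [Function.comp_def]
    · split_ifs <;> simp [Function.comp_def]
    · split_ifs <;> first | omega | simp [Function.comp_def]

variable {s d}

/-- The sign that is changed stands on the border of `- ⋯ - + ⋯ +`, so it becomes the leftmost
surviving `+`, which `f` turns back. -/
theorem e_spec {d' : α → α} (hs : ∀ a, s a = some false → s (d a) = some true)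
    (hd : ∀ a, s a = some false → d' (d a) = a) {w w' : List α} (h : e s d w = some w') :
    f s d' w' = some w ∧ ep s w = ep s w' + 1 ∧ ph s w' = ph s w + 1 := by
  induction w generalizing w' with
  | nil => simp [e] at h
  | cons a w ih =>
    simp only [e] at h
    rcases ha : s a with _ | _ | _ <;> simp only [ha] at h
    · obtain ⟨v, hv, rfl⟩ := Option.map_eq_some_iff.1 h
      obtain ⟨h1, h2, h3⟩ := ih hv
      simp [f, ep, ph, ha, h1, h2, h3]
    · split_ifs at h with h0
      · obtain ⟨v, hv, rfl⟩ := Option.map_eq_some_iff.1 h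
        obtain ⟨h1, h2, h3⟩ := ih hv
        simp [f, ep, ph, ha, h1, h2, h3]
      · cases h
        have h0' : ep s w = 0 := by omega
        simp [f, ep, ph, ha, hs a ha, h0', hd a ha]
    · split_ifs at h with h0
      obtain ⟨v, hv, rfl⟩ := Option.map_eq_some_iff.1 h
      obtain ⟨h1, h2, h3⟩ := ih hv
      have h4 : ep s v ≠ 0 := by omega
      refine ⟨?_, ?_, ?_⟩
      · simp [f, ha, h1, h4]
      · simp only [ep, ha]; omega
      · simp only [ph, ha]; omega

theorem f_spec {d' : α → α} (hs : ∀ a, s a = some true → s (d a) = some false)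
    (hd : ∀ a, s a = some true → d' (d a) = a) {w w' : List α} (h : f s d w = some w') :
    e s d' w' = some w ∧ ph s w = ph s w' + 1 ∧ ep s w' = ep s w + 1 := by
  induction w generalizing w' with
  | nil => simp [f] at h
  | cons a w ih =>
    simp only [f] at h
    rcases ha : s a with _ | _ | _ <;> simp only [ha] at h
    · obtain ⟨v, hv, rfl⟩ := Option.map_eq_some_iff.1 h
      obtain ⟨h1, h2, h3⟩ := ih hv
      simp [e, ep, ph, ha, h1, h2, h3]
    · obtain ⟨v, hv, rfl⟩ := Option.map_eq_some_iff.1 h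
      obtain ⟨h1, h2, h3⟩ := ih hv
      simp [e, ep, ph, ha, h1, h2, h3]
    · split_ifs at h with h0
      · cases h
        simp [e, ep, ph, ha, hs a ha, h0, hd a ha]
      · obtain ⟨v, hv, rfl⟩ := Option.map_eq_some_iff.1 h
        obtain ⟨h1, h2, h3⟩ := ih hv
        refine ⟨?_, ?_, ?_⟩
        · simp only [e, ha, h1]
          rw [if_pos (by omega)]; rfl
        · simp only [ph, ha]; omega
        · simp only [ep, ha]; omega

theorem length_e {w w' : List α} (h : e s d w = some w') : w'.length = w.length := by
  induction w generalizing w' with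
  | nil => simp [e] at h
  | cons a w ih =>
    simp only [e] at h
    rcases ha : s a with _ | _ | _ <;> simp only [ha] at h <;> (try split_ifs at h) <;>
      first
      | (obtain ⟨v, hv, rfl⟩ := Option.map_eq_some_iff.1 h; simp [ih hv])
      | (cases h; simp)

theorem length_f {w w' : List α} (h : f s d w = some w') : w'.length = w.length := by
  induction w generalizing w' with
  | nil => simp [f] at h
  | cons a w ih =>
    simp only [f] at h
    rcases ha : s a with _ | _ | _ <;> simp only [ha] at h <;> (try split_ifs at h) <;>
      first
      | (obtain ⟨v, hv, rfl⟩ := Option.map_eq_some_iff.1 h; simp [ih hv])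
      | (cases h; simp)

/-- The sign of a word whose reduced signature has at most one sign. -/
def toEp : Option Bool → ℕ
  | some false => 1
  | some true => 0
  | none => 0

/-- See `toEp`. -/
def toPh : Option Bool → ℕ
  | some true => 1
  | some false => 0
  | none => 0

/-- `h` replaces every letter of type `α` by a block with the same reduced signature. -/
structure IsBlockMap (s : α → Option Bool) (t : β → Option Bool) (h : α → List β) (a : α) :
    Prop where
  ep_eq : ep t (h a) = toEp (s a)
  ph_eq : ph t (h a) = toPh (s a)

theorem ep_flatMap {t : β → Option Bool} {h : α → List β} {w : List α}
    (H : ∀ a ∈ w, IsBlockMap s t h a) : ep t (w.flatMap h) = ep s w ∧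
      ph t (w.flatMap h) = ph s w := by
  induction w with
  | nil => simp [ep, ph]
  | cons a w ih =>
    obtain ⟨h1, h2⟩ := ih fun b hb => H b (List.mem_cons_of_mem _ hb)
    obtain ⟨h3, h4⟩ := H a List.mem_cons_self
    rw [List.flatMap_cons, ep_append, ph_append, h1, h2, h3, h4]
    rcases ha : s a with _ | _ | _ <;> simp only [toEp, toPh, ep, ph, ha] <;>
      constructor <;> first | trivial | omega

/-- A block with at most one surviving sign can stand for a letter. Applied to columns, this lets
the operators act on lists of columns instead of words. -/
theorem e_flatMap {t : β → Option Bool} {c : β → β} {h : α → List β} {w : List α}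
    (H : ∀ a ∈ w, IsBlockMap s t h a)
    (hd : ∀ a ∈ w, s a = some false → e t c (h a) = some (h (d a))) :
    e t c (w.flatMap h) = (e s d w).map (·.flatMap h) := by
  induction w with
  | nil => simp [e]
  | cons a w ih =>
    have ih := ih (fun b hb => H b (List.mem_cons_of_mem _ hb))
      (fun b hb => hd b (List.mem_cons_of_mem _ hb))
    obtain ⟨h1, h2⟩ := ep_flatMap fun b hb => H b (List.mem_cons_of_mem _ hb)
    obtain ⟨h3, h4⟩ := H a List.mem_cons_self
    have h5 := hd a List.mem_cons_self
    rw [List.flatMap_cons, e_append, h1, h4, ih]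
    have h6 := e_eq_none t c (w := h a)
    have h7 := e_eq_none s d (w := w)
    rcases ha : s a with _ | _ | _ <;> simp only [toPh, toEp, e, ha] at h3 ⊢
    · rw [h6.2 h3]
      by_cases h0 : 0 < ep s w
      · simp [h0, Function.comp_def]
      · simp [h7.2 (by omega)]
    · rw [h5 ha]
      by_cases h0 : 0 < ep s w <;> simp [h0, Function.comp_def]
    · rw [h6.2 h3]
      by_cases h0 : 1 < ep s w <;> simp [h0, Function.comp_def]

theorem f_flatMap {t : β → Option Bool} {c : β → β} {h : α → List β} {w : List α}
    (H : ∀ a ∈ w, IsBlockMap s t h a)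
    (hd : ∀ a ∈ w, s a = some true → f t c (h a) = some (h (d a))) :
    f t c (w.flatMap h) = (f s d w).map (·.flatMap h) := by
  induction w with
  | nil => simp [f]
  | cons a w ih =>
    have ih := ih (fun b hb => H b (List.mem_cons_of_mem _ hb))
      (fun b hb => hd b (List.mem_cons_of_mem _ hb))
    obtain ⟨h1, h2⟩ := ep_flatMap fun b hb => H b (List.mem_cons_of_mem _ hb)
    obtain ⟨h3, h4⟩ := H a List.mem_cons_self
    have h5 := hd a List.mem_cons_self
    rw [List.flatMap_cons, f_append, h1, h4, ih]
    rcases ha : s a with _ | _ | _ <;> simp only [toPh, f, ha]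
    · simp [Function.comp_def]
    · simp [Function.comp_def]
    · rw [h5 ha]
      by_cases h0 : ep s w = 0 <;> simp [h0, Function.comp_def]

end Sig

/-! ### Words in the natural numbers -/

/-- The sign of a letter for the `i`-signature. -/
def lsgn (i c : ℕ) : Option Bool :=
  if c = i then some true else if c = i + 1 then some false else none

/-- `ε_i` of a word. -/
abbrev eps (i : ℕ) (w : List ℕ) : ℕ := Sig.ep (lsgn i) w

/-- `φ_i` of a word. -/
abbrev phi (i : ℕ) (w : List ℕ) : ℕ := Sig.ph (lsgn i) w

end BoxBall

namespace BoxBall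

/-! ### The Kashiwara operators on words -/

theorem lsgn_self (i : ℕ) : lsgn i i = some true := by simp [lsgn]

theorem lsgn_succ (i : ℕ) : lsgn i (i + 1) = some false := by simp [lsgn]

theorem lsgn_eq_true {i c : ℕ} : lsgn i c = some true ↔ c = i := by
  unfold lsgn; split_ifs <;> simp_all

theorem lsgn_eq_false {i c : ℕ} : lsgn i c = some false ↔ c = i + 1 := by
  unfold lsgn; split_ifs <;> simp_all

theorem lsgn_eq_none {i c : ℕ} : lsgn i c = none ↔ c ≠ i ∧ c ≠ i + 1 := by
  unfold lsgn; split_ifs <;> simp_all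

/-- The letter `i + 1` in the reduced signature, as a stack invariant. -/
theorem foldl_signatureStep (i : ℕ) (w : List ℕ) :
    let st := w.zipIdx.foldl (signatureStep i) []
    (∀ p ∈ st, p.2 < w.length) ∧
    (∃ u v : List (ℕ × ℕ), st = u ++ v ∧ (∀ p ∈ u, p.1 = i) ∧ (∀ p ∈ v, p.1 = i + 1) ∧
      u.length = phi i w ∧ v.length = eps i w ∧
      Sig.e (lsgn i) (fun _ => i) w = v.head?.map (fun p => w.set p.2 i) ∧
      Sig.f (lsgn i) (fun _ => i + 1) w = u.getLast?.map (fun p => w.set p.2 (i + 1))) := by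
  -- The stack algorithm consumes the word from the left, so the last letter is split off and the
  -- recursive functions are computed by their append rules. With the latest sign on top, the stack
  -- reads `+ ⋯ + - ⋯ -`; hence `e` changes the head of its second part and `f` the last entry of
  -- its first part.
  induction w using List.reverseRecOn with
  | nil => exact ⟨by simp, [], [], by simp [Sig.ep, Sig.ph, Sig.e, Sig.f]⟩
  | append_singleton w c ih =>
    obtain ⟨hlt, u, v, hst, hu, hv, hul, hvl, he, hf⟩ := ih
    have hz : (w ++ [c]).zipIdx.foldl (signatureStep i) [] =
        signatureStep i (u ++ v) (c, w.length) := by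
      rw [← hst, List.zipIdx_append]; simp [List.foldl_append]
    simp only [hz]
    have hlt' : ∀ p ∈ u ++ v, p.2 < w.length := by rw [← hst]; exact hlt
    simp only [eps, phi] at hul hvl ⊢
    rw [Sig.ep_append, Sig.ph_append, Sig.e_append, Sig.f_append, he, hf]
    have hset : ∀ p ∈ u ++ v, ∀ x, w.set p.2 x ++ [c] = (w ++ [c]).set p.2 x := by
      intro p hp x
      rw [List.set_append_left _ _ (hlt' p hp)]
    have hset' : ∀ x, w ++ [x] = (w ++ [c]).set w.length x := by
      intro x; rw [List.set_append_right _ _ le_rfl]; simp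
    rcases hc : lsgn i c with _ | _ | _
    · obtain ⟨h1, h2⟩ := lsgn_eq_none.1 hc
      simp only [signatureStep, h1, h2, if_false, Sig.ep, Sig.ph, Sig.e, Sig.f, hc]
      refine ⟨fun p hp => ?_, u, v, rfl, hu, hv, by omega, by omega, ?_, ?_⟩
      · have := hlt' p hp; simp; omega
      · cases v with
        | nil => simp
        | cons p v => simp [hset p (by simp)]
      · rcases List.eq_nil_or_concat u with rfl | ⟨u', p, rfl⟩
        · simp at hul; simp [← hul]
        · simp at hul
          simp [← hul, hset p (by simp)]
    · obtain rfl := lsgn_eq_false.1 hc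
      rcases u with _ | ⟨p, u⟩
      · simp only [List.length_nil] at hul
        simp only [List.nil_append] at *
        have : signatureStep i v (i + 1, w.length) = (i + 1, w.length) :: v := by
          cases v with
          | nil => simp [signatureStep]
          | cons q v =>
            have := hv q (by simp)
            simp [signatureStep, this]
        rw [this]
        refine ⟨?_, [], (i + 1, w.length) :: v, rfl, by simp, ?_, ?_, ?_, ?_, ?_⟩
        · intro p hp
          rcases List.mem_cons.1 hp with rfl | hp
          · simp
          · have := hlt' p hp; simp; omega
        · simpa using hv
        · simp [Sig.ep, Sig.ph, hc, ← hul]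
        · simp [Sig.ep, hc, ← hul, hvl]
        · simp [Sig.ep, Sig.e, hc, ← hul]
        · simp [Sig.ep, Sig.f, hc, ← hul]
      · have hp := hu p (by simp)
        have : signatureStep i (p :: u ++ v) (i + 1, w.length) = u ++ v := by
          simp [signatureStep, hp]
        rw [this]
        simp only [List.length_cons] at hul
        refine ⟨?_, u, v, rfl, fun q hq => hu q (by simp [hq]), hv, ?_, ?_, ?_, ?_⟩
        · intro q hq; have := hlt' q (List.mem_cons_of_mem _ hq); simp; omega
        · simp [Sig.ep, Sig.ph, hc]; omega
        · simp [Sig.ep, hc]; omega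
        · have hne : Sig.ph (lsgn i) w ≠ 0 := by omega
          cases v with
          | nil => simp [Sig.ep, hc, hne]
          | cons q v => simp [Sig.ep, hc, hne, hset q (by simp)]
        · rcases List.eq_nil_or_concat u with rfl | ⟨u', q, rfl⟩
          · simp at hul; simp [Sig.ep, Sig.f, hc, ← hul]
          · simp only [List.concat_eq_append] at hul ⊢
            have : 1 < Sig.ph (lsgn i) w := by
              simp at hul; omega
            rw [List.getLast?_cons]
            simp [Sig.ep, hc, this, hset q (by simp)]
    · obtain rfl := lsgn_eq_true.1 hc
      have : signatureStep c (u ++ v) (c, w.length) = (c, w.length) :: u ++ v := by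
        simp [signatureStep]
      rw [this]
      refine ⟨?_, (c, w.length) :: u, v, rfl, ?_, hv, ?_, ?_, ?_, ?_⟩
      · intro p hp
        rcases List.mem_cons.1 hp with rfl | hp
        · simp
        · have := hlt' p hp; simp; omega
      · simpa using hu
      · simp [Sig.ep, Sig.ph, hc, hul]; omega
      · simp [Sig.ep, hc, hvl]
      · cases v with
        | nil => simp [Sig.ep, hc]
        | cons q v => simp [Sig.ep, hc, hset q (by simp)]
      · rcases List.eq_nil_or_concat u with rfl | ⟨u', q, rfl⟩
        · simp at hul; simp [Sig.ep, Sig.f, hc, ← hul]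
        · have : 0 < Sig.ph (lsgn c) w := by
            simp at hul; omega
          rw [List.getLast?_cons]
          simp [Sig.ep, hc, this, hset q (by simp)]

theorem eWord_eq (i : ℕ) (w : List ℕ) : eWord i w = Sig.e (lsgn i) (fun _ => i) w := by
  obtain ⟨-, u, v, hst, hu, hv, -, -, he, -⟩ := foldl_signatureStep i w
  have h1 : u.filter (fun p => p.1 = i + 1) = [] := by
    rw [List.filter_eq_nil_iff]; intro p hp; simp [hu p hp]
  have h2 : v.filter (fun p => p.1 = i + 1) = v := by
    rw [List.filter_eq_self]; intro p hp; simp [hv p hp]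
  rw [he, eWord, reducedSignature, hst, List.filter_reverse, List.filter_append, h1, h2]
  simp

theorem fWord_eq (i : ℕ) (w : List ℕ) : fWord i w = Sig.f (lsgn i) (fun _ => i + 1) w := by
  obtain ⟨-, u, v, hst, hu, hv, -, -, -, hf⟩ := foldl_signatureStep i w
  have h1 : u.filter (fun p => p.1 = i) = u := by
    rw [List.filter_eq_self]; intro p hp; simp [hu p hp]
  have h2 : v.filter (fun p => p.1 = i) = [] := by
    rw [List.filter_eq_nil_iff]; intro p hp; simp [hv p hp]
  rw [hf, fWord, reducedSignature, hst, List.filter_reverse, List.filter_append, h1, h2]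
  simp

theorem eps_append (i : ℕ) (u v : List ℕ) : eps i (u ++ v) = eps i u + (eps i v - phi i u) :=
  Sig.ep_append _ u v

theorem phi_append (i : ℕ) (u v : List ℕ) : phi i (u ++ v) = phi i v + (phi i u - eps i v) :=
  Sig.ph_append _ u v

theorem eWord_append (i : ℕ) (u v : List ℕ) : eWord i (u ++ v) =
    if phi i u < eps i v then (eWord i v).map (u ++ ·) else (eWord i u).map (· ++ v) := by
  simp only [eWord_eq]; exact Sig.e_append _ _ u v

theorem fWord_append (i : ℕ) (u v : List ℕ) : fWord i (u ++ v) =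
    if eps i v < phi i u then (fWord i u).map (· ++ v) else (fWord i v).map (u ++ ·) := by
  simp only [fWord_eq]; exact Sig.f_append _ _ u v

theorem eWord_eq_none {i : ℕ} {w : List ℕ} : eWord i w = none ↔ eps i w = 0 := by
  rw [eWord_eq]; exact Sig.e_eq_none _ _

theorem fWord_eq_none {i : ℕ} {w : List ℕ} : fWord i w = none ↔ phi i w = 0 := by
  rw [fWord_eq]; exact Sig.f_eq_none _ _

theorem eWord_spec {i : ℕ} {w w' : List ℕ} (h : eWord i w = some w') :
    fWord i w' = some w ∧ eps i w = eps i w' + 1 ∧ phi i w' = phi i w + 1 := by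
  rw [eWord_eq] at h
  rw [fWord_eq]
  exact Sig.e_spec (d' := fun _ => i + 1) (fun _ _ => lsgn_self i) (fun a ha => (lsgn_eq_false.1 ha).symm) h

theorem fWord_spec {i : ℕ} {w w' : List ℕ} (h : fWord i w = some w') :
    eWord i w' = some w ∧ phi i w = phi i w' + 1 ∧ eps i w' = eps i w + 1 := by
  rw [fWord_eq] at h
  rw [eWord_eq]
  exact Sig.f_spec (d' := fun _ => i) (fun _ _ => lsgn_succ i) (fun a ha => (lsgn_eq_true.1 ha).symm) h

theorem length_eWord {i : ℕ} {w w' : List ℕ} (h : eWord i w = some w') :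
    w'.length = w.length := by
  rw [eWord_eq] at h; exact Sig.length_e h

/-- `e_i` replaces one letter `i + 1` by `i`. -/
theorem eWord_split {i : ℕ} {w w' : List ℕ} (h : eWord i w = some w') :
    ∃ u v, w = u ++ (i + 1) :: v ∧ w' = u ++ i :: v := by
  induction w generalizing w' with
  | nil => simp [eWord_eq, Sig.e] at h
  | cons c w ih =>
    rw [← List.singleton_append, eWord_append] at h
    split_ifs at h
    · obtain ⟨v, hv, rfl⟩ := Option.map_eq_some_iff.1 h
      obtain ⟨a, b, rfl, rfl⟩ := ih hv
      exact ⟨c :: a, b, by simp, by simp⟩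
    · obtain ⟨v, hv, rfl⟩ := Option.map_eq_some_iff.1 h
      rw [eWord_eq] at hv
      rcases hc : lsgn i c with _ | _ | _ <;> simp [Sig.e, Sig.ep, hc] at hv
      obtain rfl := lsgn_eq_false.1 hc
      exact ⟨[], w, by simp, by simp [← hv]⟩

/-- The sum of the letters is the induction measure whenever a word is raised to highest weight. -/
theorem sum_eWord {i : ℕ} {w w' : List ℕ} (h : eWord i w = some w') : w'.sum < w.sum := by
  obtain ⟨u, v, rfl, rfl⟩ := eWord_split h
  simp

theorem le_of_mem_eWord {i a : ℕ} {w w' : List ℕ} (h : eWord i w = some w') (ha : a ≤ i)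
    (hw : ∀ c ∈ w, a ≤ c) : ∀ c ∈ w', a ≤ c := by
  obtain ⟨u, v, rfl, rfl⟩ := eWord_split h
  intro c hc
  simp only [List.mem_append, List.mem_cons] at hc
  rcases hc with hc | rfl | hc
  · exact hw c (by simp [hc])
  · exact ha
  · exact hw c (by simp [hc])

/-- The weight of a word. -/
theorem phi_add_count (i : ℕ) (w : List ℕ) :
    phi i w + w.count (i + 1) = eps i w + w.count i := by
  induction w with
  | nil => simp [Sig.ep, Sig.ph]
  | cons c w ih =>
    simp only [eps, phi] at ih ⊢
    rcases hc : lsgn i c with _ | _ | _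
    · obtain ⟨h1, h2⟩ := lsgn_eq_none.1 hc
      simp [Sig.ep, Sig.ph, hc, h1, h2, ih]
    · obtain rfl := lsgn_eq_false.1 hc
      simp [Sig.ep, Sig.ph, hc]; omega
    · obtain rfl := lsgn_eq_true.1 hc
      simp [Sig.ep, Sig.ph, hc]; omega

end BoxBall

namespace BoxBall

/-! ### Knuth equivalence -/

/-- An elementary Knuth relation, for words in the reading order of the signature rule (which is
the reverse of the order of row insertion). -/
inductive KnuthStep : List ℕ → List ℕ → Prop
  | left {x y z : ℕ} (u v : List ℕ) (h₁ : x < y) (h₂ : y ≤ z) :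
      KnuthStep (u ++ x :: z :: y :: v) (u ++ z :: x :: y :: v)
  | right {x y z : ℕ} (u v : List ℕ) (h₁ : x ≤ y) (h₂ : y < z) :
      KnuthStep (u ++ y :: z :: x :: v) (u ++ y :: x :: z :: v)

/-- Knuth equivalence. -/
def Knuth : List ℕ → List ℕ → Prop := Relation.EqvGen KnuthStep

namespace Knuth

theorem refl (w : List ℕ) : Knuth w w := Relation.EqvGen.refl w

theorem symm {w w' : List ℕ} (h : Knuth w w') : Knuth w' w := Relation.EqvGen.symm _ _ h

theorem trans {w w' w'' : List ℕ} (h : Knuth w w') (h' : Knuth w' w'') : Knuth w w'' :=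
  Relation.EqvGen.trans _ _ _ h h'

theorem left {x y z : ℕ} (h₁ : x < y) (h₂ : y ≤ z) : Knuth [x, z, y] [z, x, y] :=
  Relation.EqvGen.rel _ _ (KnuthStep.left [] [] h₁ h₂)

theorem right {x y z : ℕ} (h₁ : x ≤ y) (h₂ : y < z) : Knuth [y, z, x] [y, x, z] :=
  Relation.EqvGen.rel _ _ (KnuthStep.right [] [] h₁ h₂)

theorem context {w w' : List ℕ} (h : Knuth w w') (a b : List ℕ) :
    Knuth (a ++ w ++ b) (a ++ w' ++ b) := by
  induction h with
  | rel _ _ h =>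
    refine Relation.EqvGen.rel _ _ ?_
    cases h with
    | left u v h₁ h₂ => simpa using KnuthStep.left (a ++ u) (v ++ b) h₁ h₂
    | right u v h₁ h₂ => simpa using KnuthStep.right (a ++ u) (v ++ b) h₁ h₂
  | refl _ => exact refl _
  | symm _ _ _ ih => exact ih.symm
  | trans _ _ _ _ _ ih₁ ih₂ => exact ih₁.trans ih₂

theorem append_left {w w' : List ℕ} (h : Knuth w w') (a : List ℕ) : Knuth (a ++ w) (a ++ w') := by
  simpa using h.context a []

theorem append_right {w w' : List ℕ} (h : Knuth w w') (b : List ℕ) :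
    Knuth (w ++ b) (w' ++ b) := by
  simpa using h.context [] b

theorem append {v v' w w' : List ℕ} (h : Knuth v v') (h' : Knuth w w') :
    Knuth (v ++ w) (v' ++ w') := (h.append_right w).trans (h'.append_left v')

theorem perm {w w' : List ℕ} (h : Knuth w w') : w.Perm w' := by
  induction h with
  | rel _ _ h =>
    cases h with
    | left u v h₁ h₂ => exact (List.Perm.swap _ _ _).append_left u
    | right u v h₁ h₂ => exact ((List.Perm.swap _ _ _).cons _).append_left u
  | refl _ => exact List.Perm.refl _
  | symm _ _ _ ih => exact ih.symm
  | trans _ _ _ _ _ ih₁ ih₂ => exact ih₁.trans ih₂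

/-- The two words behave in the same way under `e_i` and `f_i`, for one step. -/
structure Sim (i : ℕ) (w w' : List ℕ) : Prop where
  eps_eq : eps i w = eps i w'
  phi_eq : phi i w = phi i w'
  e_rel : ∀ v, eWord i w = some v → ∃ v', eWord i w' = some v' ∧ Knuth v v'
  e_rel' : ∀ v, eWord i w' = some v → ∃ v', eWord i w = some v' ∧ Knuth v' v
  f_rel : ∀ v, fWord i w = some v → ∃ v', fWord i w' = some v' ∧ Knuth v v'
  f_rel' : ∀ v, fWord i w' = some v → ∃ v', fWord i w = some v' ∧ Knuth v' v

theorem Sim.symm {i : ℕ} {w w' : List ℕ} (h : Sim i w w') : Sim i w' w where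
  eps_eq := h.eps_eq.symm
  phi_eq := h.phi_eq.symm
  e_rel v hv := by obtain ⟨v', h1, h2⟩ := h.e_rel' v hv; exact ⟨v', h1, h2.symm⟩
  e_rel' v hv := by obtain ⟨v', h1, h2⟩ := h.e_rel v hv; exact ⟨v', h1, h2.symm⟩
  f_rel v hv := by obtain ⟨v', h1, h2⟩ := h.f_rel' v hv; exact ⟨v', h1, h2.symm⟩
  f_rel' v hv := by obtain ⟨v', h1, h2⟩ := h.f_rel v hv; exact ⟨v', h1, h2.symm⟩

theorem Sim.trans {i : ℕ} {w w' w'' : List ℕ} (h : Sim i w w') (h' : Sim i w' w'') :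
    Sim i w w'' where
  eps_eq := h.eps_eq.trans h'.eps_eq
  phi_eq := h.phi_eq.trans h'.phi_eq
  e_rel v hv := by
    obtain ⟨v', h1, h2⟩ := h.e_rel v hv
    obtain ⟨v'', h3, h4⟩ := h'.e_rel v' h1
    exact ⟨v'', h3, h2.trans h4⟩
  e_rel' v hv := by
    obtain ⟨v', h1, h2⟩ := h'.e_rel' v hv
    obtain ⟨v'', h3, h4⟩ := h.e_rel' v' h1
    exact ⟨v'', h3, h4.trans h2⟩
  f_rel v hv := by
    obtain ⟨v', h1, h2⟩ := h.f_rel v hv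
    obtain ⟨v'', h3, h4⟩ := h'.f_rel v' h1
    exact ⟨v'', h3, h2.trans h4⟩
  f_rel' v hv := by
    obtain ⟨v', h1, h2⟩ := h'.f_rel' v hv
    obtain ⟨v'', h3, h4⟩ := h.f_rel' v' h1
    exact ⟨v'', h3, h4.trans h2⟩

/-- Since `eps` and `phi` of the middle factor agree, the tensor product rule selects the same one
of the three factors in both words. -/
theorem e_context {i : ℕ} {w w' : List ℕ} (he : eps i w = eps i w') (hf : phi i w = phi i w')
    (H : ∀ v, eWord i w = some v → ∃ v', eWord i w' = some v' ∧ Knuth v v') (hk : Knuth w w')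
    (a b : List ℕ) : ∀ v, eWord i (a ++ w ++ b) = some v →
      ∃ v', eWord i (a ++ w' ++ b) = some v' ∧ Knuth v v' := by
  intro v hv
  simp only [eWord_append, phi_append, he, hf] at hv ⊢
  split_ifs at hv ⊢ with h1 h2
  · obtain ⟨c, hc, rfl⟩ := Option.map_eq_some_iff.1 hv
    exact ⟨_, by rw [hc]; rfl, hk.context a c⟩
  · simp only [Option.map_map, Option.map_eq_some_iff] at hv ⊢
    obtain ⟨c, hc, rfl⟩ := hv
    obtain ⟨c', hc', hk'⟩ := H c hc
    exact ⟨_, ⟨c', hc', rfl⟩, hk'.context a b⟩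
  · simp only [Option.map_map, Option.map_eq_some_iff] at hv ⊢
    obtain ⟨c, hc, rfl⟩ := hv
    exact ⟨_, ⟨c, hc, rfl⟩, hk.context c b⟩

theorem f_context {i : ℕ} {w w' : List ℕ} (he : eps i w = eps i w') (hf : phi i w = phi i w')
    (H : ∀ v, fWord i w = some v → ∃ v', fWord i w' = some v' ∧ Knuth v v') (hk : Knuth w w')
    (a b : List ℕ) : ∀ v, fWord i (a ++ w ++ b) = some v →
      ∃ v', fWord i (a ++ w' ++ b) = some v' ∧ Knuth v v' := by
  intro v hv
  simp only [fWord_append, phi_append, he, hf] at hv ⊢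
  split_ifs at hv ⊢ with h1 h2
  · simp only [Option.map_map, Option.map_eq_some_iff] at hv ⊢
    obtain ⟨c, hc, rfl⟩ := hv
    exact ⟨_, ⟨c, hc, rfl⟩, hk.context c b⟩
  · simp only [Option.map_map, Option.map_eq_some_iff] at hv ⊢
    obtain ⟨c, hc, rfl⟩ := hv
    obtain ⟨c', hc', hk'⟩ := H c hc
    exact ⟨_, ⟨c', hc', rfl⟩, hk'.context a b⟩
  · obtain ⟨c, hc, rfl⟩ := Option.map_eq_some_iff.1 hv
    exact ⟨_, by rw [hc]; rfl, hk.context a c⟩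

theorem Sim.context {i : ℕ} {w w' : List ℕ} (h : Sim i w w') (hk : Knuth w w') (a b : List ℕ) :
    Sim i (a ++ w ++ b) (a ++ w' ++ b) where
  eps_eq := by simp only [eps_append, phi_append, h.eps_eq, h.phi_eq]
  phi_eq := by simp only [phi_append, h.eps_eq, h.phi_eq]
  e_rel := e_context h.eps_eq h.phi_eq h.e_rel hk a b
  e_rel' v hv := by
    obtain ⟨v', h1, h2⟩ := e_context h.symm.eps_eq h.symm.phi_eq h.symm.e_rel hk.symm a b v hv
    exact ⟨v', h1, h2.symm⟩
  f_rel := f_context h.eps_eq h.phi_eq h.f_rel hk a b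
  f_rel' v hv := by
    obtain ⟨v', h1, h2⟩ := f_context h.symm.eps_eq h.symm.phi_eq h.symm.f_rel hk.symm a b v hv
    exact ⟨v', h1, h2.symm⟩

theorem sim_left (i : ℕ) {x y z : ℕ} (h₁ : x < y) (h₂ : y ≤ z) : Sim i [x, z, y] [z, x, y] := by
  by_cases hx : x = i <;> by_cases hx' : x = i + 1 <;> by_cases hy : y = i <;>
    by_cases hy' : y = i + 1 <;> by_cases hz : z = i <;> by_cases hz' : z = i + 1 <;>
    first
    | omega
    | (constructor <;>
        simp [eWord_eq, fWord_eq, Sig.e, Sig.f, Sig.ep, Sig.ph, lsgn, hx, hx', hy, hy', hz, hz']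
        <;> first
          | (apply left <;> omega)
          | (apply right <;> omega))

theorem sim_right (i : ℕ) {x y z : ℕ} (h₁ : x ≤ y) (h₂ : y < z) :
    Sim i [y, z, x] [y, x, z] := by
  by_cases hx : x = i <;> by_cases hx' : x = i + 1 <;> by_cases hy : y = i <;>
    by_cases hy' : y = i + 1 <;> by_cases hz : z = i <;> by_cases hz' : z = i + 1 <;>
    first
    | omega
    | (constructor <;>
        simp [eWord_eq, fWord_eq, Sig.e, Sig.f, Sig.ep, Sig.ph, lsgn, hx, hx', hy, hy', hz, hz']
        <;> first
          | (apply left <;> omega)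
          | (apply right <;> omega))

/-- The crystal structure descends to Knuth classes; the statements on $R$ and on the energy rest on
this. -/
theorem sim (i : ℕ) {w w' : List ℕ} (h : Knuth w w') : Sim i w w' := by
  induction h with
  | rel _ _ h =>
    cases h with
    | left u v h₁ h₂ => simpa using (sim_left i h₁ h₂).context (left h₁ h₂) u v
    | right u v h₁ h₂ => simpa using (sim_right i h₁ h₂).context (right h₁ h₂) u v
  | refl w => exact ⟨rfl, rfl, fun v hv => ⟨v, hv, refl v⟩, fun v hv => ⟨v, hv, refl v⟩,
      fun v hv => ⟨v, hv, refl v⟩, fun v hv => ⟨v, hv, refl v⟩⟩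
  | symm _ _ _ ih => exact ih.symm
  | trans _ _ _ _ _ ih₁ ih₂ => exact ih₁.trans ih₂

theorem eWord {i : ℕ} {w w' v : List ℕ} (h : Knuth w w') (hv : eWord i w = some v) :
    ∃ v', BoxBall.eWord i w' = some v' ∧ Knuth v v' := (h.sim i).e_rel v hv

theorem fWord {i : ℕ} {w w' v : List ℕ} (h : Knuth w w') (hv : fWord i w = some v) :
    ∃ v', BoxBall.fWord i w' = some v' ∧ Knuth v v' := (h.sim i).f_rel v hv

theorem eps {w w' : List ℕ} (h : Knuth w w') (i : ℕ) : BoxBall.eps i w = BoxBall.eps i w' :=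
  (h.sim i).eps_eq

theorem phi {w w' : List ℕ} (h : Knuth w w') (i : ℕ) : BoxBall.phi i w = BoxBall.phi i w' :=
  (h.sim i).phi_eq

end Knuth

end BoxBall

namespace BoxBall

/-! ### Row insertion -/

/-- The rows of a tableau from top to bottom, each of them from right to left. -/
def revRowWord (T : List (List ℕ)) : List ℕ := T.flatMap List.reverse

/-- Row `s` can stand directly under row `r` in a semistandard tableau. -/
def Below (r s : List ℕ) : Prop := ∀ v, s.countP (· ≤ v) ≤ r.countP (· < v)

/-- Semistandard tableaux of arbitrary shape as lists of rows. -/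
structure IsSemistandard (T : List (List ℕ)) : Prop where
  sorted : ∀ r ∈ T, r.Pairwise (· ≤ ·)
  chain : T.IsChain Below

theorem bumpRow_perm (c : ℕ) (r : List ℕ) :
    ((bumpRow c r).1 ++ (bumpRow c r).2.toList).Perm (c :: r) := by
  induction r with
  | nil => simp [bumpRow]
  | cons x r ih =>
    unfold bumpRow
    split_ifs
    · simp
    · exact (ih.cons x).trans (List.Perm.swap _ _ _)

theorem bumpRow_some {c : ℕ} {r : List ℕ} (hr : r.Pairwise (· ≤ ·)) {y : ℕ}
    (h : (bumpRow c r).2 = some y) :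
    y ∈ r ∧ c < y ∧ (∀ z ∈ r, c < z → y ≤ z) ∧
      ∃ x t, (bumpRow c r).1 = x :: t ∧ x ≤ c ∧ (x = c ∨ x ∈ r) := by
  induction r with
  | nil => simp [bumpRow] at h
  | cons x r ih =>
    rw [List.pairwise_cons] at hr
    unfold bumpRow at h ⊢
    split_ifs at h ⊢ with hc
    · simp only [Option.some.injEq] at h
      subst h
      refine ⟨by simp, hc, ?_, c, r, rfl, le_rfl, Or.inl rfl⟩
      intro z hz _
      rcases List.mem_cons.1 hz with rfl | hz
      · exact le_rfl
      · exact hr.1 z hz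
    · obtain ⟨h1, h2, h3, -⟩ := ih hr.2 h
      refine ⟨by simp [h1], h2, ?_, x, _, rfl, by omega, by simp⟩
      intro z hz hcz
      rcases List.mem_cons.1 hz with rfl | hz
      · omega
      · exact h3 z hz hcz

theorem bumpRow_none {c : ℕ} {r : List ℕ} (h : (bumpRow c r).2 = none) : ∀ z ∈ r, z ≤ c := by
  induction r with
  | nil => simp
  | cons x r ih =>
    unfold bumpRow at h
    split_ifs at h with hc
    intro z hz
    rcases List.mem_cons.1 hz with rfl | hz
    · omega
    · exact ih h z hz

theorem bumpRow_sorted {c : ℕ} {r : List ℕ} (hr : r.Pairwise (· ≤ ·)) :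
    (bumpRow c r).1.Pairwise (· ≤ ·) := by
  induction r with
  | nil => simp [bumpRow]
  | cons x r ih =>
    rw [List.pairwise_cons] at hr
    unfold bumpRow
    split_ifs with hc
    · rw [List.pairwise_cons]
      exact ⟨fun z hz => hc.le.trans (hr.1 z hz), hr.2⟩
    · rw [List.pairwise_cons]
      refine ⟨fun z hz => ?_, ih hr.2⟩
      have : z ∈ c :: r := (bumpRow_perm c r).subset (List.mem_append_left _ hz)
      rcases List.mem_cons.1 this with rfl | hz
      · omega
      · exact hr.1 z hz

/-- At each step the letter behind the one being passed is the third letter of the elementary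
relation. -/
theorem knuth_shift {c x : ℕ} (s : List ℕ) (hs : (s ++ [x]).Pairwise (· ≥ ·)) (hc : c < x) :
    Knuth (c :: (s ++ [x])) (s ++ [c, x]) := by
  induction s with
  | nil => exact Knuth.refl _
  | cons z s ih =>
    rw [List.cons_append, List.pairwise_cons] at hs
    have h1 : Knuth (c :: z :: (s ++ [x])) (z :: c :: (s ++ [x])) := by
      rcases s with _ | ⟨y, s⟩
      · exact Knuth.left hc (hs.1 x (by simp))
      · have hy : x ≤ y := by
          have := hs.2
          simp only [List.cons_append, List.pairwise_cons] at this
          exact this.1 x (by simp)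
        simpa using (Knuth.left (hc.trans_le hy) (hs.1 y (by simp))).append_right (s ++ [x])
    exact h1.trans ((ih hs.2).append_left [z])

/-- Relations of the first kind bring `c` to its place in the row; relations of the second kind
carry the bumped letter behind the smaller entries of the row. -/
theorem bumpRow_knuth {c : ℕ} {r : List ℕ} (hr : r.Pairwise (· ≤ ·)) :
    Knuth (c :: r.reverse) ((bumpRow c r).1.reverse ++ (bumpRow c r).2.toList) := by
  induction r with
  | nil => exact Knuth.refl _
  | cons x r ih =>
    have hr' := hr
    rw [List.pairwise_cons] at hr
    by_cases hc : c < x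
    · have : bumpRow c (x :: r) = (c :: r, some x) := by simp [bumpRow, hc]
      rw [this]
      simp only [List.reverse_cons, Option.toList_some, List.append_assoc, List.singleton_append]
      refine knuth_shift _ ?_ hc
      rw [← List.reverse_cons, List.pairwise_reverse]
      exact hr'
    · have : bumpRow c (x :: r) = (x :: (bumpRow c r).1, (bumpRow c r).2) := by
        rw [bumpRow, if_neg hc]
      rw [this]
      simp only [List.reverse_cons]
      have h1 := (ih hr.2).append_right [x]
      refine h1.trans ?_
      rcases hb : (bumpRow c r).2 with _ | y
      · simpa using Knuth.refl _
      · obtain ⟨hy, hcy, -, h, t, ht, hhc, hh⟩ := bumpRow_some hr.2 hb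
        have hxh : x ≤ h := by
          rcases hh with rfl | hh
          · omega
          · exact hr.1 h hh
        rw [ht]
        simpa using (Knuth.right hxh (hhc.trans_lt hcy)).append_left t.reverse

theorem insertLetter_knuth {T : List (List ℕ)} (hT : ∀ r ∈ T, r.Pairwise (· ≤ ·)) (c : ℕ) :
    Knuth (c :: revRowWord T) (revRowWord (insertLetter T c)) := by
  induction T generalizing c with
  | nil => exact Knuth.refl _
  | cons r T ih =>
    have h1 := (bumpRow_knuth (c := c) (hT r (by simp))).append_right (revRowWord T)
    have h2 : revRowWord (r :: T) = r.reverse ++ revRowWord T := rfl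
    rw [h2]
    refine h1.trans ?_
    rcases hb : bumpRow c r with ⟨r', _ | x⟩
    · simpa [insertLetter, hb, revRowWord] using Knuth.refl _
    · simpa [insertLetter, hb, revRowWord] using
        (ih (fun s hs => hT s (by simp [hs])) x).append_left r'.reverse

/-- In the upper row `c` replaces the larger letter `x`, so its counts do not drop. The lower row
gains `x`, and its count has to be compensated when the letter that `x` bumps out is beyond `v`. -/
theorem below_bumpRow {c x : ℕ} {r s : List ℕ} (hr : r.Pairwise (· ≤ ·))
    (hs : s.Pairwise (· ≤ ·)) (h : Below r s) (hx : (bumpRow c r).2 = some x) :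
    Below (bumpRow c r).1 (bumpRow x s).1 := by
  intro v
  obtain ⟨hxr, hcx, -, -⟩ := bumpRow_some hr hx
  have h1 := (bumpRow_perm c r).countP_eq (· < v)
  have h2 := (bumpRow_perm x s).countP_eq (· ≤ v)
  rw [hx] at h1
  simp only [List.countP_append, Option.toList_some, List.countP_cons, List.countP_nil,
    decide_eq_true_eq] at h1 h2
  have h3 := h v
  by_cases hxv : x < v
  -- If the lower row has no letter in the interval from `x + 1` to `v`, the column condition at `x`
  -- has one unit to spare at `v`, because `x` itself is a letter of `r` that is below `v` but not
  -- below `x`.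
  · have key : (∀ z ∈ s, z ≤ v → z ≤ x) → s.countP (· ≤ v) + 1 ≤ r.countP (· < v) := by
      intro hz
      have h4 : s.countP (· ≤ v) ≤ s.countP (· ≤ x) :=
        List.countP_mono_left fun z hzs hzv => by simpa using hz z hzs (by simpa using hzv)
      have h5 := h x
      have h6 : r.countP (· < x) + 1 ≤ r.countP (· < v) := by
        obtain ⟨l₁, l₂, rfl⟩ := List.append_of_mem hxr
        have h7 : l₁.countP (· < x) ≤ l₁.countP (· < v) :=
          List.countP_mono_left fun z _ hz => by simp at hz ⊢; omega
        have h8 : l₂.countP (· < x) ≤ l₂.countP (· < v) :=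
          List.countP_mono_left fun z _ hz => by simp at hz ⊢; omega
        simp [hxv]; omega
      omega
    rcases hb : (bumpRow x s).2 with _ | x₂
    · have := key fun z hz _ => bumpRow_none hb z hz
      rw [hb] at h2
      simp at h2
      split_ifs at h1 h2 <;> omega
    · obtain ⟨-, -, h4, -⟩ := bumpRow_some hs hb
      rw [hb] at h2
      simp at h2
      by_cases hv : x₂ ≤ v
      · split_ifs at h1 h2 <;> omega
      · have := key fun z hz hzv => by
          by_contra hcon
          have := h4 z hz (by omega)
          omega
        split_ifs at h1 h2 <;> omega
  · split_ifs at h1 h2 <;> omega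

theorem isChain_insertLetter {T : List (List ℕ)} {r : List ℕ} {c x : ℕ}
    (h : IsSemistandard (r :: T)) (hx : (bumpRow c r).2 = some x) :
    IsSemistandard ((bumpRow c r).1 :: insertLetter T x) := by
  induction T generalizing r c x with
  | nil =>
    have hr := h.sorted r (by simp)
    refine ⟨?_, ?_⟩
    · simp [insertLetter, bumpRow_sorted hr]
    · have := below_bumpRow (s := []) hr (by simp) (by intro v; simp) hx
      simpa [insertLetter, bumpRow] using this
  | cons s T ih =>
    have hr := h.sorted r (by simp)
    have hs := h.sorted s (by simp)
    have hch := List.isChain_cons_cons.1 h.chain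
    have hB := below_bumpRow hr hs hch.1 hx
    have hT : IsSemistandard (s :: T) := ⟨fun t ht => h.sorted t (by simp [ht]), hch.2⟩
    rcases hb : (bumpRow x s).2 with _ | x₂
    · have : insertLetter (s :: T) x = (bumpRow x s).1 :: T := by
        rw [insertLetter]
        rcases hb' : bumpRow x s with ⟨s', o⟩
        rw [hb'] at hb; simp only at hb; subst hb; rfl
      rw [this]
      refine ⟨?_, ?_⟩
      · intro t ht
        simp only [List.mem_cons] at ht
        rcases ht with rfl | rfl | ht
        · exact bumpRow_sorted hr
        · exact bumpRow_sorted hs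
        · exact h.sorted t (by simp [ht])
      · refine List.isChain_cons_cons.2 ⟨hB, ?_⟩
        rcases T with _ | ⟨t, T⟩
        · simp
        · have h3 := List.isChain_cons_cons.1 hch.2
          refine List.isChain_cons_cons.2 ⟨fun v => (h3.1 v).trans ?_, h3.2⟩
          have := (bumpRow_perm x s).countP_eq (· < v)
          rw [hb] at this
          simp [List.countP_cons] at this
          omega
    · have : insertLetter (s :: T) x = (bumpRow x s).1 :: insertLetter T x₂ := by
        rw [insertLetter]
        rcases hb' : bumpRow x s with ⟨s', o⟩
        rw [hb'] at hb; simp only at hb; subst hb; rfl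
      rw [this]
      have h4 := ih hT hb
      refine ⟨?_, List.isChain_cons_cons.2 ⟨hB, h4.chain⟩⟩
      intro t ht
      rcases List.mem_cons.1 ht with rfl | ht
      · exact bumpRow_sorted hr
      · exact h4.sorted t ht

theorem IsSemistandard.nil : IsSemistandard [] := ⟨by simp, by simp⟩

theorem IsSemistandard.insertLetter {T : List (List ℕ)} (h : IsSemistandard T) (c : ℕ) :
    IsSemistandard (insertLetter T c) := by
  rcases T with _ | ⟨r, T⟩
  · exact ⟨by simp [BoxBall.insertLetter], by simp [BoxBall.insertLetter]⟩
  · rcases hb : (bumpRow c r).2 with _ | x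
    · have : BoxBall.insertLetter (r :: T) c = (bumpRow c r).1 :: T := by
        rw [BoxBall.insertLetter]
        rcases hb' : bumpRow c r with ⟨s', o⟩
        rw [hb'] at hb; simp only at hb; subst hb; rfl
      rw [this]
      refine ⟨?_, ?_⟩
      · intro t ht
        rcases List.mem_cons.1 ht with rfl | ht
        · exact bumpRow_sorted (h.sorted r (by simp))
        · exact h.sorted t (by simp [ht])
      · rcases T with _ | ⟨t, T⟩
        · simp
        · have h3 := List.isChain_cons_cons.1 h.chain
          refine List.isChain_cons_cons.2 ⟨fun v => (h3.1 v).trans ?_, h3.2⟩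
          have := (bumpRow_perm c r).countP_eq (· < v)
          rw [hb] at this
          simp [List.countP_cons] at this
          omega
    · have : BoxBall.insertLetter (r :: T) c = (bumpRow c r).1 :: BoxBall.insertLetter T x := by
        rw [BoxBall.insertLetter]
        rcases hb' : bumpRow c r with ⟨s', o⟩
        rw [hb'] at hb; simp only at hb; subst hb; rfl
      rw [this]
      exact isChain_insertLetter h hb

/-- Insertion yields a semistandard representative of the Knuth class. That it is the only one is
not needed; `east_unique` extracts what matters for the energy. -/
theorem IsSemistandard.insertWord {T : List (List ℕ)} (h : IsSemistandard T) (w : List ℕ) :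
    IsSemistandard (insertWord T w) ∧ Knuth (w.reverse ++ revRowWord T)
      (revRowWord (insertWord T w)) := by
  induction w generalizing T with
  | nil => exact ⟨h, Knuth.refl _⟩
  | cons c w ih =>
    obtain ⟨h1, h2⟩ := ih (h.insertLetter c)
    refine ⟨h1, Knuth.trans ?_ h2⟩
    simpa using (insertLetter_knuth h.sorted c).append_left w.reverse

/-! ### Crystal operators on semistandard tableaux -/

theorem eps_phi_reverse {i : ℕ} {r : List ℕ} (hr : r.Pairwise (· ≤ ·)) :
    eps i r.reverse = r.count (i + 1) ∧ phi i r.reverse = r.count i := by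
  induction r with
  | nil => simp [Sig.ep, Sig.ph]
  | cons x r ih =>
    rw [List.pairwise_cons] at hr
    obtain ⟨h1, h2⟩ := ih hr.2
    rw [List.reverse_cons, eps_append, phi_append, h1, h2]
    rcases hx : lsgn i x with _ | _ | _
    · obtain ⟨h3, h4⟩ := lsgn_eq_none.1 hx
      simp [Sig.ep, Sig.ph, hx, h3, h4]
    · obtain rfl := lsgn_eq_false.1 hx
      have : r.count i = 0 := List.count_eq_zero_of_not_mem fun hi => by
        have := hr.1 i hi; omega
      simp [Sig.ep, Sig.ph, hx, this]
    · obtain rfl := lsgn_eq_true.1 hx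
      simp [Sig.ep, Sig.ph, hx]; omega

/-- In a reversed row the letters `i + 1` directly precede the letters `i`, and the last of them is
lowered. In the row this is the leftmost `i + 1`, so the row stays sorted. -/
theorem eWord_reverse {i : ℕ} {r w : List ℕ} (hr : r.Pairwise (· ≤ ·))
    (h : eWord i r.reverse = some w) :
    ∃ r' : List ℕ, w = r'.reverse ∧ r'.Pairwise (· ≤ ·) ∧ r'.length = r.length := by
  induction r generalizing w with
  | nil => simp [eWord_eq, Sig.e] at h
  | cons x r ih =>
    rw [List.reverse_cons, eWord_append] at h
    rw [List.pairwise_cons] at hr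
    split_ifs at h with hlt
    · obtain ⟨v, hv, rfl⟩ := Option.map_eq_some_iff.1 h
      rcases hx : lsgn i x with _ | _ | _ <;> simp [eWord_eq, Sig.e, Sig.ep, hx] at hv
      obtain rfl := lsgn_eq_false.1 hx
      subst hv
      refine ⟨i :: r, by simp, ?_, by simp⟩
      rw [List.pairwise_cons]
      exact ⟨fun z hz => (Nat.le_succ i).trans (hr.1 z hz), hr.2⟩
    · obtain ⟨v, hv, rfl⟩ := Option.map_eq_some_iff.1 h
      obtain ⟨r', rfl, h1, h2⟩ := ih hr.2 hv
      refine ⟨x :: r', by simp, ?_, by simp [h2]⟩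
      rw [List.pairwise_cons]
      refine ⟨fun z hz => ?_, h1⟩
      obtain ⟨a, b, hab, hab'⟩ := eWord_split hv
      have hz' : z ∈ a ++ i :: b := by rw [← hab']; simpa using hz
      have hsub : ∀ y ∈ a ++ (i + 1) :: b, y ∈ r := fun y hy => by
        rw [← hab] at hy; simpa using hy
      simp only [List.mem_append, List.mem_cons] at hz'
      rcases hz' with hz' | rfl | hz'
      · exact hr.1 z (hsub z (by simp [hz']))
      · have hxz := hr.1 (z + 1) (hsub _ (by simp))
        rcases hxz.lt_or_eq with h3 | rfl
        · omega
        · exfalso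
          obtain ⟨h3, h4⟩ := eps_phi_reverse (i := z) hr.2
          have h5 : phi z r.reverse = 0 := by
            rw [h4]; exact List.count_eq_zero_of_not_mem fun hi => by
              have := hr.1 z hi; omega
          have : eps z [z + 1] = 1 := by simp [Sig.ep, lsgn_succ]
          omega
      · exact hr.1 z (hsub z (by simp [hz']))

theorem countP_le_eWord {i v : ℕ} {w w' : List ℕ} (h : eWord i w = some w') :
    w'.countP (· ≤ v) = w.countP (· ≤ v) + if v = i then 1 else 0 := by
  obtain ⟨a, b, rfl, rfl⟩ := eWord_split h
  simp [List.countP_append, List.countP_cons]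
  split_ifs <;> omega

theorem countP_lt_eWord {i v : ℕ} {w w' : List ℕ} (h : eWord i w = some w') :
    w.countP (· < v) ≤ w'.countP (· < v) := by
  obtain ⟨a, b, rfl, rfl⟩ := eWord_split h
  simp [List.countP_append, List.countP_cons]
  split_ifs <;> omega

theorem countP_le_add_count (r : List ℕ) (i : ℕ) :
    r.countP (· ≤ i) + r.count (i + 1) = r.countP (· ≤ i + 1) := by
  induction r with
  | nil => simp
  | cons x r ih =>
    simp only [List.countP_cons, List.count_cons, beq_iff_eq, decide_eq_true_eq]
    split_ifs <;> omega

theorem countP_lt_add_count (r : List ℕ) (i : ℕ) :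
    r.countP (· < i) + r.count i = r.countP (· < i + 1) := by
  induction r with
  | nil => simp
  | cons x r ih =>
    simp only [List.countP_cons, List.count_cons, beq_iff_eq, decide_eq_true_eq]
    split_ifs <;> omega

theorem IsSemistandard.tail {r : List ℕ} {T : List (List ℕ)} (h : IsSemistandard (r :: T)) :
    IsSemistandard T := ⟨fun t ht => h.sorted t (by simp [ht]), h.chain.tail⟩

theorem isSemistandard_cons_eWord_head {i : ℕ} {s s' : List ℕ} {T : List (List ℕ)}
    (h : IsSemistandard (s :: T)) (hs : s'.Pairwise (· ≤ ·))
    (he : eWord i s.reverse = some s'.reverse) : IsSemistandard (s' :: T) := by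
  refine ⟨?_, ?_⟩
  · intro t ht
    rcases List.mem_cons.1 ht with rfl | ht
    · exact hs
    · exact h.sorted t (by simp [ht])
  · rcases T with _ | ⟨t, T⟩
    · simp
    · have h3 := List.isChain_cons_cons.1 h.chain
      refine List.isChain_cons_cons.2 ⟨fun v => (h3.1 v).trans ?_, h3.2⟩
      simpa using countP_lt_eWord (v := v) he

/-- By `hlt` the changed `-` is not cancelled by the row `r` above. If it lies in the next row `s`,
then `s` has more letters `i + 1` than `r` has letters `i`; with the column condition at `i + 1`
this leaves the unit of slack needed at `i`. -/
theorem isSemistandard_cons_eWord {i : ℕ} {r : List ℕ} {T : List (List ℕ)} {w : List ℕ}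
    (h : IsSemistandard (r :: T)) (hlt : phi i r.reverse < eps i (revRowWord T))
    (he : eWord i (revRowWord T) = some w) :
    ∃ T', w = revRowWord T' ∧ IsSemistandard (r :: T') ∧
      T'.map List.length = T.map List.length := by
  induction T generalizing r w with
  | nil => simp [revRowWord, eWord_eq, Sig.e] at he
  | cons s T ih =>
    have h2 : revRowWord (s :: T) = s.reverse ++ revRowWord T := rfl
    have hch := List.isChain_cons_cons.1 h.chain
    rw [h2, eWord_append] at he
    rw [h2, eps_append] at hlt
    split_ifs at he with hlt'
    · obtain ⟨v, hv, rfl⟩ := Option.map_eq_some_iff.1 he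
      obtain ⟨T', rfl, h3, h4⟩ := ih h.tail hlt' hv
      refine ⟨s :: T', rfl, ⟨?_, List.isChain_cons_cons.2 ⟨hch.1, h3.chain⟩⟩, by simp [h4]⟩
      intro t ht
      rcases List.mem_cons.1 ht with rfl | ht
      · exact h.sorted t (by simp)
      · exact h3.sorted t ht
    · obtain ⟨v, hv, rfl⟩ := Option.map_eq_some_iff.1 he
      have hs := h.sorted s (by simp)
      obtain ⟨s', rfl, h3, h4⟩ := eWord_reverse hs hv
      have h5 := isSemistandard_cons_eWord_head h.tail h3 hv
      refine ⟨s' :: T, rfl, ⟨?_, List.isChain_cons_cons.2 ⟨?_, h5.chain⟩⟩, by simp [h4]⟩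
      · intro t ht
        rcases List.mem_cons.1 ht with rfl | ht
        · exact h.sorted t (by simp)
        · exact h5.sorted t ht
      · intro v
        have h6 := countP_le_eWord (v := v) hv
        simp only [List.countP_reverse] at h6
        rw [h6]
        split_ifs with hvi
        · subst hvi
          have h7 := hch.1 (v + 1)
          rw [← countP_le_add_count, ← countP_lt_add_count] at h7
          have h8 := (eps_phi_reverse (i := v) hs).1
          have h9 := (eps_phi_reverse (i := v) (h.sorted r (by simp))).2
          omega
        · exact hch.1 v

theorem IsSemistandard.eWord {i : ℕ} {T : List (List ℕ)} {w : List ℕ} (h : IsSemistandard T)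
    (he : eWord i (revRowWord T) = some w) :
    ∃ T', w = revRowWord T' ∧ IsSemistandard T' ∧ T'.map List.length = T.map List.length := by
  rcases T with _ | ⟨s, T⟩
  · simp [revRowWord, eWord_eq, Sig.e] at he
  · have h2 : revRowWord (s :: T) = s.reverse ++ revRowWord T := rfl
    rw [h2, eWord_append] at he
    split_ifs at he with hlt
    · obtain ⟨v, hv, rfl⟩ := Option.map_eq_some_iff.1 he
      obtain ⟨T', rfl, h3, h4⟩ := isSemistandard_cons_eWord h hlt hv
      exact ⟨s :: T', rfl, h3, by simp [h4]⟩
    · obtain ⟨v, hv, rfl⟩ := Option.map_eq_some_iff.1 he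
      obtain ⟨s', rfl, h3, h4⟩ := eWord_reverse (h.sorted s (by simp)) hv
      exact ⟨s' :: T, rfl, isSemistandard_cons_eWord_head h h3 hv, by simp [h4]⟩

/-! ### Highest weight words and the invariance of the shape -/

/-- Row `j` consists of letters `a + j`. -/
def IsYamanouchi : ℕ → List (List ℕ) → Prop
  | _, [] => True
  | a, r :: T => (∀ c ∈ r, c = a) ∧ IsYamanouchi (a + 1) T

/-- A highest weight word in the letters `a, a + 1, …`. -/
structure IsHighest (a : ℕ) (w : List ℕ) : Prop where
  le : ∀ c ∈ w, a ≤ c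
  eps_eq : ∀ i, a ≤ i → eps i w = 0

theorem eps_phi_eq_zero {i : ℕ} {w : List ℕ} (h : ∀ c ∈ w, c ≠ i ∧ c ≠ i + 1) :
    eps i w = 0 ∧ phi i w = 0 := by
  induction w with
  | nil => simp [Sig.ep, Sig.ph]
  | cons c w ih =>
    have h1 := lsgn_eq_none.2 (h c (by simp))
    have h2 := ih fun d hd => h d (by simp [hd])
    simpa [Sig.ep, Sig.ph, h1] using h2

/-- Nothing precedes the first letter `c`, so for `c > a` it would be an uncancelled `-` of the
signature for `c - 1`. -/
theorem IsHighest.head_eq {a c : ℕ} {w : List ℕ} (h : IsHighest a (c :: w)) : c = a := by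
  by_contra hne
  have h1 := h.le c (by simp)
  have h2 := h.eps_eq (c - 1) (by omega)
  have h3 : lsgn (c - 1) c = some false := lsgn_eq_false.2 (by omega)
  simp [Sig.ep, h3] at h2

theorem IsHighest.of_append_left {a : ℕ} {u v : List ℕ} (h : IsHighest a (u ++ v)) :
    IsHighest a u := by
  refine ⟨fun c hc => h.le c (by simp [hc]), fun i hi => ?_⟩
  have := h.eps_eq i hi
  rw [eps_append] at this
  omega

/-- The first letter read is the last one of the top row; it equals `a`, hence so does the whole
row. The column condition makes the letters below larger than `a`. For `i > a` the top row has no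
sign, so the remaining rows are again of highest weight. -/
theorem IsSemistandard.isYamanouchi {T : List (List ℕ)} {a : ℕ} (h : IsSemistandard T)
    (hT : IsHighest a (revRowWord T)) : IsYamanouchi a T := by
  induction T generalizing a with
  | nil => trivial
  | cons r T ih =>
    have h2 : revRowWord (r :: T) = r.reverse ++ revRowWord T := rfl
    rw [h2] at hT
    have hr : ∀ c ∈ r, c = a := by
      have h3 := hT.of_append_left
      rcases List.eq_nil_or_concat r with rfl | ⟨r', x, rfl⟩
      · simp
      · have hx : x = a := by
          refine IsHighest.head_eq (w := r'.reverse) ?_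
          simpa using h3
        have hs := h.sorted _ (List.mem_cons_self)
        simp only [List.concat_eq_append, List.pairwise_append] at hs
        intro c hc
        refine le_antisymm ?_ (h3.le c (List.mem_reverse.2 hc))
        simp only [List.concat_eq_append, List.mem_append, List.mem_singleton] at hc
        rcases hc with hc | rfl
        · rw [← hx]; exact hs.2.2 c hc x (by simp)
        · exact hx.le
    refine ⟨hr, ih h.tail ⟨?_, ?_⟩⟩
    · have h0 : ∀ s ∈ r :: T, ∀ t, (s = r ∨ ∀ c ∈ s, a + 1 ≤ c) → Below s t →
          ∀ c ∈ t, a + 1 ≤ c := by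
        intro s _ t hst hb c hc
        have h3 := hb a
        have h4 : s.countP (· < a) = 0 := by
          rw [List.countP_eq_zero]
          intro d hd
          rcases hst with rfl | hst
          · simp [hr d hd]
          · have := hst d hd; simp; omega
        rw [h4, Nat.le_zero, List.countP_eq_zero] at h3
        have := h3 c hc
        simp at this
        omega
      have h1 : ∀ (U : List (List ℕ)) (s : List ℕ), s ∈ r :: T → (∀ t ∈ U, t ∈ r :: T) →
          (s = r ∨ ∀ c ∈ s, a + 1 ≤ c) →
          (s :: U).IsChain Below → ∀ t ∈ U, ∀ c ∈ t, a + 1 ≤ c := by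
        intro U
        induction U with
        | nil => simp
        | cons t U ihU =>
          intro s hs hU hsr hch t' ht'
          have hch' := List.isChain_cons_cons.1 hch
          have h5 := h0 s hs t hsr hch'.1
          rcases List.mem_cons.1 ht' with rfl | ht'
          · exact h5
          · exact ihU t (hU t (by simp)) (fun t' ht' => hU t' (by simp [ht'])) (Or.inr h5)
              hch'.2 t' ht'
      intro c hc
      obtain ⟨t, ht, hct⟩ := List.mem_flatMap.1 hc
      exact h1 T r (by simp) (by simp +contextual) (Or.inl rfl) h.chain t ht c (by simpa using hct)
    · intro i hi
      have h3 := hT.eps_eq i (by omega)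
      have h4 := (eps_phi_eq_zero (i := i) (w := r.reverse) fun c hc => by
        have := hr c (by simpa using hc); omega).2
      rw [eps_append] at h3
      omega

theorem IsYamanouchi.le {T : List (List ℕ)} {a : ℕ} (h : IsYamanouchi a T) :
    ∀ c ∈ revRowWord T, a ≤ c := by
  induction T generalizing a with
  | nil => simp [revRowWord]
  | cons r T ih =>
    intro c hc
    have h2 : revRowWord (r :: T) = r.reverse ++ revRowWord T := rfl
    rw [h2, List.mem_append, List.mem_reverse] at hc
    rcases hc with hc | hc
    · exact (h.1 c hc).ge
    · exact (Nat.le_succ a).trans (ih h.2 c hc)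

theorem IsYamanouchi.sorted {T : List (List ℕ)} {a : ℕ} (h : IsYamanouchi a T) :
    (revRowWord T).Pairwise (· ≤ ·) := by
  induction T generalizing a with
  | nil => simp [revRowWord]
  | cons r T ih =>
    have h2 : revRowWord (r :: T) = r.reverse ++ revRowWord T := rfl
    rw [h2, List.pairwise_append]
    refine ⟨?_, ih h.2, ?_⟩
    · rw [List.pairwise_reverse]
      refine List.Pairwise.imp_of_mem (R := fun _ _ => True) ?_ (by simp [List.pairwise_iff_getElem])
      intro x y hx hy _
      rw [h.1 x hx, h.1 y hy]
    · intro x hx y hy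
      rw [h.1 x (by simpa using hx)]
      exact (Nat.le_succ a).trans (h.2.le y hy)

theorem IsYamanouchi.sum_length {T : List (List ℕ)} {a : ℕ} (h : IsYamanouchi a T) (m N : ℕ)
    (hN : T.length ≤ N) : (T.map (fun r => r.length - m)).sum =
      ∑ j ∈ Finset.range N, ((revRowWord T).count (a + j) - m) := by
  induction T generalizing a N with
  | nil => simp [revRowWord]
  | cons r T ih =>
    obtain ⟨N, rfl⟩ : ∃ M, N = M + 1 := ⟨N - 1, by simp at hN; omega⟩
    have h2 : revRowWord (r :: T) = r.reverse ++ revRowWord T := rfl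
    rw [Finset.sum_range_succ', List.map_cons, List.sum_cons, ih h.2 N (by simpa using hN), add_comm]
    congr 1
    · refine Finset.sum_congr rfl fun j _ => ?_
      have : r.count (a + (j + 1)) = 0 := List.count_eq_zero_of_not_mem fun hc => by
        have := h.1 _ hc; omega
      rw [h2, List.count_append, List.count_reverse, this, zero_add]
      congr 2; omega
    · have h3 : r.count a = r.length := List.count_eq_length.2 fun c hc => (h.1 c hc).symm
      have h4 : (revRowWord T).count a = 0 := List.count_eq_zero_of_not_mem fun hc => by
        have := h.2.le _ hc; omega
      simp [h2, h3, h4]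

/-- Every word is Knuth equivalent to the row word of a semistandard tableau. -/
theorem exists_isSemistandard (w : List ℕ) :
    ∃ T, IsSemistandard T ∧ Knuth (revRowWord T) w := by
  obtain ⟨h1, h2⟩ := IsSemistandard.nil.insertWord w.reverse
  exact ⟨_, h1, by simpa [revRowWord] using h2.symm⟩

theorem IsHighest.congr {a : ℕ} {w w' : List ℕ} (h : IsHighest a w) (hk : Knuth w w') :
    IsHighest a w' :=
  ⟨fun c hc => h.le c (hk.perm.mem_iff.2 hc), fun i hi => by rw [← hk.eps, h.eps_eq i hi]⟩

/-- Highest weight words of the same weight are Knuth equivalent. -/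
theorem IsHighest.knuth {a : ℕ} {w w' : List ℕ} (h : IsHighest a w) (h' : IsHighest a w')
    (hp : w.Perm w') : Knuth w w' := by
  obtain ⟨T, hT, hk⟩ := exists_isSemistandard w
  obtain ⟨T', hT', hk'⟩ := exists_isSemistandard w'
  -- The word of a Yamanouchi tableau is sorted, so it is determined by the content.
  have h1 := (hT.isYamanouchi (h.congr hk.symm)).sorted
  have h2 := (hT'.isYamanouchi (h'.congr hk'.symm)).sorted
  have h3 : revRowWord T = revRowWord T' :=
    (hk.perm.trans (hp.trans hk'.perm.symm)).eq_of_pairwise (fun _ _ _ _ => le_antisymm) h1 h2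
  exact hk.symm.trans (h3 ▸ hk')

/-- The shape of the tableau of a word, as far as it matters for the energy function. -/
theorem east_unique {a m : ℕ} {w : List ℕ} (hw : ∀ c ∈ w, a ≤ c) {T T' : List (List ℕ)}
    (hT : IsSemistandard T) (hk : Knuth (revRowWord T) w) (hT' : IsSemistandard T')
    (hk' : Knuth (revRowWord T') w) :
    (T.map (fun r => r.length - m)).sum = (T'.map (fun r => r.length - m)).sum := by
  -- As long as `w` is not of highest weight, it is raised and both tableaux follow with unchanged
  -- shapes. At highest weight the row lengths are the multiplicities of the letters.
  induction hn : w.sum using Nat.strong_induction_on generalizing w T T' with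
  | _ n ih =>
    by_cases h : ∃ i, a ≤ i ∧ eps i w ≠ 0
    · obtain ⟨i, hi, he⟩ := h
      obtain ⟨w₁, hw₁⟩ : ∃ w₁, eWord i w = some w₁ := by
        rw [← Option.ne_none_iff_exists']; exact fun h => he (eWord_eq_none.1 h)
      obtain ⟨v, hv, hkv⟩ := hk.symm.eWord hw₁
      obtain ⟨v', hv', hkv'⟩ := hk'.symm.eWord hw₁
      obtain ⟨U, rfl, hU, hlen⟩ := hT.eWord hv
      obtain ⟨U', rfl, hU', hlen'⟩ := hT'.eWord hv'
      have h1 := ih w₁.sum (hn ▸ sum_eWord hw₁) (le_of_mem_eWord hw₁ hi hw) hU hkv.symm hU'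
        hkv'.symm rfl
      have h2 : ∀ V : List (List ℕ), V.map (fun r => r.length - m) =
          (V.map List.length).map (fun x => x - m) := fun V => by simp
      rw [h2 T, h2 T', ← hlen, ← hlen', ← h2, ← h2, h1]
    · push Not at h
      have hh : IsHighest a w := ⟨hw, h⟩
      have h1 := hT.isYamanouchi (hh.congr hk.symm)
      have h2 := hT'.isYamanouchi (hh.congr hk'.symm)
      rw [h1.sum_length m (max T.length T'.length) (le_max_left _ _),
        h2.sum_length m (max T.length T'.length) (le_max_right _ _)]
      refine Finset.sum_congr rfl fun j _ => ?_
      rw [hk.perm.count_eq, hk'.perm.count_eq]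

end BoxBall

namespace BoxBall

/-! ### Columns -/

/-- Two neighbouring columns of a tableau, the right one first. -/
def ColGE (C D : List ℕ) : Prop := List.Forall₂ (· ≥ ·) C D

theorem ColGE.refl (C : List ℕ) : ColGE C C := List.forall₂_same.2 fun _ _ => le_rfl

theorem colGE_iff {C D : List ℕ} : ColGE C D ↔
    C.length = D.length ∧ ∀ i (h : i < C.length) (h' : i < D.length), D[i] ≤ C[i] := by
  rw [ColGE, List.forall₂_iff_get]
  simp only [List.get_eq_getElem, ge_iff_le]

theorem ColGE.trans {C D E : List ℕ} (h : ColGE C D) (h' : ColGE D E) : ColGE C E := by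
  rw [colGE_iff] at *
  exact ⟨h.1.trans h'.1, fun i hi hi' =>
    (h'.2 i (h.1 ▸ hi) hi').trans (h.2 i hi (h.1 ▸ hi))⟩

instance : IsTrans (List ℕ) ColGE := ⟨fun _ _ _ => ColGE.trans⟩

/-- The sign of a column in the `i`-signature. -/
def csgn (i : ℕ) (C : List ℕ) : Option Bool :=
  if i ∈ C then (if i + 1 ∈ C then none else some true)
  else if i + 1 ∈ C then some false else none

theorem csgn_eq_true {i : ℕ} {C : List ℕ} : csgn i C = some true ↔ i ∈ C ∧ i + 1 ∉ C := by
  unfold csgn; split_ifs <;> simp_all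

theorem csgn_eq_false {i : ℕ} {C : List ℕ} : csgn i C = some false ↔ i ∉ C ∧ i + 1 ∈ C := by
  unfold csgn; split_ifs <;> simp_all

/-- Replace `i + 1` by `i`. -/
def colDown (i : ℕ) (C : List ℕ) : List ℕ := C.map fun c => if c = i + 1 then i else c

/-- Replace `i` by `i + 1`. -/
def colUp (i : ℕ) (C : List ℕ) : List ℕ := C.map fun c => if c = i then i + 1 else c

theorem map_ite_of_not_mem {C : List ℕ} {x y : ℕ} (h : x ∉ C) :
    C.map (fun c => if c = x then y else c) = C := by
  conv_rhs => rw [← List.map_id C]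
  refine List.map_congr_left fun c hc => ?_
  rw [if_neg]; rfl
  rintro rfl; exact h hc

/-- In a strictly increasing column an `i` is immediately followed by the `i + 1`, if both occur,
and they cancel. So at most one sign survives. -/
theorem isBlockMap_column (i : ℕ) {C : List ℕ} (hC : C.Pairwise (· < ·)) :
    Sig.IsBlockMap (csgn i) (lsgn i) id C := by
  induction C with
  | nil => constructor <;> simp [csgn, Sig.ep, Sig.ph, Sig.toEp, Sig.toPh]
  | cons x C ih =>
    rw [List.pairwise_cons] at hC
    obtain ⟨h1, h2⟩ := ih hC.2
    simp only [id_eq] at h1 h2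
    rcases hx : lsgn i x with _ | _ | _
    · obtain ⟨h3, h4⟩ := lsgn_eq_none.1 hx
      have : csgn i (x :: C) = csgn i C := by
        simp [csgn, Ne.symm h3, Ne.symm h4]
      constructor <;> simp [Sig.ep, Sig.ph, hx, this, h1, h2]
    · obtain rfl := lsgn_eq_false.1 hx
      have h3 : i ∉ C := fun h => by have := hC.1 i h; omega
      have h4 : i + 1 ∉ C := fun h => by have := hC.1 _ h; omega
      have h5 : csgn i C = none := by simp [csgn, h3, h4]
      have h6 : csgn i ((i + 1) :: C) = some false := by simp [csgn, h3]
      rw [h5] at h1 h2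
      constructor <;> simp [Sig.ep, Sig.ph, hx, h1, h2, h6, Sig.toEp, Sig.toPh]
    · obtain rfl := lsgn_eq_true.1 hx
      have h3 : x ∉ C := fun h => by have := hC.1 x h; omega
      by_cases h4 : x + 1 ∈ C
      · have h5 : csgn x C = some false := by simp [csgn, h3, h4]
        have h6 : csgn x (x :: C) = none := by simp [csgn, h4]
        rw [h5] at h1 h2
        constructor <;> simp [Sig.ep, Sig.ph, hx, h1, h2, h6, Sig.toEp, Sig.toPh]
      · have h5 : csgn x C = none := by simp [csgn, h3, h4]
        have h6 : csgn x (x :: C) = some true := by simp [csgn, h4]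
        rw [h5] at h1 h2
        constructor <;> simp [Sig.ep, Sig.ph, hx, h1, h2, h6, Sig.toEp, Sig.toPh]

theorem e_column {i : ℕ} {C : List ℕ} (hC : C.Pairwise (· < ·)) (h : csgn i C = some false) :
    Sig.e (lsgn i) (fun _ => i) C = some (colDown i C) := by
  induction C with
  | nil => simp [csgn] at h
  | cons x C ih =>
    rw [List.pairwise_cons] at hC
    obtain ⟨h1, h2⟩ := csgn_eq_false.1 h
    simp only [List.mem_cons, not_or] at h1 h2
    rcases h2 with rfl | h2
    · have h4 : i + 1 ∉ C := fun h => by have := hC.1 _ h; omega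
      have h5 := (isBlockMap_column i hC.2).ep_eq
      have h6 : csgn i C = none := by simp [csgn, h1.2, h4]
      rw [h6] at h5
      simp only [id_eq, Sig.toEp] at h5
      simp [Sig.e, lsgn_succ, h5, colDown, map_ite_of_not_mem h4]
    · have hx : x ≠ i + 1 := fun hx => by have := hC.1 _ h2; omega
      have h3 : lsgn i x = none := lsgn_eq_none.2 ⟨Ne.symm h1.1, hx⟩
      simp [Sig.e, h3, ih hC.2 (csgn_eq_false.2 ⟨h1.2, h2⟩), colDown, hx]

theorem f_column {i : ℕ} {C : List ℕ} (hC : C.Pairwise (· < ·)) (h : csgn i C = some true) :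
    Sig.f (lsgn i) (fun _ => i + 1) C = some (colUp i C) := by
  induction C with
  | nil => simp [csgn] at h
  | cons x C ih =>
    rw [List.pairwise_cons] at hC
    obtain ⟨h1, h2⟩ := csgn_eq_true.1 h
    simp only [List.mem_cons, not_or] at h1 h2
    rcases h1 with rfl | h1
    · have h4 : i ∉ C := fun h => by have := hC.1 _ h; omega
      have h5 := (isBlockMap_column i hC.2).ep_eq
      have h6 : csgn i C = none := by simp [csgn, h2.2, h4]
      rw [h6] at h5
      simp only [id_eq, Sig.toEp] at h5
      simp [Sig.f, lsgn_self, h5, colUp, map_ite_of_not_mem h4]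
    · have hx : x ≠ i := fun hx => by have := hC.1 _ h1; omega
      have h3 : lsgn i x = none := lsgn_eq_none.2 ⟨hx, Ne.symm h2.1⟩
      simp [Sig.f, h3, ih hC.2 (csgn_eq_true.2 ⟨h1, h2.2⟩), colUp, hx]

/-- The columns of height `K` in the letters `a, …, b`. -/
structure IsCol (a b K : ℕ) (C : List ℕ) : Prop where
  length_eq : C.length = K
  strict : C.Pairwise (· < ·)
  bounds : ∀ c ∈ C, a ≤ c ∧ c ≤ b

theorem IsCol.colDown {a b K i : ℕ} {C : List ℕ} (h : IsCol a b K C) (ha : a ≤ i) (hi : i < b)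
    (hs : csgn i C = some false) : IsCol a b K (colDown i C) := by
  refine ⟨by simp [BoxBall.colDown, h.length_eq], ?_, ?_⟩
  · rw [BoxBall.colDown, List.pairwise_map]
    refine h.strict.imp_of_mem fun {x y} hx hy hxy => ?_
    have h1 : x ≠ i := by rintro rfl; exact (csgn_eq_false.1 hs).1 hx
    split_ifs <;> omega
  · intro c hc
    obtain ⟨d, hd, rfl⟩ := List.mem_map.1 hc
    have := h.bounds d hd
    split_ifs <;> omega

theorem IsCol.colUp {a b K i : ℕ} {C : List ℕ} (h : IsCol a b K C) (ha : a ≤ i) (hi : i < b)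
    (hs : csgn i C = some true) : IsCol a b K (colUp i C) := by
  refine ⟨by simp [BoxBall.colUp, h.length_eq], ?_, ?_⟩
  · rw [BoxBall.colUp, List.pairwise_map]
    refine h.strict.imp_of_mem fun {x y} hx hy hxy => ?_
    have h1 : y ≠ i + 1 := by rintro rfl; exact (csgn_eq_true.1 hs).2 hy
    split_ifs <;> omega
  · intro c hc
    obtain ⟨d, hd, rfl⟩ := List.mem_map.1 hc
    have := h.bounds d hd
    split_ifs <;> omega

theorem colGE_colDown_self (i : ℕ) (C : List ℕ) : ColGE C (colDown i C) := by
  rw [colGE_iff]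
  refine ⟨by simp [colDown], fun r h h' => ?_⟩
  simp only [colDown, List.getElem_map]
  split_ifs <;> omega

theorem colGE_colUp_self (i : ℕ) (C : List ℕ) : ColGE (colUp i C) C := by
  rw [colGE_iff]
  refine ⟨by simp [colUp], fun r h h' => ?_⟩
  simp only [colUp, List.getElem_map]
  split_ifs <;> omega

theorem getElem_lt_of_strict {C : List ℕ} (hC : C.Pairwise (· < ·)) {r r' : ℕ}
    (hr : r < C.length) (hr' : r' < C.length) : C[r] < C[r'] ↔ r < r' := by
  rw [List.pairwise_iff_getElem] at hC
  constructor
  · intro h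
    by_contra hcon
    rcases (not_lt.1 hcon).lt_or_eq with h1 | rfl
    · have := hC r' r hr' hr h1; omega
    · omega
  · exact hC r r' hr hr'

/-- A conflict could arise only if `D` had `i + 1` beside the lowered entry. As `D` is not a `-`
column, it then has an `i` further up, and the entry of `C` beside it is squeezed to `i`; but `C`
has no `i`. -/
theorem ColGE.colDown {i : ℕ} {C D : List ℕ} (h : ColGE C D) (hC : C.Pairwise (· < ·))
    (hD : D.Pairwise (· < ·)) (h₁ : csgn i C = some false) (h₂ : csgn i D ≠ some false) :
    ColGE (colDown i C) D := by
  rw [colGE_iff] at *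
  refine ⟨by simp [BoxBall.colDown, h.1], fun r hr hr' => ?_⟩
  have hrC : r < C.length := by simpa [BoxBall.colDown] using hr
  have h3 := h.2 r hrC hr'
  simp only [BoxBall.colDown, List.getElem_map]
  split_ifs with hc
  · by_contra hcon
    have hd : D[r] = i + 1 := by omega
    have hi : i ∈ D := by
      by_contra hi
      exact h₂ (csgn_eq_false.2 ⟨hi, hd ▸ List.getElem_mem _⟩)
    obtain ⟨s, hs, hsi⟩ := List.getElem_of_mem hi
    have hsr : s < r := (getElem_lt_of_strict hD hs hr').1 (by omega)
    have h4 := h.2 s (by omega) hs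
    have h5 := (getElem_lt_of_strict hC (by omega : s < C.length) hrC).2 hsr
    have : C[s] = i := by omega
    exact (csgn_eq_false.1 h₁).1 (this ▸ List.getElem_mem _)
  · exact h3

theorem ColGE.colUp {i : ℕ} {C D : List ℕ} (h : ColGE C D) (hC : C.Pairwise (· < ·))
    (hD : D.Pairwise (· < ·)) (h₁ : csgn i C ≠ some true) (h₂ : csgn i D = some true) :
    ColGE C (colUp i D) := by
  rw [colGE_iff] at *
  refine ⟨by simp [BoxBall.colUp, h.1], fun r hr hr' => ?_⟩
  have hrD : r < D.length := by simpa [BoxBall.colUp] using hr'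
  have h3 := h.2 r hr hrD
  simp only [BoxBall.colUp, List.getElem_map]
  split_ifs with hc
  · by_contra hcon
    have hd : C[r] = i := by omega
    have hi : i + 1 ∈ C := by
      by_contra hi
      exact h₁ (csgn_eq_true.2 ⟨hd ▸ List.getElem_mem _, hi⟩)
    obtain ⟨s, hs, hsi⟩ := List.getElem_of_mem hi
    have hsr : r < s := (getElem_lt_of_strict hC hr hs).1 (by omega)
    have h4 := h.2 s hs (by omega)
    have h5 := (getElem_lt_of_strict hD hrD (by omega : s < D.length)).2 hsr
    have : D[s] = i + 1 := by omega
    exact (csgn_eq_true.1 h₂).2 (this ▸ List.getElem_mem _)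
  · exact h3

/-- The columns of a tableau in reading order, i.e. from right to left. -/
structure IsColList (a b K l : ℕ) (cs : List (List ℕ)) : Prop where
  length_eq : cs.length = l
  isCol : ∀ C ∈ cs, IsCol a b K C
  chain : cs.IsChain ColGE

/-- The lowered column is the last one with a surviving `-`, so the column after it is not a `-`
column and `ColGE.colDown` applies. `B` stands for the column read before `cs`. -/
theorem e_isChain {i : ℕ} {B : List ℕ} {cs cs' : List (List ℕ)}
    (hs : ∀ C ∈ cs, C.Pairwise (· < ·)) (hc : (B :: cs).IsChain ColGE)
    (h : Sig.e (csgn i) (colDown i) cs = some cs') : (B :: cs').IsChain ColGE := by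
  induction cs generalizing B cs' with
  | nil => simp [Sig.e] at h
  | cons C cs ih =>
    have hc' := List.isChain_cons_cons.1 hc
    have key : ∀ v, Sig.e (csgn i) (colDown i) cs = some v →
        (B :: C :: v).IsChain ColGE := fun v hv =>
      List.isChain_cons_cons.2 ⟨hc'.1, ih (fun D hD => hs D (by simp [hD])) hc'.2 hv⟩
    simp only [Sig.e] at h
    rcases hC : csgn i C with _ | _ | _ <;> simp only [hC] at h
    · obtain ⟨v, hv, rfl⟩ := Option.map_eq_some_iff.1 h
      exact key v hv
    · split_ifs at h with h0
      · obtain ⟨v, hv, rfl⟩ := Option.map_eq_some_iff.1 h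
        exact key v hv
      · cases h
        refine List.isChain_cons_cons.2 ⟨hc'.1.trans (colGE_colDown_self i C), ?_⟩
        rcases cs with _ | ⟨D, cs⟩
        · simp
        · have hc'' := List.isChain_cons_cons.1 hc'.2
          refine List.isChain_cons_cons.2 ⟨?_, hc''.2⟩
          refine hc''.1.colDown (hs C (by simp)) (hs D (by simp)) hC fun hD => ?_
          simp [Sig.ep, hD] at h0
    · split_ifs at h with h0
      obtain ⟨v, hv, rfl⟩ := Option.map_eq_some_iff.1 h
      exact key v hv

/-- By `hBs` a `+` of `B` would be cancelled by the columns after it. The raised column is an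
uncancelled `+` followed by no uncancelled `-`; if it comes directly after `B`, then `B` is not a
`+` column. -/
theorem f_isChain {i : ℕ} {B : List ℕ} {cs cs' : List (List ℕ)} (hB : B.Pairwise (· < ·))
    (hs : ∀ C ∈ cs, C.Pairwise (· < ·)) (hc : (B :: cs).IsChain ColGE)
    (hBs : csgn i B = some true → Sig.ep (csgn i) cs ≠ 0)
    (h : Sig.f (csgn i) (colUp i) cs = some cs') : (B :: cs').IsChain ColGE := by
  induction cs generalizing B cs' with
  | nil => simp [Sig.f] at h
  | cons C cs ih =>
    have hc' := List.isChain_cons_cons.1 hc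
    have key : ∀ v, (csgn i C = some true → Sig.ep (csgn i) cs ≠ 0) →
        Sig.f (csgn i) (colUp i) cs = some v → (B :: C :: v).IsChain ColGE := fun v h0 hv =>
      List.isChain_cons_cons.2 ⟨hc'.1, ih (hs C (by simp)) (fun D hD => hs D (by simp [hD]))
        hc'.2 h0 hv⟩
    simp only [Sig.f] at h
    rcases hC : csgn i C with _ | _ | _ <;> simp only [hC] at h
    · obtain ⟨v, hv, rfl⟩ := Option.map_eq_some_iff.1 h
      exact key v (by simp [hC]) hv
    · obtain ⟨v, hv, rfl⟩ := Option.map_eq_some_iff.1 h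
      exact key v (by simp [hC]) hv
    · split_ifs at h with h0
      · cases h
        have hBC : ColGE B (colUp i C) := by
          refine hc'.1.colUp hB (hs C (by simp)) (fun hB' => hBs hB' ?_) hC
          simp [Sig.ep, hC, h0]
        refine List.isChain_cons_cons.2 ⟨hBC, ?_⟩
        rcases cs with _ | ⟨D, cs⟩
        · simp
        · have hc'' := List.isChain_cons_cons.1 hc'.2
          exact List.isChain_cons_cons.2 ⟨(colGE_colUp_self i C).trans hc''.1, hc''.2⟩
      · obtain ⟨v, hv, rfl⟩ := Option.map_eq_some_iff.1 h
        exact key v (fun _ => h0) hv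

theorem e_forall {P : List ℕ → Prop} {i : ℕ} {cs cs' : List (List ℕ)} (hs : ∀ C ∈ cs, P C)
    (hP : ∀ C, P C → csgn i C = some false → P (colDown i C))
    (h : Sig.e (csgn i) (colDown i) cs = some cs') : ∀ C ∈ cs', P C := by
  induction cs generalizing cs' with
  | nil => simp [Sig.e] at h
  | cons C cs ih =>
    have ih := @ih
    simp only [List.mem_cons, forall_eq_or_imp] at hs
    simp only [Sig.e] at h
    rcases hC : csgn i C with _ | _ | _ <;> simp only [hC] at h <;> (try split_ifs at h) <;>
      first
      | (obtain ⟨v, hv, rfl⟩ := Option.map_eq_some_iff.1 h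
         simpa [hs.1] using ih hs.2 hv)
      | (cases h; simpa using ⟨hP C hs.1 hC, hs.2⟩)

theorem f_forall {P : List ℕ → Prop} {i : ℕ} {cs cs' : List (List ℕ)} (hs : ∀ C ∈ cs, P C)
    (hP : ∀ C, P C → csgn i C = some true → P (colUp i C))
    (h : Sig.f (csgn i) (colUp i) cs = some cs') : ∀ C ∈ cs', P C := by
  induction cs generalizing cs' with
  | nil => simp [Sig.f] at h
  | cons C cs ih =>
    have ih := @ih
    simp only [List.mem_cons, forall_eq_or_imp] at hs
    simp only [Sig.f] at h
    rcases hC : csgn i C with _ | _ | _ <;> simp only [hC] at h <;> (try split_ifs at h) <;>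
      first
      | (obtain ⟨v, hv, rfl⟩ := Option.map_eq_some_iff.1 h
         simpa [hs.1] using ih hs.2 hv)
      | (cases h; simpa using ⟨hP C hs.1 hC, hs.2⟩)

theorem IsColList.eWord {a b K l i : ℕ} {cs : List (List ℕ)} (h : IsColList a b K l cs)
    (ha : a ≤ i) (hi : i < b) {w : List ℕ} (hw : eWord i cs.flatten = some w) :
    ∃ cs', IsColList a b K l cs' ∧ cs'.flatten = w := by
  have h1 := Sig.e_flatMap (s := csgn i) (d := colDown i) (t := lsgn i) (c := fun _ => i)
    (h := id) (w := cs) (fun C hC => isBlockMap_column i (h.isCol C hC).strict)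
    (fun C hC => e_column (h.isCol C hC).strict)
  rw [eWord_eq, ← List.flatMap_id, h1] at hw
  obtain ⟨v, hv, rfl⟩ := Option.map_eq_some_iff.1 hw
  refine ⟨v, ⟨(Sig.length_e hv).trans h.length_eq, ?_, ?_⟩, by simp⟩
  · exact e_forall h.isCol (fun C hC hs => hC.colDown ha hi hs) hv
  · rcases cs with _ | ⟨C, cs⟩
    · simp [Sig.e] at hv
    · exact (e_isChain (B := C) (fun D hD => (h.isCol D hD).strict)
        (List.isChain_cons_cons.2 ⟨ColGE.refl C, h.chain⟩) hv).tail

theorem IsColList.fWord {a b K l i : ℕ} {cs : List (List ℕ)} (h : IsColList a b K l cs)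
    (ha : a ≤ i) (hi : i < b) {w : List ℕ} (hw : fWord i cs.flatten = some w) :
    ∃ cs', IsColList a b K l cs' ∧ cs'.flatten = w := by
  have h1 := Sig.f_flatMap (s := csgn i) (d := colUp i) (t := lsgn i) (c := fun _ => i + 1)
    (h := id) (w := cs) (fun C hC => isBlockMap_column i (h.isCol C hC).strict)
    (fun C hC => f_column (h.isCol C hC).strict)
  rw [fWord_eq, ← List.flatMap_id, h1] at hw
  obtain ⟨v, hv, rfl⟩ := Option.map_eq_some_iff.1 hw
  refine ⟨v, ⟨(Sig.length_f hv).trans h.length_eq, ?_, ?_⟩, by simp⟩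
  · exact f_forall h.isCol (fun C hC hs => hC.colUp ha hi hs) hv
  · rcases cs with _ | ⟨C, cs⟩
    · simp [Sig.f] at hv
    · have hs : ∀ D ∈ C :: cs, D.Pairwise (· < ·) := fun D hD => (h.isCol D hD).strict
      simp only [Sig.f] at hv
      have key : ∀ v, (csgn i C = some true → Sig.ep (csgn i) cs ≠ 0) →
          Sig.f (csgn i) (colUp i) cs = some v → (C :: v).IsChain ColGE := fun v h0 hv =>
        f_isChain (hs C (by simp)) (fun D hD => hs D (by simp [hD])) h.chain h0 hv
      rcases hC : csgn i C with _ | _ | _ <;> simp only [hC] at hv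
      · obtain ⟨z, hz, rfl⟩ := Option.map_eq_some_iff.1 hv
        exact key z (by simp [hC]) hz
      · obtain ⟨z, hz, rfl⟩ := Option.map_eq_some_iff.1 hv
        exact key z (by simp [hC]) hz
      · split_ifs at hv with h0
        · cases hv
          rcases cs with _ | ⟨D, cs⟩
          · simp
          · have hc'' := List.isChain_cons_cons.1 h.chain
            exact List.isChain_cons_cons.2 ⟨(colGE_colUp_self i C).trans hc''.1, hc''.2⟩
        · obtain ⟨z, hz, rfl⟩ := Option.map_eq_some_iff.1 hv
          exact key z (fun _ => h0) hz

/-! ### Row words and column words -/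

theorem forall₂_dropLast {E D : List ℕ} {d : ℕ} (h : ColGE E D)
    (hD : (d :: D).Pairwise (· < ·)) : ColGE E (d :: D).dropLast := by
  induction h generalizing d with
  | nil => exact List.Forall₂.nil
  | @cons e d' E D hed _ ih =>
    rw [List.pairwise_cons] at hD
    rw [List.dropLast_cons_cons]
    exact List.Forall₂.cons ((hD.1 d' (by simp)).le.trans hed) (ih hD.2)

/-- A letter can be moved through a column if a smaller column follows. -/
theorem knuth_letter_column {E D : List ℕ} {x : ℕ} (h : ColGE E D)
    (hD : (x :: D).Pairwise (· < ·)) : Knuth (x :: (E ++ D)) (E ++ x :: D) := by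
  induction E generalizing x D with
  | nil => exact Knuth.refl _
  | cons e E ih =>
    rcases h with _ | ⟨hed, h⟩
    rename_i d D
    have hxD := hD
    rw [List.pairwise_cons] at hD
    have h1 : Knuth (x :: e :: (E ++ d :: D)) (x :: e :: d :: (E ++ D)) :=
      (ih h hD.2).symm.append_left [x, e]
    have h2 : Knuth (x :: e :: d :: (E ++ D)) (e :: x :: d :: (E ++ D)) :=
      (Knuth.left (hD.1 d (by simp)) hed).append_right (E ++ D)
    have h3 : Knuth (e :: x :: d :: (E ++ D)) (e :: x :: (E ++ d :: D)) :=
      (ih h hD.2).append_left [e, x]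
    -- `E` is now one letter shorter than `d :: D`, so the induction hypothesis is applied to `d ::
    -- D` without its last letter.
    have h4 : (d :: D).dropLast ++ [(d :: D).getLast (by simp)] = d :: D :=
      List.dropLast_append_getLast _
    have h5 : (x :: (d :: D).dropLast).Pairwise (· < ·) :=
      hxD.sublist (List.Sublist.cons_cons x (List.dropLast_sublist _))
    have h6 := ((ih (forall₂_dropLast h hD.2) h5).append_right
      [(d :: D).getLast (by simp)]).append_left [e]
    simp only [List.cons_append, List.append_assoc, List.nil_append, h4] at h6
    exact h1.trans (h2.trans (h3.trans h6))

theorem knuth_letter_columns {cs : List (List ℕ)} {D : List ℕ} {x : ℕ}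
    (h : (cs ++ [D]).Pairwise ColGE) (hs : ∀ E ∈ cs ++ [D], (x :: E).Pairwise (· < ·)) :
    Knuth (x :: (cs.flatten ++ D)) (cs.flatten ++ x :: D) := by
  induction cs using List.reverseRecOn generalizing D with
  | nil => exact Knuth.refl _
  | append_singleton cs E ih =>
    have h1 := ih (D := E) (h.sublist (by simp)) (fun F hF => hs F (by
      simp only [List.mem_append, List.mem_singleton] at hF ⊢; tauto))
    have hED : ColGE E D := (List.pairwise_append.1 h).2.2 E (by simp) D (by simp)
    have h2 := (knuth_letter_column hED (hs D (by simp))).append_left cs.flatten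
    have h3 := h1.append_right D
    simp only [List.flatten_append, List.flatten_cons, List.flatten_nil, List.append_nil,
      List.append_assoc, List.cons_append] at h2 h3 ⊢
    exact h3.trans h2

/-- This splits off the first row: the head of each new column travels left through the tails of the
columns already treated. Iteration yields the row word. -/
theorem knuth_heads_tails {cs : List (List ℕ)} (h : cs.Pairwise ColGE)
    (hs : ∀ C ∈ cs, C.Pairwise (· < ·)) (hne : ∀ C ∈ cs, C ≠ []) :
    Knuth cs.flatten (cs.map (·.getD 0 0) ++ (cs.map List.tail).flatten) := by
  induction cs using List.reverseRecOn with
  | nil => exact Knuth.refl _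
  | append_singleton cs C ih =>
    obtain ⟨x, D, rfl⟩ := List.exists_cons_of_ne_nil (hne C (by simp))
    have h1 := (ih (h.sublist (by simp)) (fun F hF => hs F (by simp [hF]))
      (fun F hF => hne F (by simp [hF]))).append_right (x :: D)
    have hp := List.pairwise_append.1 h
    have h2 := (knuth_letter_columns (cs := cs.map List.tail) (D := D) (x := x) ?_ ?_).append_left
      (cs.map (·.getD 0 0))
    · simp only [List.flatten_append, List.flatten_cons, List.flatten_nil, List.append_nil,
        List.append_assoc, List.map_append, List.map_cons, List.map_nil, List.cons_append,
        List.nil_append, List.tail_cons, List.getD_cons_zero] at h1 h2 ⊢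
      exact h1.trans h2.symm
    · have : (cs.map List.tail ++ [D]) = (cs ++ [x :: D]).map List.tail := by simp
      rw [this, List.pairwise_map]
      refine h.imp fun {E F} hEF => ?_
      rcases hEF with _ | ⟨_, hEF⟩
      · exact List.Forall₂.nil
      · exact hEF
    · intro E hE
      simp only [List.mem_append, List.mem_map, List.mem_singleton] at hE
      rcases hE with ⟨F, hF, rfl⟩ | rfl
      · have h3 := hp.2.2 F hF (x :: D) (by simp)
        have h4 := hs F (by simp [hF])
        rcases h3 with _ | ⟨h3, _⟩
        rw [List.pairwise_cons] at h4
        rw [List.tail_cons, List.pairwise_cons]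
        exact ⟨fun z hz => lt_of_le_of_lt h3 (h4.1 z hz), h4.2⟩
      · exact hs _ (by simp)

/-- Column word and row word of a rectangular tableau are Knuth equivalent. -/
theorem knuth_columnWord {K : ℕ} {cs : List (List ℕ)} (h : cs.Pairwise ColGE)
    (hs : ∀ C ∈ cs, C.Pairwise (· < ·)) (hK : ∀ C ∈ cs, C.length = K) :
    Knuth cs.flatten ((List.range K).flatMap fun i => cs.map (·.getD i 0)) := by
  induction K generalizing cs with
  | zero =>
    have : cs.flatten = [] := by
      rw [List.flatten_eq_nil_iff]; intro C hC; exact List.length_eq_zero_iff.1 (hK C hC)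
    simpa [this] using Knuth.refl _
  | succ K ih =>
    have h1 := knuth_heads_tails h hs fun C hC h0 => by
      have := hK C hC; simp [h0] at this
    refine h1.trans ?_
    rw [List.range_succ_eq_map, List.flatMap_cons]
    refine Knuth.append_left ?_ _
    have h2 := ih (cs := cs.map List.tail) ?_ ?_ ?_
    · convert h2 using 1
      rw [List.flatMap_map]
      refine List.flatMap_congr fun i _ => ?_
      rw [List.map_map]
      refine List.map_congr_left fun C hC => ?_
      rcases C with _ | ⟨x, C⟩
      · have := hK _ hC; simp at this
      · simp
    · rw [List.pairwise_map]
      refine h.imp fun {E F} hEF => ?_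
      rcases hEF with _ | ⟨_, hEF⟩
      · exact List.Forall₂.nil
      · exact hEF
    · intro C hC
      obtain ⟨D, hD, rfl⟩ := List.mem_map.1 hC
      exact (hs D hD).sublist (List.tail_sublist D)
    · intro C hC
      obtain ⟨D, hD, rfl⟩ := List.mem_map.1 hC
      simp [hK D hD]

end BoxBall

namespace BoxBall

variable {a b k l k' l' : ℕ}

/-! ### Tableaux and their columns -/

/-- The columns of a tableau, from right to left. -/
def Tab.cols (T : Tab a b k l) : List (List ℕ) :=
  (List.range l).reverse.map fun j => (List.range k).map fun i => T.entry i j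

theorem Tab.columnWord_eq (T : Tab a b k l) : T.columnWord = T.cols.flatten := by
  rw [Tab.columnWord, Tab.cols, List.flatMap_def]

theorem Tab.isColList (T : Tab a b k l) : IsColList a b k l T.cols := by
  refine ⟨by simp [Tab.cols], ?_, ?_⟩
  · intro C hC
    obtain ⟨j, hj, rfl⟩ := List.mem_map.1 hC
    have hj : j < l := by simpa using hj
    refine ⟨by simp, ?_, ?_⟩
    · rw [List.pairwise_map]
      refine List.pairwise_lt_range.imp_of_mem fun {x y} _ hy hxy => ?_
      exact T.entry_col hxy (by simpa using hy) hj
    · intro c hc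
      obtain ⟨i, hi, rfl⟩ := List.mem_map.1 hc
      exact T.entry_bounds (by simpa using hi) hj
  · rw [List.isChain_iff_pairwise, Tab.cols, List.pairwise_map, List.pairwise_reverse]
    refine List.pairwise_lt_range.imp_of_mem fun {x y} _ hy hxy => ?_
    rw [colGE_iff]
    refine ⟨by simp, fun i h h' => ?_⟩
    simp only [List.getElem_map, List.getElem_range]
    exact T.entry_row (by simpa using h) hxy (by simpa using hy)

theorem exists_tab {cs : List (List ℕ)} (h : IsColList a b k l cs) :
    ∃ T : Tab a b k l, T.cols = cs := by
  have hp := List.isChain_iff_pairwise.1 h.chain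
  have hlen : ∀ j, j < l → l - 1 - j < cs.length := fun j hj => by rw [h.length_eq]; omega
  have hcol : ∀ j (hj : j < l), IsCol a b k (cs[l - 1 - j]'(hlen j hj)) := fun j hj =>
    h.isCol _ (List.getElem_mem _)
  have hx : ∀ i (_ : i < k) j (hj : j < l), (cs.getD (l - 1 - j) []).getD i 0 =
      (cs[l - 1 - j]'(hlen j hj))[i]'((hcol j hj).length_eq ▸ ‹i < k›) := by
    intro i hi j hj
    rw [List.getD_eq_getElem _ _ (hlen j hj), List.getD_eq_getElem]
  -- Columns are listed from right to left, hence the index `l - 1 - j`.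
  refine ⟨Tab.mk (fun i j => (cs.getD (l - 1 - j) []).getD i 0) ?_ ?_ ?_, ?_⟩
  · intro i hi j hj
    rw [hx i hi j hj]
    exact (hcol j hj).bounds _ (List.getElem_mem _)
  · intro i hi j₁ j₂ hj hj₂
    rw [hx i hi j₁ (hj.trans hj₂), hx i hi j₂ hj₂]
    exact (colGE_iff.1 (List.pairwise_iff_getElem.1 hp (l - 1 - j₂) (l - 1 - j₁)
      (hlen _ hj₂) (hlen _ (hj.trans hj₂)) (by omega))).2 i _ _
  · intro j hj i₁ i₂ hi hi₂
    rw [hx i₁ (hi.trans hi₂) j hj, hx i₂ hi₂ j hj]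
    exact (getElem_lt_of_strict (hcol j hj).strict _ _).2 hi
  · refine List.ext_getElem (by simp [Tab.cols, h.length_eq]) fun j hj hj' => ?_
    have hjl : j < l := h.length_eq ▸ hj'
    have h1 := h.isCol cs[j] (List.getElem_mem _)
    refine List.ext_getElem (by simp [Tab.cols, h1.length_eq]) fun i hi hi' => ?_
    have hik : i < k := h1.length_eq ▸ hi'
    simp only [Tab.cols, List.getElem_map, List.getElem_reverse, List.getElem_range,
      List.length_range, Tab.entry_mk]
    rw [if_pos ⟨hik, by omega⟩, hx i hik _ (by omega)]
    congr 2
    omega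

theorem Tab.ext {T T' : Tab a b k l} (h : ∀ i < k, ∀ j < l, T.entry i j = T'.entry i j) :
    T = T' := by
  refine Subtype.ext (SemistandardYoungTableau.ext fun i j => ?_)
  by_cases hij : i < k ∧ j < l
  · exact h i hij.1 j hij.2
  · rw [T.1.zeros (by rwa [mem_rect]), T'.1.zeros (by rwa [mem_rect])]

theorem Tab.cols_injective : Function.Injective (Tab.cols : Tab a b k l → _) := by
  intro T T' h
  refine Tab.ext fun i hi j hj => ?_
  have h1 := List.map_inj_left.1 h j (by simpa using hj)
  exact List.map_inj_left.1 h1 i (by simpa using hi)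

theorem Tab.columnWord_injective : Function.Injective (Tab.columnWord : Tab a b k l → _) := by
  intro T T' h
  refine Tab.cols_injective (List.eq_iff_flatten_eq.2 ⟨?_, ?_⟩)
  · rw [← Tab.columnWord_eq, h, Tab.columnWord_eq]
  · simp [Tab.cols, Function.comp_def]

theorem Tab.length_columnWord (T : Tab a b k l) : T.columnWord.length = l * k := by
  simp [Tab.columnWord, List.length_flatMap]

theorem Tab.mem_columnWord (T : Tab a b k l) {c : ℕ} (hc : c ∈ T.columnWord) :
    a ≤ c ∧ c ≤ b := by
  rw [Tab.columnWord_eq, List.mem_flatten] at hc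
  obtain ⟨C, hC, hc⟩ := hc
  exact (T.isColList.isCol C hC).bounds c hc

theorem exists_tab_eWord {i : ℕ} (ha : a ≤ i) (hi : i < b) (T : Tab a b k l) {w : List ℕ}
    (hw : eWord i T.columnWord = some w) : ∃ T' : Tab a b k l, T'.columnWord = w := by
  rw [Tab.columnWord_eq] at hw
  obtain ⟨cs, hcs, rfl⟩ := T.isColList.eWord ha hi hw
  obtain ⟨T', rfl⟩ := exists_tab hcs
  exact ⟨T', T'.columnWord_eq⟩

theorem exists_tab_fWord {i : ℕ} (ha : a ≤ i) (hi : i < b) (T : Tab a b k l) {w : List ℕ}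
    (hw : fWord i T.columnWord = some w) : ∃ T' : Tab a b k l, T'.columnWord = w := by
  rw [Tab.columnWord_eq] at hw
  obtain ⟨cs, hcs, rfl⟩ := T.isColList.fWord ha hi hw
  obtain ⟨T', rfl⟩ := exists_tab hcs
  exact ⟨T', T'.columnWord_eq⟩

theorem tensorWord_injective :
    Function.Injective (tensorWord : Tab a b k l × Tab a b k' l' → _) := by
  rintro ⟨x, y⟩ ⟨x', y'⟩ h
  obtain ⟨h1, h2⟩ := List.append_inj h (by simp [Tab.length_columnWord])
  exact Prod.ext (Tab.columnWord_injective h1) (Tab.columnWord_injective h2)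

theorem mem_tensorWord {p : Tab a b k l × Tab a b k' l'} {c : ℕ} (hc : c ∈ tensorWord p) :
    a ≤ c ∧ c ≤ b := by
  rw [tensorWord, List.mem_append] at hc
  exact hc.elim p.1.mem_columnWord p.2.mem_columnWord

theorem exists_tensor_eWord {i : ℕ} (ha : a ≤ i) (hi : i < b)
    (p : Tab a b k l × Tab a b k' l') {w : List ℕ} (hw : eWord i (tensorWord p) = some w) :
    ∃ q : Tab a b k l × Tab a b k' l', tensorWord q = w := by
  rw [tensorWord, eWord_append] at hw
  split_ifs at hw
  · obtain ⟨v, hv, rfl⟩ := Option.map_eq_some_iff.1 hw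
    obtain ⟨T, rfl⟩ := exists_tab_eWord ha hi _ hv
    exact ⟨(p.1, T), rfl⟩
  · obtain ⟨v, hv, rfl⟩ := Option.map_eq_some_iff.1 hw
    obtain ⟨T, rfl⟩ := exists_tab_eWord ha hi _ hv
    exact ⟨(T, p.2), rfl⟩

theorem exists_tensor_fWord {i : ℕ} (ha : a ≤ i) (hi : i < b)
    (p : Tab a b k l × Tab a b k' l') {w : List ℕ} (hw : fWord i (tensorWord p) = some w) :
    ∃ q : Tab a b k l × Tab a b k' l', tensorWord q = w := by
  rw [tensorWord, fWord_append] at hw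
  split_ifs at hw
  · obtain ⟨v, hv, rfl⟩ := Option.map_eq_some_iff.1 hw
    obtain ⟨T, rfl⟩ := exists_tab_fWord ha hi _ hv
    exact ⟨(T, p.2), rfl⟩
  · obtain ⟨v, hv, rfl⟩ := Option.map_eq_some_iff.1 hw
    obtain ⟨T, rfl⟩ := exists_tab_fWord ha hi _ hv
    exact ⟨(p.1, T), rfl⟩

/-- The reading word is injective, so the choice made in `onTensor` is the only possible one. -/
theorem onTensor_eq_some {op : List ℕ → Option (List ℕ)} {p q : Tab a b k l × Tab a b k' l'} :
    onTensor op p = some q ↔ op (tensorWord p) = some (tensorWord q) := by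
  unfold onTensor
  split_ifs with h
  · rw [Option.some_inj]
    constructor
    · rintro rfl; exact h.choose_spec
    · intro h'
      exact tensorWord_injective (Option.some_inj.1 (h.choose_spec.symm.trans h'))
  · simp only [false_iff]
    exact fun h' => h ⟨q, h'⟩

theorem kashiwaraE_eq_some {i : ℕ} {p q : Tab a b k l × Tab a b k' l'} :
    kashiwaraE i p = some q ↔ eWord i (tensorWord p) = some (tensorWord q) := onTensor_eq_some

theorem kashiwaraF_eq_some {i : ℕ} {p q : Tab a b k l × Tab a b k' l'} :
    kashiwaraF i p = some q ↔ fWord i (tensorWord p) = some (tensorWord q) := onTensor_eq_some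

/-- The value `none` never arises from a word that has left the set of tableaux, since that set is
closed under the operators. -/
theorem kashiwaraE_eq_none {i : ℕ} (ha : a ≤ i) (hi : i < b) {p : Tab a b k l × Tab a b k' l'} :
    kashiwaraE i p = none ↔ eWord i (tensorWord p) = none := by
  constructor
  · intro h
    rw [← Option.not_isSome_iff_eq_none, Option.isSome_iff_exists]
    rintro ⟨w, hw⟩
    obtain ⟨q, rfl⟩ := exists_tensor_eWord ha hi p hw
    rw [kashiwaraE_eq_some.2 hw] at h
    cases h
  · intro h
    rw [← Option.not_isSome_iff_eq_none, Option.isSome_iff_exists]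
    rintro ⟨q, hq⟩
    rw [kashiwaraE_eq_some.1 hq] at h
    cases h

theorem kashiwaraF_eq_none {i : ℕ} (ha : a ≤ i) (hi : i < b) {p : Tab a b k l × Tab a b k' l'} :
    kashiwaraF i p = none ↔ fWord i (tensorWord p) = none := by
  constructor
  · intro h
    rw [← Option.not_isSome_iff_eq_none, Option.isSome_iff_exists]
    rintro ⟨w, hw⟩
    obtain ⟨q, rfl⟩ := exists_tensor_fWord ha hi p hw
    rw [kashiwaraF_eq_some.2 hw] at h
    cases h
  · intro h
    rw [← Option.not_isSome_iff_eq_none, Option.isSome_iff_exists]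
    rintro ⟨q, hq⟩
    rw [kashiwaraF_eq_some.1 hq] at h
    cases h

/-! ### The energy function -/

theorem Tab.isSemistandard_rows (T : Tab a b k l) : IsSemistandard T.rows := by
  constructor
  · intro r hr
    obtain ⟨i, hi, rfl⟩ := List.mem_map.1 hr
    rw [List.pairwise_map]
    refine List.pairwise_lt_range.imp_of_mem fun {x y} _ hy hxy => ?_
    exact T.entry_row (by simpa using hi) hxy (by simpa using hy)
  · rw [List.isChain_iff_getElem]
    intro i hi
    have hi' : i + 1 < k := by simpa [Tab.rows] using hi
    simp only [Tab.rows, List.getElem_map, List.getElem_range]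
    intro v
    rw [List.countP_map, List.countP_map]
    refine List.countP_mono_left fun j hj => ?_
    have := T.entry_col (Nat.lt_succ_self i) hi' (by simpa using hj)
    simp only [Function.comp_apply, decide_eq_true_eq]
    simp only [Nat.succ_eq_add_one] at this
    omega

theorem Tab.knuth_rows (T : Tab a b k l) : Knuth (revRowWord T.rows) T.columnWord := by
  have h := knuth_columnWord (K := k) (List.isChain_iff_pairwise.1 T.isColList.chain)
    (fun C hC => (T.isColList.isCol C hC).strict) (fun C hC => (T.isColList.isCol C hC).length_eq)
  rw [T.columnWord_eq]
  convert h.symm using 1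
  rw [revRowWord, Tab.rows, List.flatMap_map]
  refine List.flatMap_congr fun i hi => ?_
  rw [← List.map_reverse, Tab.cols, List.map_map]
  refine List.map_congr_left fun j _ => ?_
  have hi : i < k := by simpa using hi
  simp [hi]

/-- The number of cells east of column `m` in the tableau of a word. -/
def eastNum (m : ℕ) (w : List ℕ) : ℕ :=
  ((insertWord [] w.reverse).map (fun r => r.length - m)).sum

theorem eastNum_eq {m : ℕ} {w : List ℕ} {T : List (List ℕ)} (hT : IsSemistandard T)
    (hk : Knuth (revRowWord T) w) : eastNum m w = (T.map (fun r => r.length - m)).sum := by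
  obtain ⟨h1, h2⟩ := IsSemistandard.nil.insertWord w.reverse
  exact east_unique (a := 0) (fun _ _ => Nat.zero_le _) h1 (by simpa [revRowWord] using h2.symm)
    hT hk

/-- Row insertion consumes the reverse of the row word used here, and row and column words are Knuth
equivalent. So inserting `x` into `y` gives a tableau of the Knuth class of $x\otimes y$. -/
theorem eastCells_eq (x : Tab a b k l) (y : Tab a b k' l') :
    eastCells x y = eastNum (max l l') (tensorWord (x, y)) := by
  obtain ⟨h1, h2⟩ := y.isSemistandard_rows.insertWord x.rowWord
  refine (eastNum_eq h1 (h2.symm.trans ?_)).symm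
  have h3 : x.rowWord.reverse = revRowWord x.rows := by
    rw [Tab.rowWord, revRowWord, List.reverse_flatten, List.map_reverse, List.reverse_reverse,
      List.flatMap_def]
  rw [h3]
  exact x.knuth_rows.append y.knuth_rows

/-- Raising a semistandard tableau does not change its shape. -/
theorem eastNum_eWord {i m : ℕ} {w w' : List ℕ} (h : eWord i w = some w') :
    eastNum m w = eastNum m w' := by
  obtain ⟨T, hT, hk⟩ := exists_isSemistandard w
  obtain ⟨v, hv, hkv⟩ := hk.symm.eWord h
  obtain ⟨U, rfl, hU, hlen⟩ := hT.eWord hv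
  rw [eastNum_eq hT hk, eastNum_eq hU hkv.symm]
  have h2 : ∀ V : List (List ℕ), V.map (fun r => r.length - m) =
      (V.map List.length).map (fun x => x - m) := fun V => by simp
  rw [h2 T, h2 U, hlen]

theorem IsHighest.eastNum {m N : ℕ} {w : List ℕ} (h : IsHighest a w) (hN : ∀ c ∈ w, c < a + N) :
    eastNum m w = ∑ j ∈ Finset.range N, (w.count (a + j) - m) := by
  obtain ⟨T, hT, hk⟩ := exists_isSemistandard w
  rw [eastNum_eq hT hk, (hT.isYamanouchi (h.congr hk.symm)).sum_length m (max T.length N)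
    (le_max_left _ _)]
  symm
  refine Finset.sum_subset_zero_on_sdiff
    (Finset.range_subset_range.2 (le_max_right _ _)) ?_ ?_
  · intro j hj
    rw [hk.perm.count_eq, List.count_eq_zero_of_not_mem, Nat.zero_sub]
    intro hc
    have := hN _ hc
    simp only [Finset.mem_sdiff, Finset.mem_range] at hj
    omega
  · intro j _
    rw [hk.perm.count_eq]

theorem energy_eWord {i : ℕ} {p q : Tab a b k l × Tab a b k' l'}
    (h : eWord i (tensorWord p) = some (tensorWord q)) :
    energy p.1 p.2 = energy q.1 q.2 := by
  rw [energy, energy, eastCells_eq, eastCells_eq]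
  exact congrArg (fun x : ℕ => (x : ℤ) - _) (eastNum_eWord h)

end BoxBall

namespace BoxBall

variable {a b k l k' l' : ℕ}

/-! ### The combinatorial `R` and Knuth equivalence -/

theorem isHighest_or_exists_eWord (p : Tab a b k l × Tab a b k' l') :
    IsHighest a (tensorWord p) ∨ ∃ (i : ℕ) (q : Tab a b k l × Tab a b k' l'), a ≤ i ∧
      i < b ∧ eWord i (tensorWord p) = some (tensorWord q) := by
  by_cases h : ∃ i, a ≤ i ∧ eps i (tensorWord p) ≠ 0
  · obtain ⟨i, hi, he⟩ := h
    obtain ⟨w, hw⟩ : ∃ w, eWord i (tensorWord p) = some w := by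
      rw [← Option.ne_none_iff_exists']; exact fun h => he (eWord_eq_none.1 h)
    have hib : i < b := by
      obtain ⟨u, v, h1, -⟩ := eWord_split hw
      exact (mem_tensorWord (p := p) (c := i + 1) (by simp [h1])).2
    obtain ⟨q, rfl⟩ := exists_tensor_eWord hi hib p hw
    exact Or.inr ⟨i, q, hi, hib, hw⟩
  · push Not at h
    exact Or.inl ⟨fun c hc => (mem_tensorWord hc).1, h⟩

/-- Induction over a tensor product of crystals, starting from the highest weight elements. -/
theorem tensor_induction {P : Tab a b k l × Tab a b k' l' → Prop}
    (hw : ∀ p, IsHighest a (tensorWord p) → P p)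
    (step : ∀ i p q, a ≤ i → i < b → eWord i (tensorWord p) = some (tensorWord q) → P q → P p)
    (p : Tab a b k l × Tab a b k' l') : P p := by
  induction hn : (tensorWord p).sum using Nat.strong_induction_on generalizing p with
  | _ n ih =>
    rcases isHighest_or_exists_eWord p with h | ⟨i, q, hi, hib, h⟩
    · exact hw p h
    · exact step i p q hi hib h (ih _ (hn ▸ sum_eWord h) q rfl)

/-- Knuth equivalent elements are raised in parallel to highest weight, where `hm` identifies them;
the inverse operator `f` leads back on a unique path. -/
theorem tensor_eq_of_knuth
    (hm : ∀ p q : Tab a b k l × Tab a b k' l', IsHighest a (tensorWord p) →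
      IsHighest a (tensorWord q) → (tensorWord p).Perm (tensorWord q) → p = q)
    {p q : Tab a b k l × Tab a b k' l'} (h : Knuth (tensorWord p) (tensorWord q)) : p = q := by
  induction p using tensor_induction generalizing q with
  | hw p hp => exact hm p q hp (hp.congr h) h.perm
  | step i p p₁ hi hib he ih =>
    obtain ⟨w, hw, hk⟩ := h.eWord he
    obtain ⟨q₁, rfl⟩ := exists_tensor_eWord hi hib q hw
    rw [ih hk] at he
    exact tensorWord_injective (Option.some_inj.1 ((eWord_spec he).1.symm.trans (eWord_spec hw).1))

theorem exists_knuth_tensor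
    (ht : ∀ p : Tab a b k l × Tab a b k' l', IsHighest a (tensorWord p) →
      ∃ q : Tab a b k' l' × Tab a b k l, Knuth (tensorWord p) (tensorWord q))
    (p : Tab a b k l × Tab a b k' l') :
    ∃ q : Tab a b k' l' × Tab a b k l, Knuth (tensorWord p) (tensorWord q) := by
  induction p using tensor_induction with
  | hw p hp => exact ht p hp
  | step i p p₁ hi hib he ih =>
    obtain ⟨q₁, hq₁⟩ := ih
    obtain ⟨w, hw, hk⟩ := hq₁.fWord (eWord_spec he).1
    obtain ⟨q, rfl⟩ := exists_tensor_fWord hi hib q₁ hw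
    exact ⟨q, hk⟩

instance : Finite (Tab a b k l) := by
  refine Finite.of_injective (β := Fin k → Fin l → Fin (b + 1)) (fun T i j =>
    ⟨T.entry i j, Nat.lt_succ_of_le (T.entry_bounds i.2 j.2).2⟩) fun T T' h => ?_
  refine Tab.ext fun i hi j hj => ?_
  simpa using congrFun (congrFun h ⟨i, hi⟩) ⟨j, hj⟩

theorem IsCombinatorialR.isHighest {R : Tab a b k l × Tab a b k' l' → Tab a b k' l' × Tab a b k l}
    (hR : IsCombinatorialR R) {p : Tab a b k l × Tab a b k' l'} (hp : IsHighest a (tensorWord p)) :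
    IsHighest a (tensorWord (R p)) := by
  rcases isHighest_or_exists_eWord (R p) with h | ⟨i, q, hi, hib, h⟩
  · exact h
  · have h1 := hR.comm_e i hi hib p
    rw [(kashiwaraE_eq_none hi hib).2 (eWord_eq_none.2 (hp.eps_eq i hi)), Option.map_none,
      kashiwaraE_eq_none hi hib, h] at h1
    cases h1

theorem IsCombinatorialR.phi_eq {R : Tab a b k l × Tab a b k' l' → Tab a b k' l' × Tab a b k l}
    (hR : IsCombinatorialR R) {i : ℕ} (hi : a ≤ i) (hib : i < b) (p : Tab a b k l × Tab a b k' l') :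
    phi i (tensorWord (R p)) = phi i (tensorWord p) := by
  induction hn : phi i (tensorWord p) generalizing p with
  | zero =>
    have h1 := hR.comm_f i hi hib p
    rwa [(kashiwaraF_eq_none hi hib).2 (fWord_eq_none.2 hn), Option.map_none,
      kashiwaraF_eq_none hi hib, fWord_eq_none] at h1
  | succ n ih =>
    have h1 := hR.comm_f i hi hib p
    obtain ⟨w, hw⟩ : ∃ w, fWord i (tensorWord p) = some w := by
      rw [← Option.ne_none_iff_exists']; exact fun h => by have := fWord_eq_none.1 h; omega
    obtain ⟨q, rfl⟩ := exists_tensor_fWord hi hib p hw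
    rw [kashiwaraF_eq_some.2 hw, Option.map_some, kashiwaraF_eq_some] at h1
    have h2 := (fWord_spec hw).2.1
    rw [(fWord_spec h1).2.1, ih q (by omega)]

/-- The numbers $\varphi_i-\varepsilon_i$ are the differences of consecutive multiplicities, so the
multiplicities agree up to a constant, and the equal lengths make it zero. -/
theorem perm_of_phi_eq {w w' : List ℕ} (hl : w.length = w'.length)
    (hw : ∀ c ∈ w, a ≤ c ∧ c ≤ b) (hw' : ∀ c ∈ w', a ≤ c ∧ c ≤ b)
    (he : ∀ i, a ≤ i → i < b → eps i w = eps i w')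
    (hf : ∀ i, a ≤ i → i < b → phi i w = phi i w') : w.Perm w' := by
  have h1 : ∀ i, a ≤ i → i ≤ b → (w.count i : ℤ) - w'.count i = w.count a - w'.count a := by
    intro i hi
    induction i, hi using Nat.le_induction with
    | base => intros; rfl
    | succ i hi ih =>
      intro hib
      have h2 := phi_add_count i w
      have h3 := phi_add_count i w'
      have := he i hi hib
      have := hf i hi hib
      have := ih (by omega)
      omega
  have h2 : ∀ v : List ℕ, (∀ c ∈ v, a ≤ c ∧ c ≤ b) →
      ∑ i ∈ Finset.Icc a b, v.count i = v.length := fun v hv => by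
    have := Multiset.sum_count_eq_card (s := Finset.Icc a b) (m := (v : Multiset ℕ))
      (fun c hc => Finset.mem_Icc.2 (hv c (by simpa using hc)))
    simpa using this
  have h3 : ∑ i ∈ Finset.Icc a b, ((w.count i : ℤ) - w'.count i) = 0 := by
    rw [Finset.sum_sub_distrib, ← Nat.cast_sum, ← Nat.cast_sum, h2 w hw, h2 w' hw', hl, sub_self]
  rw [List.perm_iff_count]
  intro c
  by_cases hc : a ≤ c ∧ c ≤ b
  · rw [Finset.sum_congr rfl fun i hi => h1 i (Finset.mem_Icc.1 hi).1 (Finset.mem_Icc.1 hi).2,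
      Finset.sum_const, nsmul_eq_mul, mul_eq_zero] at h3
    have h4 := h1 c hc.1 hc.2
    rcases h3 with h3 | h3
    · simp at h3; omega
    · omega
  · rw [List.count_eq_zero_of_not_mem fun h => hc (hw c h),
      List.count_eq_zero_of_not_mem fun h => hc (hw' c h)]

theorem IsCombinatorialR.knuth {R : Tab a b k l × Tab a b k' l' → Tab a b k' l' × Tab a b k l}
    (hR : IsCombinatorialR R) (p : Tab a b k l × Tab a b k' l') :
    Knuth (tensorWord p) (tensorWord (R p)) := by
  induction p using tensor_induction with
  | hw p hp =>
    refine hp.knuth (hR.isHighest hp) (perm_of_phi_eq (a := a) (b := b) ?_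
      (fun c => mem_tensorWord) (fun c => mem_tensorWord) (fun i hi _ => ?_) (fun i hi hib => ?_))
    · simp [tensorWord, Tab.length_columnWord, add_comm]
    · rw [hp.eps_eq i hi, (hR.isHighest hp).eps_eq i hi]
    · exact (hR.phi_eq hi hib p).symm
  | step i p q hi hib he ih =>
    have h1 := hR.comm_e i hi hib p
    rw [kashiwaraE_eq_some.2 he, Option.map_some, kashiwaraE_eq_some] at h1
    obtain ⟨w, hw, hk⟩ := ih.fWord (eWord_spec he).1
    rwa [Option.some_inj.1 (hw.symm.trans (eWord_spec h1).1)] at hk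

/-- `hm` expresses that the product is multiplicity free, and `ht` that each of its highest weights
also occurs in the swapped product. The second conclusion is the form in which $R$ is used from here
on. -/
theorem existsUnique_combinatorialR
    (hm : ∀ p q : Tab a b k l × Tab a b k' l', IsHighest a (tensorWord p) →
      IsHighest a (tensorWord q) → (tensorWord p).Perm (tensorWord q) → p = q)
    (ht : ∀ p : Tab a b k l × Tab a b k' l', IsHighest a (tensorWord p) →
      ∃ q : Tab a b k' l' × Tab a b k l, Knuth (tensorWord p) (tensorWord q)) :
    (∃! R : Tab a b k l × Tab a b k' l' → Tab a b k' l' × Tab a b k l, IsCombinatorialR R) ∧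
    ∀ R : Tab a b k l × Tab a b k' l' → Tab a b k' l' × Tab a b k l, IsCombinatorialR R →
      ∀ p q, R p = q ↔ Knuth (tensorWord p) (tensorWord q) := by
  choose R₀ hR₀ using exists_knuth_tensor ht
  have hinj : Function.Injective R₀ := fun p q h =>
    tensor_eq_of_knuth hm ((hR₀ p).trans (h ▸ (hR₀ q).symm))
  -- After a swap of the factors `R₀` is an injective map of a finite set into itself.
  have hsurj : Function.Surjective R₀ := by
    have h1 : Function.Injective (R₀ ∘ Prod.swap) := hinj.comp Prod.swap_injective
    intro q
    obtain ⟨p, rfl⟩ := Finite.surjective_of_injective h1 q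
    exact ⟨p.swap, rfl⟩
  have huniq : ∀ p q, Knuth (tensorWord p) (tensorWord q) → R₀ p = q := by
    intro p q h
    obtain ⟨p', rfl⟩ := hsurj q
    rw [tensor_eq_of_knuth hm (h.trans (hR₀ p').symm)]
  have hall : ∀ R : Tab a b k l × Tab a b k' l' → Tab a b k' l' × Tab a b k l,
      IsCombinatorialR R → R = R₀ := fun R hR => funext fun p => (huniq p _ (hR.knuth p)).symm
  refine ⟨⟨R₀, ⟨⟨hinj, hsurj⟩, ?_, ?_⟩, hall⟩, ?_⟩
  · intro i hi hib p
    rcases hp : kashiwaraE i p with _ | q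
    · rw [Option.map_none, kashiwaraE_eq_none hi hib, eWord_eq_none, ← (hR₀ p).eps,
        ← eWord_eq_none, ← kashiwaraE_eq_none hi hib, hp]
    · rw [kashiwaraE_eq_some] at hp
      obtain ⟨w, hw, hk⟩ := (hR₀ p).eWord hp
      obtain ⟨q', rfl⟩ := exists_tensor_eWord hi hib _ hw
      rw [Option.map_some, kashiwaraE_eq_some, hw, huniq q q' hk]
  · intro i hi hib p
    rcases hp : kashiwaraF i p with _ | q
    · rw [Option.map_none, kashiwaraF_eq_none hi hib, fWord_eq_none, ← (hR₀ p).phi,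
        ← fWord_eq_none, ← kashiwaraF_eq_none hi hib, hp]
    · rw [kashiwaraF_eq_some] at hp
      obtain ⟨w, hw, hk⟩ := (hR₀ p).fWord hp
      obtain ⟨q', rfl⟩ := exists_tensor_fWord hi hib _ hw
      rw [Option.map_some, kashiwaraF_eq_some, hw, huniq q q' hk]
  · intro R hR p q
    constructor
    · rintro rfl; exact hR.knuth p
    · intro h; rw [hall R hR]; exact huniq p q h

/-! ### Highest weight elements -/

/-- The column `a, a + 1, …, a + K - 1`. -/
abbrev vacCol (a K : ℕ) : List ℕ := List.range' a K

theorem isCol_vacCol {K : ℕ} (h : a + K ≤ b + 1) : IsCol a b K (vacCol a K) :=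
  ⟨by simp, List.pairwise_lt_range', fun c hc => by
    rw [List.mem_range'_1] at hc; omega⟩

theorem IsCol.colGE_vacCol {K : ℕ} {C : List ℕ} (h : IsCol a b K C) : ColGE C (vacCol a K) := by
  rw [colGE_iff]
  refine ⟨by simp [h.length_eq], fun i hi _ => ?_⟩
  rw [List.getElem_range', one_mul]
  induction i with
  | zero => exact (h.bounds _ (List.getElem_mem _)).1
  | succ i ih =>
    have h1 := (getElem_lt_of_strict h.strict (by omega : i < C.length) hi).2 (by omega)
    have h2 := ih (by omega) (by simp; have := h.length_eq; omega)
    omega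

theorem ColGE.antisymm {C D : List ℕ} (h : ColGE C D) (h' : ColGE D C) : C = D := by
  rw [colGE_iff] at *
  exact List.ext_getElem h.1 fun i h1 h2 => le_antisymm (h'.2 i h2 h1) (h.2 i h1 h2)

theorem eq_vacCol_of_isHighest {C : List ℕ} (hs : C.Pairwise (· < ·)) (h : IsHighest a C) :
    C = vacCol a C.length := by
  induction C generalizing a with
  | nil => rfl
  | cons c C ih =>
    obtain rfl := h.head_eq
    rw [List.pairwise_cons] at hs
    rw [List.length_cons, vacCol, List.range'_succ]
    congr 1
    refine ih hs.2 ⟨fun d hd => hs.1 d hd, fun i hi => ?_⟩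
    have h1 := h.eps_eq i (by omega)
    have h2 : lsgn i c = none := lsgn_eq_none.2 (by omega)
    simpa [Sig.ep, h2] using h1

/-- The first column read is a prefix, hence of highest weight and equal to the smallest column. All
other columns are bounded above by it. -/
theorem IsColList.eq_replicate {K : ℕ} {cs : List (List ℕ)} (h : IsColList a b K l cs)
    (hw : IsHighest a cs.flatten) : cs = List.replicate l (vacCol a K) := by
  rw [List.eq_replicate_iff]
  refine ⟨h.length_eq, ?_⟩
  rcases cs with _ | ⟨C, cs⟩
  · simp
  · have hC := h.isCol C (by simp)
    have h1 : C = vacCol a K := by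
      rw [← hC.length_eq]
      exact eq_vacCol_of_isHighest hC.strict (IsHighest.of_append_left (v := cs.flatten) hw)
    intro D hD
    have hD' := (h.isCol D hD).colGE_vacCol
    refine hD'.antisymm ?_
    rcases List.mem_cons.1 hD with rfl | hD
    · rw [h1]; exact ColGE.refl _
    · rw [← h1]
      exact (List.pairwise_cons.1 (List.isChain_iff_pairwise.1 h.chain)).1 D hD

theorem csgn_vacCol {i K : ℕ} (hi : a ≤ i) :
    csgn i (vacCol a K) = if i + 1 = a + K then some true else none := by
  unfold csgn
  simp only [vacCol, List.mem_range'_1]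
  split_ifs <;> first | rfl | omega

theorem eps_phi_replicate_vacCol {i K : ℕ} (hi : a ≤ i) (m : ℕ) :
    eps i (List.replicate m (vacCol a K)).flatten = 0 ∧
    phi i (List.replicate m (vacCol a K)).flatten = if i + 1 = a + K then m else 0 := by
  have h := Sig.ep_flatMap (s := csgn i) (t := lsgn i) (h := id)
    (w := List.replicate m (vacCol a K)) (fun C hC => isBlockMap_column i (by
      rw [List.eq_of_mem_replicate hC]; exact List.pairwise_lt_range'))
  rw [List.flatMap_id] at h
  rw [eps, phi, h.1, h.2]
  clear h
  induction m with
  | zero => simp [Sig.ep, Sig.ph]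
  | succ m ih =>
    rw [List.replicate_succ]
    simp only [Sig.ep, Sig.ph, csgn_vacCol hi]
    split_ifs with h <;> simp only [h, if_true, if_false] at ih <;> simp [ih]

theorem eps_flatten_le {i : ℕ} {cs : List (List ℕ)} (h : ∀ C ∈ cs, C.Pairwise (· < ·)) :
    eps i cs.flatten ≤ cs.length := by
  have h1 := (Sig.ep_flatMap (s := csgn i) (t := lsgn i) (h := id) (w := cs)
    (fun C hC => isBlockMap_column i (h C hC))).1
  rw [List.flatMap_id] at h1
  rw [eps, h1]
  clear h1 h
  induction cs with
  | nil => simp [Sig.ep]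
  | cons C cs ih =>
    rcases h : csgn i C with _ | _ | _ <;> simp only [Sig.ep, h, List.length_cons] <;> omega

/-- The column list of `x` is known if `x ⊗ y` is a highest weight element. -/
theorem cols_fst_of_isHighest {p : Tab a b k l × Tab a b k' l'}
    (h : IsHighest a (tensorWord p)) : p.1.cols = List.replicate l (vacCol a k) :=
  p.1.isColList.eq_replicate (by
    rw [← Tab.columnWord_eq]; exact IsHighest.of_append_left (v := p.2.columnWord) h)

/-- Here `x` consists of `l` smallest columns, and `l - l'` of them are moved behind `y`. The
remaining `l'` still supply enough `+` signs, because each of the `l'` columns of `y` has at most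
one `-`. -/
theorem exists_knuth_of_isHighest (hl : l' ≤ l) (p : Tab a b k l × Tab a b k l')
    (h : IsHighest a (tensorWord p)) :
    ∃ q : Tab a b k l' × Tab a b k l, Knuth (tensorWord p) (tensorWord q) := by
  have h0 := cols_fst_of_isHighest h
  have hb : l ≠ 0 → a + k ≤ b + 1 ∨ k = 0 := by
    intro hl0
    rcases k.eq_zero_or_pos with rfl | hk
    · simp
    · left
      have h1 := p.1.isColList.isCol (vacCol a k) (by rw [h0]; simp [hl0])
      have := (h1.bounds (a + k - 1) (by rw [List.mem_range'_1]; omega)).2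
      omega
  have hcol : l ≠ 0 → IsCol a b k (vacCol a k) := by
    intro hl0
    rcases hb hl0 with h | rfl
    · exact isCol_vacCol h
    · exact ⟨rfl, List.Pairwise.nil, by simp⟩
  have hy := p.2.isColList
  have h1 : IsColList a b k l' (List.replicate l' (vacCol a k)) := by
    refine ⟨by simp, fun C hC => ?_, List.isChain_iff_pairwise.2 ?_⟩
    · rw [List.mem_replicate] at hC
      rw [hC.2]; exact hcol (by omega)
    · exact List.pairwise_replicate.2 (Or.inr (ColGE.refl _))
  have h2 : IsColList a b k l (p.2.cols ++ List.replicate (l - l') (vacCol a k)) := by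
    refine ⟨by simp [hy.length_eq, hl], fun C hC => ?_, List.isChain_iff_pairwise.2 ?_⟩
    · rcases List.mem_append.1 hC with hC | hC
      · exact hy.isCol C hC
      · rw [List.mem_replicate] at hC
        rw [hC.2]; exact hcol (by omega)
    · rw [List.pairwise_append]
      refine ⟨List.isChain_iff_pairwise.1 hy.chain,
        List.pairwise_replicate.2 (Or.inr (ColGE.refl _)), fun C hC D hD => ?_⟩
      rw [List.eq_of_mem_replicate hD]
      exact (hy.isCol C hC).colGE_vacCol
  obtain ⟨x, hx⟩ := exists_tab h1
  obtain ⟨y, hy'⟩ := exists_tab h2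
  refine ⟨(x, y), h.knuth ⟨fun c hc => (mem_tensorWord hc).1, fun i hi => ?_⟩ ?_⟩
  · have h3 := h.eps_eq i hi
    simp only [tensorWord, Tab.columnWord_eq, h0, hx, hy', List.flatten_append] at h3 ⊢
    rw [eps_append, (eps_phi_replicate_vacCol hi _).1, (eps_phi_replicate_vacCol hi _).2] at h3 ⊢
    rw [eps_append, (eps_phi_replicate_vacCol hi _).1]
    have h4 := eps_flatten_le (i := i) (cs := p.2.cols) fun C hC => (hy.isCol C hC).strict
    rw [hy.length_eq] at h4
    split_ifs at h3 ⊢ <;> omega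
  · simp only [tensorWord, Tab.columnWord_eq, h0, hx, hy', List.flatten_append]
    obtain ⟨m, rfl⟩ := Nat.exists_eq_add_of_le hl
    rw [Nat.add_sub_cancel_left, List.replicate_add, List.flatten_append, List.append_assoc]
    exact List.perm_append_comm.append_left _

/-- A tableau is determined by its content if all its rows but the last are known. -/
theorem Tab.eq_of_perm {T T' : Tab a b k l}
    (h : ∀ i, i + 1 < k → ∀ j < l, T.entry i j = T'.entry i j)
    (hp : T.columnWord.Perm T'.columnWord) : T = T' := by
  rcases k with _ | k
  · exact Tab.ext fun i hi => absurd hi (by omega)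
  have hp' := (T.knuth_rows.perm.trans hp).trans T'.knuth_rows.perm.symm
  simp only [revRowWord, Tab.rows, List.range_succ, List.map_append, List.flatMap_append,
    List.map_cons, List.map_nil, List.flatMap_cons, List.flatMap_nil, List.append_nil] at hp'
  have h1 : (List.range k).map (fun i => (List.range l).map fun j => T.entry i j) =
      (List.range k).map (fun i => (List.range l).map fun j => T'.entry i j) :=
    List.map_congr_left fun i hi => List.map_congr_left fun j hj =>
      h i (by simpa using hi) j (by simpa using hj)
  rw [h1, List.perm_append_left_iff] at hp'
  have hs : ∀ U : Tab a b (k + 1) l, ((List.range l).map fun j => U.entry k j).Pairwise (· ≤ ·) :=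
    fun U => U.isSemistandard_rows.sorted _ (List.mem_map.2 ⟨k, by simp, rfl⟩)
  have h2 := ((List.reverse_perm _).symm.trans (hp'.trans (List.reverse_perm _))).eq_of_pairwise
    (fun _ _ _ _ => le_antisymm) (hs T) (hs T')
  refine Tab.ext fun i hi j hj => ?_
  rcases (Nat.lt_succ_iff.1 hi).lt_or_eq with hi | rfl
  · exact h i (by omega) j hj
  · exact List.map_inj_left.1 h2 j (by simpa using hj)

theorem Tab.eq_of_perm_column {T T' : Tab a b k 1} (hp : T.columnWord.Perm T'.columnWord) :
    T = T' := by
  have hs : ∀ U : Tab a b k 1, U.columnWord.Pairwise (· < ·) := fun U => by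
    have h := (U.isColList.isCol _ (List.mem_map.2 ⟨0, by simp, rfl⟩)).strict
    simpa [Tab.columnWord] using h
  exact Tab.columnWord_injective (hp.eq_of_pairwise (le := (· < ·))
    (fun _ _ _ _ h h' => absurd h h'.asymm) (hs T) (hs T'))

theorem tensor_eq_of_isHighest {p q : Tab a b k l × Tab a b k' l'}
    (hp : IsHighest a (tensorWord p)) (hq : IsHighest a (tensorWord q))
    (h : (tensorWord p).Perm (tensorWord q))
    (H : p.2.columnWord.Perm q.2.columnWord → p.2 = q.2) : p = q := by
  have h1 : p.1 = q.1 := Tab.cols_injective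
    ((cols_fst_of_isHighest hp).trans (cols_fst_of_isHighest hq).symm)
  refine Prod.ext h1 (H ?_)
  rwa [tensorWord, tensorWord, h1, List.perm_append_left_iff] at h

/-- A column of `K` out of `K + 1` letters has only `i + 1` or `i + 2` in row `i`. In the first
column read, the topmost `i + 2` with `i + 1 < K` would be an uncancelled `-`, because the columns
of `x` supply `+` only for the index `K`. The other columns lie between this one and the smallest
column. -/
theorem entry_of_isHighest {K l l' : ℕ} {p : Tab 1 (K + 1) K l × Tab 1 (K + 1) K l'}
    (hp : IsHighest 1 (tensorWord p)) {i j : ℕ} (hi : i + 1 < K) (hj : j < l') :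
    p.2.entry i j = i + 1 := by
  have hy := p.2.isColList
  have hlast : ∀ i, i + 1 < K → p.2.entry i (l' - 1) = i + 1 := by
    intro i hi
    induction i using Nat.strong_induction_on with
    | _ i ih =>
      have hj0 : l' - 1 < l' := by omega
      set C := (List.range K).map fun i => p.2.entry i (l' - 1) with hC
      obtain ⟨cs, hcs⟩ : ∃ cs, p.2.cols = C :: cs := by
        obtain ⟨m, rfl⟩ : ∃ m, l' = m + 1 := ⟨l' - 1, by omega⟩
        exact ⟨_, by rw [Tab.cols, List.range_succ, List.reverse_append, List.map_append]; rfl⟩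
      have hCc := hy.isCol C (by simp [hcs])
      have h1 := hp.eps_eq (i + 1) (by omega)
      rw [tensorWord, Tab.columnWord_eq, Tab.columnWord_eq, cols_fst_of_isHighest hp, hcs,
        List.flatten_cons, eps_append, eps_append, (eps_phi_replicate_vacCol (by omega) _).2,
        if_neg (by omega)] at h1
      have h2 : eps (i + 1) C = 0 := by omega
      by_contra hne
      have hge : ∀ r < K, r + 1 ≤ p.2.entry r (l' - 1) := by
        intro r hr
        have := (colGE_iff.1 hCc.colGE_vacCol).2 r (by simpa [hC] using hr) (by simpa using hr)
        simp [hC] at this; omega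
      have hle : ∀ r < K, p.2.entry r (l' - 1) ≤ r + 2 := by
        intro r hr
        obtain ⟨d, hd⟩ : ∃ d, K = r + 1 + d := ⟨K - r - 1, by omega⟩
        induction d generalizing r with
        | zero => have := (p.2.entry_bounds hr hj0).2; omega
        | succ d ihd =>
          have h3 := ihd (r + 1) (by omega) (by omega)
          have h4 := p.2.entry_col (Nat.lt_succ_self r) (by omega : r + 1 < K) hj0
          simp only [Nat.succ_eq_add_one] at h4
          omega
      have h3 : p.2.entry i (l' - 1) = i + 2 := by
        have := hge i (by omega)
        have := hle i (by omega)
        omega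
      have h4 : csgn (i + 1) C = some false := by
        rw [csgn_eq_false]
        refine ⟨fun hm => ?_, List.mem_map.2 ⟨i, by simp; omega, h3⟩⟩
        obtain ⟨r, hr, hr'⟩ := List.mem_map.1 hm
        have hr : r < K := by simpa using hr
        rcases lt_trichotomy r i with hri | rfl | hri
        · have := ih r hri (by omega); omega
        · omega
        · have := hge r hr; omega
      have h5 := (isBlockMap_column (i + 1) hCc.strict).ep_eq
      rw [h4] at h5
      change eps (i + 1) C = 1 at h5
      omega
  have hj' := hlast i hi
  have h1 : p.2.entry i j ≤ p.2.entry i (l' - 1) := by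
    rcases (show j ≤ l' - 1 by omega).lt_or_eq with h | rfl
    · exact p.2.entry_row (by omega) h (by omega)
    · exact le_rfl
  have h2 := (hy.isCol _ (List.mem_map.2 ⟨j, by simpa using hj, rfl⟩)).colGE_vacCol
  have := (colGE_iff.1 h2).2 i (by simp; omega) (by simp; omega)
  simp at this
  omega

theorem combinatorialR_column (hl : 1 ≤ l) :
    (∃! R : Tab a b k l × Tab a b k 1 → Tab a b k 1 × Tab a b k l, IsCombinatorialR R) ∧
    ∀ R : Tab a b k l × Tab a b k 1 → Tab a b k 1 × Tab a b k l, IsCombinatorialR R →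
      ∀ p q, R p = q ↔ Knuth (tensorWord p) (tensorWord q) :=
  existsUnique_combinatorialR
    (fun _ _ hp hq h => tensor_eq_of_isHighest hp hq h Tab.eq_of_perm_column)
    (exists_knuth_of_isHighest hl)

theorem combinatorialR_row (hl : l' ≤ l) :
    (∃! R : Tab a b 1 l × Tab a b 1 l' → Tab a b 1 l' × Tab a b 1 l, IsCombinatorialR R) ∧
    ∀ R : Tab a b 1 l × Tab a b 1 l' → Tab a b 1 l' × Tab a b 1 l, IsCombinatorialR R →
      ∀ p q, R p = q ↔ Knuth (tensorWord p) (tensorWord q) :=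
  existsUnique_combinatorialR
    (fun _ _ hp hq h => tensor_eq_of_isHighest hp hq h
      (Tab.eq_of_perm fun _ hi => absurd hi (by omega)))
    (exists_knuth_of_isHighest hl)

theorem combinatorialR_corank_one {K : ℕ} (hl : l' ≤ l) :
    (∃! R : Tab 1 (K + 1) K l × Tab 1 (K + 1) K l' → Tab 1 (K + 1) K l' × Tab 1 (K + 1) K l,
      IsCombinatorialR R) ∧
    ∀ R : Tab 1 (K + 1) K l × Tab 1 (K + 1) K l' → Tab 1 (K + 1) K l' × Tab 1 (K + 1) K l,
      IsCombinatorialR R → ∀ p q, R p = q ↔ Knuth (tensorWord p) (tensorWord q) :=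
  existsUnique_combinatorialR
    (fun _ _ hp hq h => tensor_eq_of_isHighest hp hq h (Tab.eq_of_perm fun _ hi _ hj =>
      (entry_of_isHighest hp hi hj).trans (entry_of_isHighest hq hi hj).symm))
    (exists_knuth_of_isHighest hl)

end BoxBall

namespace BoxBall

/-! ### The carrier -/

/-- The reading word of a state. -/
def sitesWord {a b k l : ℕ} (p : List (Tab a b k l)) : List ℕ := p.flatMap Tab.columnWord

section
variable {a b k l : ℕ}

theorem sitesWord_cons (c : Tab a b k l) (p : List (Tab a b k l)) :
    sitesWord (c :: p) = c.columnWord ++ sitesWord p := rfl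

theorem sitesWord_append (p q : List (Tab a b k l)) :
    sitesWord (p ++ q) = sitesWord p ++ sitesWord q := List.flatMap_append

theorem length_sitesWord (p : List (Tab a b k l)) :
    (sitesWord p).length = p.length * (l * k) := by
  induction p with
  | nil => simp [sitesWord]
  | cons c p ih => rw [sitesWord_cons, List.length_append, ih, c.length_columnWord,
      List.length_cons]; ring

theorem sitesWord_injective {p q : List (Tab a b k l)} (h : sitesWord p = sitesWord q)
    (hl : p.length = q.length) : p = q := by
  induction p generalizing q with
  | nil => exact (List.length_eq_zero_iff.1 hl.symm).symm
  | cons c p ih =>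
    rcases q with _ | ⟨c', q⟩
    · simp at hl
    · rw [sitesWord_cons, sitesWord_cons] at h
      obtain ⟨h1, h2⟩ := List.append_inj h (by simp [Tab.length_columnWord])
      rw [Tab.columnWord_injective h1, ih h2 (by simpa using hl)]

theorem length_carry {B C : Type} (R : B × C → C × B) (x : B) (p : List C) :
    (carry R x p).1.length = p.length := by
  induction p generalizing x with
  | nil => rfl
  | cons c p ih => simp [carry, ih]

variable {l' : ℕ} {R : Tab a b k l × Tab a b k l' → Tab a b k l' × Tab a b k l}

theorem knuth_carry (hR : ∀ p q, R p = q ↔ Knuth (tensorWord p) (tensorWord q))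
    (x : Tab a b k l) (p : List (Tab a b k l')) :
    Knuth (x.columnWord ++ sitesWord p)
      (sitesWord (carry R x p).1 ++ (carry R x p).2.columnWord) := by
  induction p generalizing x with
  | nil => simpa [carry, sitesWord] using Knuth.refl _
  | cons c p ih =>
    have h1 := ((hR (x, c) _).1 rfl).append_right (sitesWord p)
    have h2 := (ih (R (x, c)).2).append_left (R (x, c)).1.columnWord
    simp only [tensorWord, List.append_assoc] at h1
    simpa only [carry, sitesWord_cons, List.append_assoc] using h1.trans h2

/-- The carrier commutes with the Kashiwara operators. -/
theorem eWord_carry (hR : ∀ p q, R p = q ↔ Knuth (tensorWord p) (tensorWord q))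
    {i : ℕ} (ha : a ≤ i) (hi : i < b) {x x' : Tab a b k l} {p p' : List (Tab a b k l')}
    (hl : p.length = p'.length)
    (h : eWord i (x.columnWord ++ sitesWord p) = some (x'.columnWord ++ sitesWord p')) :
    eWord i (sitesWord (carry R x p).1 ++ (carry R x p).2.columnWord) =
      some (sitesWord (carry R x' p').1 ++ (carry R x' p').2.columnWord) := by
  induction p generalizing x x' p' with
  | nil =>
    obtain rfl := List.length_eq_zero_iff.1 hl.symm
    simpa [carry, sitesWord] using h
  | cons c p ih =>
    rcases p' with _ | ⟨c', p'⟩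
    · simp at hl
    have hl' : p.length = p'.length := by simpa using hl
    have hc := (hR (x, c) _).1 rfl
    -- The first exchange replaces a prefix by a Knuth equivalent one with the same `phi`, so `e_i`
    -- acts on the same side of the cut. The rest of the run is treated below in the same way, by
    -- comparing `eps`.
    have key : eWord i ((R (x, c)).1.columnWord ++ ((R (x, c)).2.columnWord ++ sitesWord p)) =
        some ((R (x', c')).1.columnWord ++ ((R (x', c')).2.columnWord ++ sitesWord p')) := by
      rw [sitesWord_cons, sitesWord_cons, ← List.append_assoc, ← List.append_assoc,
        eWord_append] at h
      rw [← List.append_assoc, ← List.append_assoc, eWord_append]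
      change Knuth (x.columnWord ++ c.columnWord)
        ((R (x, c)).1.columnWord ++ (R (x, c)).2.columnWord) at hc
      rw [← hc.phi]
      split_ifs at h ⊢
      · obtain ⟨v, hv, h1⟩ := Option.map_eq_some_iff.1 h
        obtain ⟨h2, h3⟩ := List.append_inj h1 (by simp [Tab.length_columnWord])
        have h4 : (x, c) = (x', c') := tensorWord_injective h2
        rw [hv, h3, h4, Option.map_some]
      · obtain ⟨v, hv, h1⟩ := Option.map_eq_some_iff.1 h
        obtain ⟨h2, h3⟩ := List.append_inj h1 (by
          rw [length_eWord hv]; simp [Tab.length_columnWord])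
        subst h2
        obtain ⟨w, hw, hk⟩ := hc.eWord hv
        obtain ⟨q, rfl⟩ := exists_tensor_eWord ha hi (R (x, c)) hw
        rw [hw, h3, (hR (x', c') q).2 hk]
        rfl
    simp only [carry, sitesWord_cons, List.append_assoc]
    have hk := knuth_carry hR (R (x, c)).2 p
    rw [eWord_append] at key
    rw [eWord_append, ← hk.eps]
    split_ifs at key ⊢
    · obtain ⟨v, hv, h1⟩ := Option.map_eq_some_iff.1 key
      obtain ⟨h2, h3⟩ := List.append_inj h1 (by simp [Tab.length_columnWord])
      rw [ih hl' (hv.trans (congrArg some h3)), h2, Option.map_some]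
    · obtain ⟨v, hv, h1⟩ := Option.map_eq_some_iff.1 key
      obtain ⟨h2, h3⟩ := List.append_inj h1 (by
        rw [length_eWord hv]; simp [Tab.length_columnWord])
      obtain ⟨h4, h5⟩ := List.append_inj h3 (by simp [Tab.length_columnWord])
      rw [hv, h2, Tab.columnWord_injective h4, sitesWord_injective h5 hl', Option.map_some]

end

/-! ### Time evolution and Kashiwara operators -/

section
variable {n k l : ℕ} {h : k ≤ n}

theorem cols_vacuum (l : ℕ) : (vacuum h l).cols = List.replicate l (vacCol 1 k) := by
  rw [List.eq_replicate_iff]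
  refine ⟨by simp [Tab.cols], fun C hC => ?_⟩
  obtain ⟨j, hj, rfl⟩ := List.mem_map.1 hC
  have hj : j < l := by simpa using hj
  refine List.ext_getElem (by simp) fun i hi hi' => ?_
  have hi : i < k := by simpa using hi
  simp [vacuum, Tab.entry_mk, hi, hj, add_comm]

theorem eps_phi_vacuum {i : ℕ} (hi : 1 ≤ i) (hik : i ≠ k) (l : ℕ) :
    eps i (vacuum h l).columnWord = 0 ∧ phi i (vacuum h l).columnWord = 0 := by
  rw [Tab.columnWord_eq, cols_vacuum, (eps_phi_replicate_vacCol hi l).1,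
    (eps_phi_replicate_vacCol hi l).2, if_neg (by omega)]
  exact ⟨rfl, rfl⟩

theorem eWord_append_of_neutral_left {i : ℕ} {u : List ℕ} (hu : eps i u = 0 ∧ phi i u = 0)
    (w : List ℕ) : eWord i (u ++ w) = (eWord i w).map (u ++ ·) := by
  rw [eWord_append, hu.2]
  split_ifs with h
  · rfl
  · rw [eWord_eq_none.2 hu.1, eWord_eq_none.2 (by omega)]; rfl

theorem eWord_append_of_neutral_right {i : ℕ} {u : List ℕ} (hu : eps i u = 0 ∧ phi i u = 0)
    (w : List ℕ) : eWord i (w ++ u) = (eWord i w).map (· ++ u) := by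
  rw [eWord_append, hu.1, if_neg (Nat.not_lt_zero _)]

variable {R : Tab 1 n k l × Tab 1 n k 1 → Tab 1 n k 1 × Tab 1 n k l}

/-- For $i\ne k$ the vacuum carrier is neutral at the start. At the end `e_i` cannot act on the
carrier: the result would be the vacuum, which has $\varphi_i=0$ and so is not in the image of
$e_i$. -/
theorem eWord_timeEvolution (hR : ∀ p q, R p = q ↔ Knuth (tensorWord p) (tensorWord q))
    {i : ℕ} (hi : 1 ≤ i) (hin : i < n) (hik : i ≠ k) {p p' : List (Tab 1 n k 1)}
    (hl : p.length = p'.length) (he : eWord i (sitesWord p) = some (sitesWord p'))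
    (hf : finalCarrier h R p' = vacuum h l) :
    finalCarrier h R p = vacuum h l ∧
      eWord i (sitesWord (timeEvolution h R p)) = some (sitesWord (timeEvolution h R p')) := by
  have hv := eps_phi_vacuum (h := h) hi hik l
  have h1 := eWord_carry hR hi hin hl (x := vacuum h l) (x' := vacuum h l) (by
    rw [eWord_append_of_neutral_left hv, he, Option.map_some])
  rw [finalCarrier] at hf ⊢
  rw [hf, eWord_append] at h1
  split_ifs at h1 with hlt
  · obtain ⟨v, hv', h2⟩ := Option.map_eq_some_iff.1 h1
    obtain ⟨-, rfl⟩ := List.append_inj h2 (by simp [length_sitesWord, length_carry, hl])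
    have := (eWord_spec hv').2.2
    omega
  · obtain ⟨v, hv', h2⟩ := Option.map_eq_some_iff.1 h1
    obtain ⟨rfl, h3⟩ := List.append_inj h2 (by
      rw [length_eWord hv']; simp [length_sitesWord, length_carry, hl])
    exact ⟨Tab.columnWord_injective h3, hv'⟩

theorem length_timeEvolution (p : List (Tab 1 n k 1)) :
    (timeEvolution h R p).length = p.length := length_carry R _ p

theorem length_timeEvolution_iterate (t : ℕ) (p : List (Tab 1 n k 1)) :
    ((timeEvolution h R)^[t] p).length = p.length := by
  induction t generalizing p with
  | zero => rfl
  | succ t ih => rw [Function.iterate_succ_apply, ih, length_timeEvolution]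

theorem eWord_timeEvolution_iterate
    (hR : ∀ p q, R p = q ↔ Knuth (tensorWord p) (tensorWord q))
    {i : ℕ} (hi : 1 ≤ i) (hin : i < n) (hik : i ≠ k) {p p' : List (Tab 1 n k 1)}
    (hl : p.length = p'.length) (he : eWord i (sitesWord p) = some (sitesWord p')) (t : ℕ)
    (hf : ∀ s < t, finalCarrier h R ((timeEvolution h R)^[s] p') = vacuum h l) :
    (∀ s < t, finalCarrier h R ((timeEvolution h R)^[s] p) = vacuum h l) ∧
      eWord i (sitesWord ((timeEvolution h R)^[t] p)) =
        some (sitesWord ((timeEvolution h R)^[t] p')) := by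
  induction t with
  | zero => exact ⟨fun s hs => absurd hs (by omega), he⟩
  | succ t ih =>
    obtain ⟨h1, h2⟩ := ih fun s hs => hf s (by omega)
    obtain ⟨h3, h4⟩ := eWord_timeEvolution hR hi hin hik
      (by simp only [length_timeEvolution_iterate, hl]) h2 (hf t (by omega))
    refine ⟨fun s hs => ?_, by simpa only [Function.iterate_succ_apply'] using h4⟩
    rcases (Nat.lt_succ_iff.1 hs).lt_or_eq with hs | rfl
    · exact h1 s hs
    · exact h3

end

end BoxBall

namespace BoxBall

/-! ### States with two solitons -/

/-- The columns of a tableau as a list of sites. -/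
def Tab.sites {a b k l : ℕ} (T : Tab a b k l) : List (Tab a b k 1) :=
  List.ofFn fun s : Fin l => T.column (l - 1 - s) (by omega)

theorem Tab.length_sites {a b k l : ℕ} (T : Tab a b k l) : T.sites.length = l := by
  simp [Tab.sites]

theorem Tab.columnWord_column {a b k l : ℕ} (T : Tab a b k l) {j : ℕ} (hj : j < l) :
    (T.column j hj).columnWord = (List.range k).map fun i => T.entry i j := by
  simp only [Tab.columnWord, Tab.column, Tab.entry_mk, List.range_one, List.reverse_singleton,
    List.flatMap_cons, List.flatMap_nil, List.append_nil]
  refine List.map_congr_left fun i hi => ?_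
  rw [if_pos ⟨by simpa using hi, Nat.zero_lt_one⟩]

theorem Tab.sitesWord_sites {a b k l : ℕ} (T : Tab a b k l) :
    sitesWord T.sites = T.columnWord := by
  rw [T.columnWord_eq, sitesWord, List.flatMap_def]
  congr 1
  refine List.ext_getElem (by simp [Tab.cols, Tab.sites]) fun i hi hi' => ?_
  simp [Tab.sites, Tab.cols, Tab.columnWord_column]

variable {n k : ℕ} {h : k ≤ n}

theorem sitesWord_replicate_vacuum (x : ℕ) :
    sitesWord (List.replicate x (vacuum h 1)) = (List.replicate x (vacCol 1 k)).flatten := by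
  rw [sitesWord, List.flatMap_def, List.map_replicate, Tab.columnWord_eq, cols_vacuum]
  simp

theorem twoSolitonState_eq {d₁ d₂ : ℕ} (x g N : ℕ) (u : Soliton n k d₁) (v : Soliton n k d₂) :
    twoSolitonState h (x + d₁ + g + d₂ + N) x u ((x + d₁ + g : ℕ) : ℤ) v =
      List.replicate x (vacuum h 1) ++ (u.tableau h).sites ++ List.replicate g (vacuum h 1) ++
        (v.tableau h).sites ++ List.replicate N (vacuum h 1) := by
  refine List.ext_getElem (by simp [twoSolitonState, Tab.length_sites]; omega) fun s hs hs' => ?_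
  simp only [twoSolitonState, List.getElem_map, List.getElem_range, List.getElem_append,
    List.length_append, List.length_replicate, Tab.sites, List.length_ofFn,
    List.getElem_ofFn,
    List.getElem_replicate, twoSolitonSite]
  split_ifs <;> first | rfl | (exfalso; omega) | (congr 1; omega)

/-! ### Operators on the subwords of small and of large letters -/

/-- Two words with the same distribution of large and small letters agree if their small letters
and their large letters agree. -/
theorem eq_of_filter_eq {α : Type*} {q : α → Bool} {w w' : List α} (hm : w.map q = w'.map q)
    (h₁ : w.filter q = w'.filter q) (h₂ : w.filter (fun c => !q c) = w'.filter fun c => !q c) :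
    w = w' := by
  induction w generalizing w' with
  | nil => exact (List.map_eq_nil_iff.1 hm.symm).symm
  | cons c w ih =>
    rcases w' with _ | ⟨c', w'⟩
    · simp at hm
    simp only [List.map_cons, List.cons.injEq] at hm
    have hc := hm.1
    rcases hq : q c <;> rw [hq] at hc
    · rw [List.filter_cons_of_neg (by simp [hq]), List.filter_cons_of_neg (by simp [← hc])] at h₁
      rw [List.filter_cons_of_pos (by simp [hq]), List.filter_cons_of_pos (by simp [← hc])] at h₂
      obtain ⟨rfl, h3⟩ := List.cons.inj h₂
      rw [ih hm.2 h₁ h3]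
    · rw [List.filter_cons_of_neg (by simp [hq]), List.filter_cons_of_neg (by simp [← hc])] at h₂
      rw [List.filter_cons_of_pos (by simp [hq]), List.filter_cons_of_pos (by simp [← hc])] at h₁
      obtain ⟨rfl, h3⟩ := List.cons.inj h₁
      rw [ih hm.2 h3 h₂]

theorem eps_phi_filter {i : ℕ} {q : ℕ → Bool} (h₁ : q i) (h₂ : q (i + 1)) (w : List ℕ) :
    eps i (w.filter q) = eps i w ∧ phi i (w.filter q) = phi i w := by
  induction w with
  | nil => exact ⟨rfl, rfl⟩
  | cons c w ih =>
    by_cases hc : q c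
    · rw [List.filter_cons_of_pos hc]
      simp only [Sig.ep, Sig.ph, ih, and_self]
    · rw [List.filter_cons_of_neg hc]
      have h3 : lsgn i c = none := lsgn_eq_none.2
        ⟨by rintro rfl; exact hc h₁, by rintro rfl; exact hc h₂⟩
      simpa only [Sig.ep, Sig.ph, h3] using ih

/-- The operator sees only the letters `i` and `i + 1`, which belong to the subword. The other
letters and the pattern of positions are kept, so an action on the subword lifts to the word. -/
theorem eWord_filter {i : ℕ} {q : ℕ → Bool} (h₁ : q i) (h₂ : q (i + 1)) {w w' : List ℕ}
    (hm : w.map q = w'.map q) (hf : w.filter (fun c => !q c) = w'.filter fun c => !q c)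
    (he : eWord i (w.filter q) = some (w'.filter q)) : eWord i w = some w' := by
  have h3 : (eWord i w).map (List.filter q) = eWord i (w.filter q) := by
    clear hm hf he
    induction w with
    | nil => rfl
    | cons c w ih =>
      rw [eWord_eq, eWord_eq] at *
      by_cases hc : q c
      · rw [List.filter_cons_of_pos hc]
        have h4 := (eps_phi_filter h₁ h₂ w).1
        simp only [Sig.e]
        change Sig.ep _ _ = Sig.ep _ _ at h4
        rw [h4, ← ih]
        rcases lsgn i c with _ | _ | _ <;> simp only <;> (try split_ifs) <;>
          simp [Option.map_map, Function.comp_def, hc, h₁]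
      · rw [List.filter_cons_of_neg hc]
        have h3 : lsgn i c = none := lsgn_eq_none.2
          ⟨by rintro rfl; exact hc h₁, by rintro rfl; exact hc h₂⟩
        simp only [Sig.e, h3]
        rw [← ih, Option.map_map]
        congr 1
        funext v
        simp [hc]
  rw [he, Option.map_eq_some_iff] at h3
  obtain ⟨v, hv, h4⟩ := h3
  obtain ⟨a, b, rfl, rfl⟩ := eWord_split hv
  rw [hv]
  congr 1
  refine eq_of_filter_eq (q := q) ?_ h4 ?_
  · rw [← hm]; simp [h₁, h₂]
  · rw [← hf]; simp [h₁, h₂]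

namespace Soliton

variable {d : ℕ}

/-- Every column has `k - 1` small letters followed by one large letter. The pattern does not depend
on the soliton, so `upper` and `lower` can be changed independently. -/
theorem map_columnWord_tableau (u : Soliton n k d) :
    (u.tableau h).columnWord.map (fun c => decide (c ≤ k)) =
      (List.range d).reverse.flatMap fun _ =>
        (List.range k).map fun i => decide (i < k - 1) := by
  rw [Tab.columnWord, List.map_flatMap]
  refine List.flatMap_congr fun j hj => ?_
  have hj : j < d := by simpa using hj
  rw [List.map_map]
  refine List.map_congr_left fun i hi => ?_
  have hi : i < k := by simpa using hi
  simp only [Function.comp_apply, tableau, Tab.entry_mk, if_pos (And.intro hi hj)]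
  split_ifs with h1
  · simp [h1, u.upper.entry_bounds h1 hj]
  · have := u.lower.entry_bounds Nat.zero_lt_one hj
    simp [h1]; omega

theorem filter_le_columnWord_tableau (hk : 1 ≤ k) (u : Soliton n k d) :
    (u.tableau h).columnWord.filter (fun c => decide (c ≤ k)) = u.upper.columnWord := by
  obtain ⟨K, rfl⟩ : ∃ K, k = K + 1 := ⟨k - 1, by omega⟩
  rw [Tab.columnWord, List.filter_flatMap, Tab.columnWord]
  refine List.flatMap_congr fun j hj => ?_
  have hj : j < d := by simpa using hj
  have h1 : ∀ i < K, (u.tableau h).entry i j = u.upper.entry i j := fun i hi => by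
    simp only [tableau, Tab.entry_mk]
    rw [if_pos ⟨by omega, hj⟩, if_pos (by omega)]
  have h2 : (u.tableau h).entry K j = u.lower.entry 0 j := by
    simp only [tableau, Tab.entry_mk]
    rw [if_pos ⟨by omega, hj⟩, if_neg (by omega)]
  have h3 := u.lower.entry_bounds Nat.zero_lt_one hj
  rw [List.range_succ, List.map_append, List.filter_append, List.map_singleton, h2,
    List.map_congr_left (fun i hi => h1 i (by simpa using hi))]
  refine Eq.trans (congrArg₂ (· ++ ·) (List.filter_eq_self.2 ?_)
    (List.filter_cons_of_neg ?_)) (List.append_nil _)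
  · intro c hc
    obtain ⟨i, hi, rfl⟩ := List.mem_map.1 hc
    exact decide_eq_true (u.upper.entry_bounds (by simpa using hi) hj).2
  · simp; omega

theorem filter_gt_columnWord_tableau (hk : 1 ≤ k) (u : Soliton n k d) :
    (u.tableau h).columnWord.filter (fun c => !decide (c ≤ k)) = u.lower.columnWord := by
  obtain ⟨K, rfl⟩ : ∃ K, k = K + 1 := ⟨k - 1, by omega⟩
  rw [Tab.columnWord, List.filter_flatMap, Tab.columnWord]
  refine List.flatMap_congr fun j hj => ?_
  have hj : j < d := by simpa using hj
  have h1 : ∀ i < K, (u.tableau h).entry i j = u.upper.entry i j := fun i hi => by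
    simp only [tableau, Tab.entry_mk]
    rw [if_pos ⟨by omega, hj⟩, if_pos (by omega)]
  have h2 : (u.tableau h).entry K j = u.lower.entry 0 j := by
    simp only [tableau, Tab.entry_mk]
    rw [if_pos ⟨by omega, hj⟩, if_neg (by omega)]
  have h3 := u.lower.entry_bounds Nat.zero_lt_one hj
  rw [List.range_succ, List.map_append, List.filter_append, List.map_singleton, h2,
    List.map_congr_left (fun i hi => h1 i (by simpa using hi))]
  refine Eq.trans (congrArg₂ (· ++ ·) (List.filter_eq_nil_iff.2 ?_)
    (List.filter_cons_of_pos ?_)) rfl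
  · intro c hc
    obtain ⟨i, hi, rfl⟩ := List.mem_map.1 hc
    have := (u.upper.entry_bounds (by simpa using hi) hj).2
    simp; omega
  · simp; omega

theorem eps_phi_tableau_upper (hk : 1 ≤ k) {i : ℕ} (hi : i < k) (u : Soliton n k d) :
    eps i (u.tableau h).columnWord = eps i u.upper.columnWord ∧
      phi i (u.tableau h).columnWord = phi i u.upper.columnWord := by
  have := eps_phi_filter (i := i) (q := fun c => decide (c ≤ k)) (by simp; omega) (by simp; omega)
    (u.tableau h).columnWord
  rw [filter_le_columnWord_tableau hk] at this
  exact ⟨this.1.symm, this.2.symm⟩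

theorem eps_phi_tableau_lower (hk : 1 ≤ k) {i : ℕ} (hi : k < i) (u : Soliton n k d) :
    eps i (u.tableau h).columnWord = eps i u.lower.columnWord ∧
      phi i (u.tableau h).columnWord = phi i u.lower.columnWord := by
  have := eps_phi_filter (i := i) (q := fun c => !decide (c ≤ k)) (by simp; omega)
    (by simp; omega) (u.tableau h).columnWord
  rw [filter_gt_columnWord_tableau hk] at this
  exact ⟨this.1.symm, this.2.symm⟩

theorem eWord_tableau_upper (hk : 1 ≤ k) {i : ℕ} (hi : i < k) {u u' : Soliton n k d}
    (hl : u.lower = u'.lower) (he : eWord i u.upper.columnWord = some u'.upper.columnWord) :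
    eWord i (u.tableau h).columnWord = some (u'.tableau h).columnWord := by
  refine eWord_filter (q := fun c => decide (c ≤ k)) (by simp; omega) (by simp; omega) ?_ ?_ ?_
  · rw [map_columnWord_tableau, map_columnWord_tableau]
  · rw [filter_gt_columnWord_tableau hk, filter_gt_columnWord_tableau hk, hl]
  · rwa [filter_le_columnWord_tableau hk, filter_le_columnWord_tableau hk]

theorem eWord_tableau_lower (hk : 1 ≤ k) {i : ℕ} (hi : k < i) {u u' : Soliton n k d}
    (hl : u.upper = u'.upper) (he : eWord i u.lower.columnWord = some u'.lower.columnWord) :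
    eWord i (u.tableau h).columnWord = some (u'.tableau h).columnWord := by
  refine eWord_filter (q := fun c => !decide (c ≤ k)) (by simp; omega) (by simp; omega) ?_ ?_ ?_
  · have h1 := congrArg (List.map not) (map_columnWord_tableau (h := h) u)
    have h2 := congrArg (List.map not) (map_columnWord_tableau (h := h) u')
    rw [List.map_map] at h1 h2
    exact h1.trans h2.symm
  · simp only [Bool.not_not]
    rw [filter_le_columnWord_tableau hk, filter_le_columnWord_tableau hk, hl]
  · rwa [filter_gt_columnWord_tableau hk, filter_gt_columnWord_tableau hk]

end Soliton

/-- The state with solitons `u` and `v`, as a list of blocks. -/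
def solitonPair {d₁ d₂ : ℕ} (h : k ≤ n) (x : ℕ) (u : Soliton n k d₁) (g : ℕ) (v : Soliton n k d₂)
    (N : ℕ) : List (Tab 1 n k 1) :=
  List.replicate x (vacuum h 1) ++ (u.tableau h).sites ++ List.replicate g (vacuum h 1) ++
    (v.tableau h).sites ++ List.replicate N (vacuum h 1)

theorem length_solitonPair {d₁ d₂ : ℕ} (x g N : ℕ) (u : Soliton n k d₁) (v : Soliton n k d₂) :
    (solitonPair h x u g v N).length = x + d₁ + g + d₂ + N := by
  simp [solitonPair, Tab.length_sites, add_assoc]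

/-- The vacuum blocks have no surviving sign for $i\ne k$, so the soliton that is changed is the
same as in $u\otimes v$. -/
theorem eWord_solitonPair {d₁ d₂ i : ℕ} (hi : 1 ≤ i) (hik : i ≠ k) (x g N : ℕ)
    {u u' : Soliton n k d₁} {v v' : Soliton n k d₂}
    (he : eWord i ((u.tableau h).columnWord ++ (v.tableau h).columnWord) =
      some ((u'.tableau h).columnWord ++ (v'.tableau h).columnWord)) :
    eWord i (sitesWord (solitonPair h x u g v N)) =
      some (sitesWord (solitonPair h x u' g v' N)) := by
  have hN : ∀ m, eps i (List.replicate m (vacCol 1 k)).flatten = 0 ∧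
      phi i (List.replicate m (vacCol 1 k)).flatten = 0 := fun m => by
    rw [(eps_phi_replicate_vacCol hi m).1, (eps_phi_replicate_vacCol hi m).2, if_neg (by omega)]
    exact ⟨rfl, rfl⟩
  simp only [solitonPair, sitesWord_append, sitesWord_replicate_vacuum, Tab.sitesWord_sites,
    List.append_assoc]
  rw [eWord_append_of_neutral_left (hN x), eWord_append]
  rw [eWord_append] at he
  have h1 : eps i ((List.replicate g (vacCol 1 k)).flatten ++ ((v.tableau h).columnWord ++
      (List.replicate N (vacCol 1 k)).flatten)) = eps i (v.tableau h).columnWord := by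
    rw [eps_append, eps_append, (hN g).1, (hN g).2, (hN N).1]
    omega
  rw [h1]
  split_ifs at he ⊢
  · obtain ⟨w, hw, h2⟩ := Option.map_eq_some_iff.1 he
    obtain ⟨h3, rfl⟩ := List.append_inj h2 (by simp [Tab.length_columnWord])
    rw [eWord_append_of_neutral_left (hN g), eWord_append_of_neutral_right (hN N), hw, h3]
    rfl
  · obtain ⟨w, hw, h2⟩ := Option.map_eq_some_iff.1 he
    obtain ⟨rfl, h3⟩ := List.append_inj h2 (by
      rw [length_eWord hw]; simp [Tab.length_columnWord])
    rw [hw, h3]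
    rfl

theorem eWord_tableau_append_upper {d₁ d₂ i : ℕ} (hk : 1 ≤ k) (hi : i < k)
    {u u' : Soliton n k d₁} {v v' : Soliton n k d₂} (hu : u.lower = u'.lower)
    (hv : v.lower = v'.lower) (he : eWord i (tensorWord (u.upper, v.upper)) =
      some (tensorWord (u'.upper, v'.upper))) :
    eWord i ((u.tableau h).columnWord ++ (v.tableau h).columnWord) =
      some ((u'.tableau h).columnWord ++ (v'.tableau h).columnWord) := by
  rw [tensorWord, eWord_append] at he
  rw [eWord_append, (u.eps_phi_tableau_upper hk hi).2, (v.eps_phi_tableau_upper hk hi).1]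
  split_ifs at he ⊢
  · obtain ⟨w, hw, h2⟩ := Option.map_eq_some_iff.1 he
    obtain ⟨h3, rfl⟩ := List.append_inj h2 (by simp [Tab.length_columnWord])
    rw [Soliton.eWord_tableau_upper hk hi hv hw,
      show u = u' by cases u; cases u'; cases hu; cases Tab.columnWord_injective h3; rfl]
    rfl
  · obtain ⟨w, hw, h2⟩ := Option.map_eq_some_iff.1 he
    obtain ⟨rfl, h3⟩ := List.append_inj h2 (by
      rw [length_eWord hw]; simp [Tab.length_columnWord])
    rw [Soliton.eWord_tableau_upper hk hi hu hw,
      show v = v' by cases v; cases v'; cases hv; cases Tab.columnWord_injective h3; rfl]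
    rfl

theorem eWord_tableau_append_lower {d₁ d₂ i : ℕ} (hk : 1 ≤ k) (hi : k < i)
    {u u' : Soliton n k d₁} {v v' : Soliton n k d₂} (hu : u.upper = u'.upper)
    (hv : v.upper = v'.upper) (he : eWord i (tensorWord (u.lower, v.lower)) =
      some (tensorWord (u'.lower, v'.lower))) :
    eWord i ((u.tableau h).columnWord ++ (v.tableau h).columnWord) =
      some ((u'.tableau h).columnWord ++ (v'.tableau h).columnWord) := by
  rw [tensorWord, eWord_append] at he
  rw [eWord_append, (u.eps_phi_tableau_lower hk hi).2, (v.eps_phi_tableau_lower hk hi).1]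
  split_ifs at he ⊢
  · obtain ⟨w, hw, h2⟩ := Option.map_eq_some_iff.1 he
    obtain ⟨h3, rfl⟩ := List.append_inj h2 (by simp [Tab.length_columnWord])
    rw [Soliton.eWord_tableau_lower hk hi hv hw,
      show u = u' by cases u; cases u'; cases hu; cases Tab.columnWord_injective h3; rfl]
    rfl
  · obtain ⟨w, hw, h2⟩ := Option.map_eq_some_iff.1 he
    obtain ⟨rfl, h3⟩ := List.append_inj h2 (by
      rw [length_eWord hw]; simp [Tab.length_columnWord])
    rw [Soliton.eWord_tableau_lower hk hi hu hw,
      show v = v' by cases v; cases v'; cases hv; cases Tab.columnWord_injective h3; rfl]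
    rfl

/-! ### Reduction to highest weight -/

/-- The scattering `ζ^{c₁} u ⊗ ζ^{c₂} v → ζ^{c₂ - δ} v' ⊗ ζ^{c₁ + δ} u'`. -/
def Scatters {l d₁ d₂ : ℕ} (h : k ≤ n)
    (R : Tab 1 n k l × Tab 1 n k 1 → Tab 1 n k 1 × Tab 1 n k l)
    (u : Soliton n k d₁) (v : Soliton n k d₂) (u' : Soliton n k d₁) (v' : Soliton n k d₂)
    (δ : ℤ) : Prop :=
  ∀ c g₀ : ℕ, d₂ ≤ g₀ → ∃ t₀ : ℕ, ∀ t ≥ t₀, ∃ x g : ℕ,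
    (x : ℤ) = (c + d₁ + g₀ : ℕ) - δ + (min d₂ l : ℕ) * (t : ℤ) ∧
    ((x + d₂ + g : ℕ) : ℤ) = c + δ + (min d₁ l : ℕ) * (t : ℤ) ∧
    ∃ L₀, ∀ L ≥ L₀, ∃ N N', c + d₁ + g₀ + d₂ + N = L ∧ x + d₂ + g + d₁ + N' = L ∧
      (∀ s < t, finalCarrier h R
        ((timeEvolution h R)^[s] (solitonPair h c u g₀ v N)) = vacuum h l) ∧
      (timeEvolution h R)^[t] (solitonPair h c u g₀ v N) = solitonPair h x v' g u' N'

/-- The evolved state and the predicted state are raised by `e_i` to the same state, and `f_i`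
recovers both from it. The positions are not affected. -/
theorem Scatters.of_eWord {l d₁ d₂ i : ℕ}
    {R : Tab 1 n k l × Tab 1 n k 1 → Tab 1 n k 1 × Tab 1 n k l}
    (hR : ∀ p q, R p = q ↔ Knuth (tensorWord p) (tensorWord q))
    (hi : 1 ≤ i) (hin : i < n) (hik : i ≠ k)
    {u u₁ u' u₁' : Soliton n k d₁} {v v₁ v' v₁' : Soliton n k d₂} {δ : ℤ}
    (he : eWord i ((u.tableau h).columnWord ++ (v.tableau h).columnWord) =
      some ((u₁.tableau h).columnWord ++ (v₁.tableau h).columnWord))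
    (he' : eWord i ((v'.tableau h).columnWord ++ (u'.tableau h).columnWord) =
      some ((v₁'.tableau h).columnWord ++ (u₁'.tableau h).columnWord))
    (hs : Scatters h R u₁ v₁ u₁' v₁' δ) : Scatters h R u v u' v' δ := by
  intro c g₀ hg₀
  obtain ⟨t₀, ht₀⟩ := hs c g₀ hg₀
  refine ⟨t₀, fun t ht => ?_⟩
  obtain ⟨x, g, hx, hg, L₀, hL₀⟩ := ht₀ t ht
  refine ⟨x, g, hx, hg, L₀, fun L hL => ?_⟩
  obtain ⟨N, N', hN, hN', hf, hT⟩ := hL₀ L hL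
  obtain ⟨h1, h2⟩ := eWord_timeEvolution_iterate (h := h) hR hi hin hik
    (by simp only [length_solitonPair])
    (eWord_solitonPair (h := h) hi hik c g₀ N he) t hf
  refine ⟨N, N', hN, hN', h1, ?_⟩
  rw [hT] at h2
  have h3 := eWord_solitonPair (h := h) hi hik x g N' he'
  refine sitesWord_injective ?_ ?_
  · have h4 := (eWord_spec h2).1
    rw [(eWord_spec h3).1] at h4
    exact (Option.some_inj.1 h4).symm
  · rw [length_timeEvolution_iterate, length_solitonPair, length_solitonPair, hN, hN']

/-- It is enough to know the scattering of highest weight pairs. -/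
theorem scatters_of_isHighest {l d₁ d₂ : ℕ} (hk : 1 ≤ k)
    {R : Tab 1 n k l × Tab 1 n k 1 → Tab 1 n k 1 × Tab 1 n k l}
    (hR : ∀ p q, R p = q ↔ Knuth (tensorWord p) (tensorWord q))
    (H : ∀ (u u' : Soliton n k d₁) (v v' : Soliton n k d₂),
      IsHighest 1 (tensorWord (u.upper, v.upper)) →
      IsHighest (k + 1) (tensorWord (u.lower, v.lower)) →
      Knuth (tensorWord (u.upper, v.upper)) (tensorWord (v'.upper, u'.upper)) →
      Knuth (tensorWord (u.lower, v.lower)) (tensorWord (v'.lower, u'.lower)) →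
      Scatters h R u v u' v' (phaseShift u v))
    (u u' : Soliton n k d₁) (v v' : Soliton n k d₂)
    (hU : Knuth (tensorWord (u.upper, v.upper)) (tensorWord (v'.upper, u'.upper)))
    (hL : Knuth (tensorWord (u.lower, v.lower)) (tensorWord (v'.lower, u'.lower))) :
    Scatters h R u v u' v' (phaseShift u v) := by
  obtain ⟨uu, ul⟩ := u
  obtain ⟨vu, vl⟩ := v
  obtain ⟨uu', ul'⟩ := u'
  obtain ⟨vu', vl'⟩ := v'
  dsimp only at hU hL
  obtain ⟨p, hp⟩ : ∃ p : Tab 1 k (k - 1) d₁ × Tab 1 k (k - 1) d₂, p = (uu, vu) := ⟨_, rfl⟩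
  obtain ⟨q, hq⟩ : ∃ q : Tab (k + 1) n 1 d₁ × Tab (k + 1) n 1 d₂, q = (ul, vl) := ⟨_, rfl⟩
  -- The upper pair is raised first, then the lower pair. The outgoing pair follows because it is
  -- Knuth equivalent to the incoming one, and the phase shift is constant by `energy_eWord`.
  induction p using tensor_induction generalizing uu vu uu' vu' with
  | hw p hp' =>
    subst hp
    induction q using tensor_induction generalizing ul vl ul' vl' with
    | hw q hq' =>
      subst hq
      exact H _ _ _ _ hp' hq' hU hL
    | step i q q₁ hi hin he ih =>
      subst hq
      obtain ⟨w, hw, hk'⟩ := hL.eWord he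
      obtain ⟨⟨vl₁', ul₁'⟩, rfl⟩ := exists_tensor_eWord hi hin _ hw
      have h1 := ih q₁.1 q₁.2 ul₁' vl₁' hk' rfl
      have h2 : phaseShift ⟨uu, ul⟩ ⟨vu, vl⟩ = phaseShift ⟨uu, q₁.1⟩ ⟨vu, q₁.2⟩ := by
        simp only [phaseShift]
        rw [energy_eWord he]
      rw [h2]
      exact h1.of_eWord hR (by omega) hin (by omega)
        (eWord_tableau_append_lower hk (by omega) (u' := ⟨uu, q₁.1⟩) (v' := ⟨vu, q₁.2⟩) rfl rfl he)
        (eWord_tableau_append_lower hk (by omega) (u' := ⟨vu', vl₁'⟩) (v' := ⟨uu', ul₁'⟩)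
          rfl rfl hw)
  | step i p p₁ hi hin he ih =>
    subst hp
    obtain ⟨w, hw, hk'⟩ := hU.eWord he
    obtain ⟨⟨vu₁', uu₁'⟩, rfl⟩ := exists_tensor_eWord hi hin _ hw
    have h1 := ih p₁.1 p₁.2 uu₁' vu₁' hk' rfl
    have h2 : phaseShift ⟨uu, ul⟩ ⟨vu, vl⟩ = phaseShift ⟨p₁.1, ul⟩ ⟨p₁.2, vl⟩ := by
      simp only [phaseShift]
      rw [energy_eWord he]
    rw [h2]
    exact h1.of_eWord hR hi (by omega) (by omega)
      (eWord_tableau_append_upper hk hin (u' := ⟨p₁.1, ul⟩) (v' := ⟨p₁.2, vl⟩) rfl rfl he)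
      (eWord_tableau_append_upper hk hin (u' := ⟨vu₁', vl'⟩) (v' := ⟨uu₁', ul'⟩) rfl rfl hw)

end BoxBall

namespace BoxBall

/-! ### Columns of highest weight two-soliton states -/

/-- The columns occurring in the time evolution of a highest weight pair of solitons. -/
inductive Column
  | V | P | M | Q | W
  deriving DecidableEq

namespace Column

/-- The order of the columns. -/
def rank : Column → ℕ
  | V => 0
  | P => 1
  | M => 2
  | Q => 3
  | W => 4

/-- The rewriting rules which move a column to the left. -/
def rules : List (List Column × List Column) :=
  [([V, V, P], [V, P, V]), ([V, V, M], [V, M, V]), ([V, V, Q], [V, Q, V]), ([V, V, W], [V, W, V]),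
   ([P, V, P], [V, P, P]), ([M, V, P], [V, M, P]), ([Q, V, P], [V, Q, P]), ([M, V, M], [V, M, M]),
   ([Q, V, M], [V, Q, M]), ([Q, V, Q], [V, Q, Q]), ([W, V, W], [V, W, W]), ([P, V, W], [V, W, P]),
   ([W, V, P], [P, Q, P]), ([W, V, M], [P, Q, M]), ([W, V, Q], [P, Q, Q]),
   ([P, V, Q], [P, Q, V]), ([P, P, Q], [P, W, V]), ([P, P, W], [P, W, P]), ([W, P, Q], [P, W, Q]),
   ([W, P, W], [P, W, W]), ([P, V, M], [P, M, V]), ([P, P, M], [P, M, P]), ([M, P, M], [P, M, M]),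
   ([W, P, M], [P, W, M])]

end Column

open Column

/-- The carrier with `t` columns `W`, `s` columns `Q`, `r` columns `M`, `q` columns `P` and `p`
columns `V`. -/
def car (t s r q p : ℕ) : List Column :=
  List.replicate t W ++ (List.replicate s Q ++ (List.replicate r M ++ (List.replicate q P ++
    List.replicate p V)))

theorem replicate_succ_append {α : Type*} (m : ℕ) (a : α) (L : List α) :
    List.replicate (m + 1) a ++ L = List.replicate m a ++ a :: L := by
  rw [List.replicate_succ', List.append_assoc, List.singleton_append]

theorem replicate_append_cons {α : Type*} (m : ℕ) (a : α) (L : List α) :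
    List.replicate m a ++ a :: L = a :: (List.replicate m a ++ L) := by
  rw [← replicate_succ_append, List.replicate_succ, List.cons_append]

/-- Rewriting with `Column.rules`. -/
inductive Rw : List Column → List Column → Prop
  | refl (L : List Column) : Rw L L
  | step {L L' K : List Column} (A B : List Column) : (L, L') ∈ rules → Rw (A ++ L' ++ B) K →
      Rw (A ++ L ++ B) K

namespace Rw

theorem trans {L L' L'' : List Column} (h : Rw L L') (h' : Rw L' L'') : Rw L L'' := by
  induction h with
  | refl => exact h'
  | step A B hr _ ih => exact step A B hr (ih h')

theorem append_left {L L' : List Column} (h : Rw L L') (A : List Column) : Rw (A ++ L) (A ++ L') := by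
  induction h with
  | refl => exact refl _
  | step A' B hr _ ih =>
    have := step (A ++ A') B hr (by simpa only [List.append_assoc] using ih)
    simpa only [List.append_assoc] using this

theorem cons {L L' : List Column} (h : Rw L L') (a : Column) : Rw (a :: L) (a :: L') :=
  h.append_left [a]

theorem rule {x y z x' y' z' : Column} (h : ([x, y, z], [x', y', z']) ∈ rules) (B : List Column) :
    Rw (x :: y :: z :: B) (x' :: y' :: z' :: B) :=
  step (L := [x, y, z]) (L' := [x', y', z']) [] B h (refl _)

theorem length_eq {L L' : List Column} (h : Rw L L') : L.length = L'.length := by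
  induction h with
  | refl => rfl
  | @step L L' K A B hr _ ih =>
    have : ∀ p ∈ rules, p.1.length = p.2.length := by decide
    have := this _ hr
    simp only [List.length_append] at this ih ⊢
    omega

/-- A column is moved to the left through copies of `z`, except for the first one. -/
theorem replicate_right {z c : Column} (h : ([z, z, c], [z, c, z]) ∈ rules) (m : ℕ) (B : List Column) :
    Rw (z :: (List.replicate m z ++ c :: B)) (z :: c :: (List.replicate m z ++ B)) := by
  induction m with
  | zero => exact refl _
  | succ m ih => exact (ih.cons z).trans (rule h _)

/-- A rule that moves `o` to the left needs a third column on the right of `o`: at first this is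
`y`, later the column that `o` has just passed. -/
theorem chain_left {o y : Column} {D : List Column}
    (h : (D ++ [y]).IsChain fun z y => ([z, o, y], [o, z, y]) ∈ rules) (B : List Column) :
    Rw (D ++ o :: y :: B) (o :: (D ++ y :: B)) := by
  induction D with
  | nil => exact refl _
  | cons z D ih =>
    have h1 := (ih (List.IsChain.tail h)).cons z
    rcases D with _ | ⟨d, D⟩
    · simp only [List.nil_append, List.cons_append, List.isChain_cons_cons] at h
      exact rule h.1 B
    · simp only [List.cons_append, List.isChain_cons_cons] at h
      exact h1.trans (rule h.1 _)

theorem replicate_left {z o y : Column} (h : ([z, o, y], [o, z, y]) ∈ rules)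
    (h' : ([z, o, z], [o, z, z]) ∈ rules) (m : ℕ) (B : List Column) :
    Rw (List.replicate m z ++ o :: y :: B) (o :: (List.replicate m z ++ y :: B)) := by
  refine chain_left ?_ B
  induction m with
  | zero => simp
  | succ m ih =>
    rcases m with _ | m
    · simpa using h
    · exact List.isChain_cons_cons.2 ⟨h', ih⟩

/-- The columns which may be passed by `V`. -/
def passesV (z y : Column) : Bool := decide (1 ≤ rank y ∧ rank y ≤ rank z ∧ rank z ≤ 3)

theorem passesV_left {y : Column} {D : List Column} (h : (D ++ [y]).Pairwise fun z y => passesV z y)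
    (B : List Column) : Rw (D ++ V :: y :: B) (V :: (D ++ y :: B)) := by
  refine chain_left (List.Pairwise.isChain (h.imp fun {z y} hzy => ?_)) B
  cases z <;> cases y <;> first | decide | (exact absurd hzy (by decide))

/-- When a `V` reaches the `W` block, the last `W` splits into an outgoing `P` and a `Q`. The column
that follows depends on which exponents vanish, and so does the rule. -/
theorem wv_left (s r q : ℕ) (B : List Column) :
    Rw (W :: V :: (List.replicate s Q ++ (List.replicate r M ++ (List.replicate q P ++ P :: B))))
      (P :: Q :: (List.replicate s Q ++ (List.replicate r M ++ (List.replicate q P ++ P :: B)))) := by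
  rcases s with _ | s
  · rcases r with _ | r
    · rcases q with _ | q <;> exact rule (by decide) _
    · exact rule (by decide) _
  · exact rule (by decide) _

/-- The entering `P` stops behind the leftmost `V`, and this `V` then travels left through the `P`,
`M` and `Q`. -/
theorem vp_left (s r q p : ℕ) :
    Rw (List.replicate s Q ++ (List.replicate r M ++ (List.replicate q P ++
        (V :: (List.replicate p V ++ [P])))))
      (V :: (List.replicate s Q ++ (List.replicate r M ++ (List.replicate q P ++
        P :: List.replicate p V)))) := by
  have h1 := (((replicate_right (z := V) (c := P) (by decide) p []).append_left
    (List.replicate q P)).append_left (List.replicate r M)).append_left (List.replicate s Q)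
  rw [List.append_nil] at h1
  have h2 := passesV_left (y := P) (D := List.replicate s Q ++ (List.replicate r M ++
    List.replicate q P)) (by
      simp only [List.pairwise_append, List.pairwise_replicate, List.mem_append,
        List.mem_replicate, List.mem_singleton, List.pairwise_singleton]
      refine ⟨⟨Or.inr (by decide), ⟨Or.inr (by decide), Or.inr (by decide), ?_⟩, ?_⟩, trivial, ?_⟩
      · rintro a ⟨_, rfl⟩ b ⟨_, rfl⟩; decide
      · rintro a ⟨_, rfl⟩ b (⟨_, rfl⟩ | ⟨_, rfl⟩) <;> decide
      · rintro a (⟨_, rfl⟩ | ⟨_, rfl⟩ | ⟨_, rfl⟩) b rfl <;> decide) (List.replicate p V)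
  simp only [List.append_assoc] at h2
  exact h1.trans h2

theorem vm_left (s r p : ℕ) :
    Rw (List.replicate s Q ++ (List.replicate r M ++ (V :: (List.replicate p V ++ [M]))))
      (V :: (List.replicate s Q ++ (List.replicate r M ++ M :: List.replicate p V))) := by
  have h1 := ((replicate_right (z := V) (c := M) (by decide) p []).append_left
    (List.replicate r M)).append_left (List.replicate s Q)
  rw [List.append_nil] at h1
  have h2 := passesV_left (y := M) (D := List.replicate s Q ++ List.replicate r M) (by
      simp only [List.pairwise_append, List.pairwise_replicate, List.mem_append,
        List.mem_replicate, List.mem_singleton, List.pairwise_singleton]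
      refine ⟨⟨Or.inr (by decide), Or.inr (by decide), ?_⟩, trivial, ?_⟩
      · rintro a ⟨_, rfl⟩ b ⟨_, rfl⟩; decide
      · rintro a (⟨_, rfl⟩ | ⟨_, rfl⟩) b rfl <;> decide) (List.replicate p V)
  simp only [List.append_assoc] at h2
  exact h1.trans h2

theorem vq_left (s p : ℕ) :
    Rw (List.replicate s Q ++ (V :: (List.replicate p V ++ [Q])))
      (V :: (List.replicate s Q ++ Q :: List.replicate p V)) := by
  have h1 := (replicate_right (z := V) (c := Q) (by decide) p []).append_left (List.replicate s Q)
  rw [List.append_nil] at h1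
  exact h1.trans (replicate_left (by decide) (by decide) s _)

/-- Passing of a column `c` through `P V^p`. -/
theorem pv_right {c : Column} (h : ([V, V, c], [V, c, V]) ∈ rules)
    (h' : ([P, V, c], [P, c, V]) ∈ rules) (p : ℕ) :
    Rw (P :: (List.replicate p V ++ [c])) (P :: c :: List.replicate p V) := by
  rcases p with _ | p
  · exact refl _
  · have h1 := (replicate_right h p []).cons P
    rw [List.append_nil] at h1
    exact h1.trans (rule h' _)

/-! ### One exchange between the carrier and a site -/

theorem car_P_of_zero (s r q p : ℕ) :
    Rw (car 0 s r q (p + 1) ++ [P]) (V :: car 0 s r (q + 1) p) := by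
  have h := vp_left s r q p
  simpa only [car, List.replicate_zero, List.replicate_one, List.replicate_succ, List.nil_append, List.append_nil,
    List.append_assoc, List.cons_append, replicate_append_cons] using h

theorem car_P (t s r q p : ℕ) :
    Rw (car (t + 1) s r q (p + 1) ++ [P]) (P :: car t (s + 1) r (q + 1) p) := by
  have h1 := (((vp_left s r q p).cons W).trans (wv_left s r q _)).append_left (List.replicate t W)
  have h2 := h1.trans (replicate_left (by decide) (by decide) t _)
  simpa only [car, List.replicate_zero, List.replicate_one, List.replicate_succ, List.nil_append, List.append_nil,
    List.append_assoc, List.cons_append, replicate_append_cons] using h2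

theorem car_Q_of_zero (s p : ℕ) :
    Rw (car 0 s 0 0 (p + 1) ++ [Q]) (V :: car 0 (s + 1) 0 0 p) := by
  have h := vq_left s p
  simpa only [car, List.replicate_zero, List.replicate_one, List.replicate_succ, List.nil_append, List.append_nil,
    List.append_assoc, List.cons_append, replicate_append_cons] using h

/-- The entering `Q` and a `P` of the carrier merge into a `W`, which frees a place `V`; another `P`
is left behind. -/
theorem car_Q_of_two_le (t q p : ℕ) :
    Rw (car t 0 0 (q + 2) p ++ [Q]) (P :: car (t + 1) 0 0 q (p + 1)) := by
  have h1 := ((pv_right (c := Q) (by decide) (by decide) p).cons P).trans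
    (rule (x' := P) (y' := W) (z' := V) (by decide) _)
  have h2 := (h1.append_left (List.replicate q P))
  have h3 : Rw (List.replicate q P ++ P :: W :: V :: List.replicate p V)
      (P :: W :: (List.replicate q P ++ V :: List.replicate p V)) := by
    have := replicate_right (z := P) (c := W) (by decide) q (V :: List.replicate p V)
    rwa [← replicate_succ_append, List.replicate_succ, List.cons_append]
  have h4 := ((h2.trans h3).append_left (List.replicate t W)).trans
    (replicate_left (by decide) (by decide) t _)
  simpa only [car, List.replicate_zero, List.replicate_one, List.replicate_succ, List.nil_append, List.append_nil,
    List.append_assoc, List.cons_append, replicate_append_cons] using h4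

theorem car_Q_of_one (t p : ℕ) :
    Rw (car t 0 0 1 p ++ [Q]) (P :: car t 1 0 0 p) := by
  have h1 := ((pv_right (c := Q) (by decide) (by decide) p).append_left (List.replicate t W)).trans
    (replicate_left (by decide) (by decide) t _)
  simpa only [car, List.replicate_zero, List.replicate_one, List.replicate_succ, List.nil_append, List.append_nil,
    List.append_assoc, List.cons_append, replicate_append_cons] using h1

/-- With no `P` in the carrier, the outgoing `P` comes from splitting a `W`, so the number of `Q`
grows by two. -/
theorem car_Q (t s p : ℕ) :
    Rw (car (t + 1) s 0 0 (p + 1) ++ [Q]) (P :: car t (s + 2) 0 0 p) := by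
  have h1 := (vq_left s p).cons W
  have h2 : Rw (W :: V :: (List.replicate s Q ++ Q :: List.replicate p V))
      (P :: Q :: (List.replicate s Q ++ Q :: List.replicate p V)) := by
    rw [← replicate_succ_append, List.replicate_succ, List.cons_append]
    exact rule (by decide) _
  have h3 := ((h1.trans h2).append_left (List.replicate t W)).trans
    (replicate_left (by decide) (by decide) t _)
  simpa only [car, List.replicate_zero, List.replicate_one, List.replicate_succ, List.nil_append, List.append_nil,
    List.append_assoc, List.cons_append, replicate_append_cons] using h3

theorem car_W_of_pos (t q p : ℕ) :
    Rw (car t 0 0 q (p + 1) ++ [W]) (V :: car (t + 1) 0 0 q p) := by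
  have h1 := replicate_right (z := V) (c := W) (by decide) p []
  rw [List.append_nil] at h1
  have h2 : Rw (List.replicate q P ++ V :: W :: List.replicate p V)
      (V :: W :: (List.replicate q P ++ List.replicate p V)) := by
    generalize List.replicate p V = B
    induction q generalizing B with
    | zero => exact refl _
    | succ q ih =>
      rw [replicate_succ_append, replicate_succ_append]
      exact ((rule (by decide) B).append_left _).trans (ih (P :: B))
  have h3 := (((h1.append_left (List.replicate q P)).trans h2).append_left
    (List.replicate t W)).trans (replicate_left (by decide) (by decide) t _)
  simpa only [car, List.replicate_zero, List.replicate_one, List.replicate_succ, List.nil_append, List.append_nil,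
    List.append_assoc, List.cons_append, replicate_append_cons] using h3

theorem car_W_of_zero (t q : ℕ) :
    Rw (car t 0 0 (q + 1) 0 ++ [W]) (P :: car (t + 1) 0 0 q 0) := by
  have h1 := replicate_right (z := P) (c := W) (by decide) q []
  have h2 := (h1.append_left (List.replicate t W)).trans
    (replicate_left (by decide) (by decide) t _)
  simpa only [car, List.replicate_zero, List.replicate_one, List.replicate_succ, List.nil_append, List.append_nil,
    List.append_assoc, List.cons_append, replicate_append_cons] using h2

theorem car_M_of_zero (s r p : ℕ) :
    Rw (car 0 s r 0 (p + 1) ++ [M]) (V :: car 0 s (r + 1) 0 p) := by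
  have h := vm_left s r p
  simpa only [car, List.replicate_zero, List.replicate_one, List.replicate_succ, List.nil_append, List.append_nil,
    List.append_assoc, List.cons_append, replicate_append_cons] using h

theorem car_M_of_pos (t r q p : ℕ) :
    Rw (car t 0 r (q + 1) p ++ [M]) (P :: car t 0 (r + 1) q p) := by
  have h1 := (pv_right (c := M) (by decide) (by decide) p).append_left (List.replicate q P)
  have h2 : Rw (List.replicate q P ++ P :: M :: List.replicate p V)
      (P :: M :: (List.replicate q P ++ List.replicate p V)) := by
    have := replicate_right (z := P) (c := M) (by decide) q (List.replicate p V)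
    rwa [← replicate_succ_append, List.replicate_succ, List.cons_append]
  have h3 := ((h1.trans h2).append_left (List.replicate r M)).trans
    (replicate_left (by decide) (by decide) r _)
  have h4 : Rw (List.replicate t W ++ P :: (List.replicate r M ++
      M :: (List.replicate q P ++ List.replicate p V)))
      (P :: (List.replicate t W ++ (List.replicate r M ++
      M :: (List.replicate q P ++ List.replicate p V)))) := by
    rw [← replicate_succ_append, List.replicate_succ, List.cons_append]
    exact replicate_left (by decide) (by decide) t _
  have h5 := (h3.append_left (List.replicate t W)).trans h4
  simp only [car, List.replicate_zero, List.nil_append, List.append_assoc, replicate_succ_append]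
  exact h5

theorem car_M (t s r p : ℕ) :
    Rw (car (t + 1) s r 0 (p + 1) ++ [M]) (P :: car t (s + 1) (r + 1) 0 p) := by
  have h1 := (vm_left s r p).cons W
  have h2 : Rw (W :: V :: (List.replicate s Q ++ (List.replicate r M ++ M :: List.replicate p V)))
      (P :: Q :: (List.replicate s Q ++ (List.replicate r M ++ M :: List.replicate p V))) := by
    rw [← replicate_succ_append, List.replicate_succ, List.cons_append]
    rcases s with _ | s <;> exact rule (by decide) _
  have h3 := ((h1.trans h2).append_left (List.replicate t W)).trans
    (replicate_left (by decide) (by decide) t _)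
  simpa only [car, List.replicate_zero, List.replicate_one, List.replicate_succ, List.nil_append, List.append_nil,
    List.append_assoc, List.cons_append, replicate_append_cons] using h3

end Rw
end BoxBall

namespace BoxBall

open Column

/-! ### The carrier on highest weight states -/

/-- The columns of a tableau, read from right to left, are weakly decreasing. -/
def Decr (L : List Column) : Prop := L.Pairwise fun a b => rank b ≤ rank a

/-- The carrier `C` runs through the sites `S`, leaves the sites `O` behind and ends up as `C'`. -/
inductive Run : List Column → List Column → List Column → List Column → Prop
  | nil (C : List Column) : Run C [] [] C
  | cons {C C' C'' S O : List Column} {c o : Column} : Rw (C ++ [c]) (o :: C') → Decr C' →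
      Run C' S O C'' → Run C (c :: S) (o :: O) C''

namespace Run

theorem append {C C' C'' S S' O O' : List Column} (h : Run C S O C') (h' : Run C' S' O' C'') :
    Run C (S ++ S') (O ++ O') C'' := by
  induction h with
  | nil => exact h'
  | cons h1 h2 _ ih => exact cons h1 h2 (ih h')

/-- If the carrier followed by the sites is already decreasing, no rewriting takes place and $R$
only moves the cut. -/
theorem shift {C C' S O : List Column} (h : Decr (C ++ S)) (he : C ++ S = O ++ C')
    (hl : S.length = O.length) : Run C S O C' := by
  induction S generalizing C O with
  | nil =>
    obtain rfl := List.length_eq_zero_iff.1 hl.symm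
    rw [List.append_nil, List.nil_append] at he
    exact he ▸ nil C
  | cons c S ih =>
    rcases O with _ | ⟨o, O⟩
    · simp at hl
    have h1 : C ++ [c] ++ S = o :: (O ++ C') := by simpa using he
    obtain ⟨C₁, hC₁⟩ : ∃ C₁, C ++ [c] = o :: C₁ := by
      rcases C with _ | ⟨d, C⟩
      · simp only [List.nil_append, List.cons_append, List.cons.injEq] at h1
        exact ⟨[], by rw [h1.1]; rfl⟩
      · simp only [List.cons_append, List.cons.injEq] at h1
        exact ⟨C ++ [c], by rw [h1.1]; rfl⟩
    have h2 : Decr (o :: C₁ ++ S) := by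
      rw [← hC₁, List.append_assoc]; exact h
    rw [hC₁, List.cons_append, List.cons.injEq] at h1
    have h3 : Decr (C₁ ++ S) := List.Pairwise.of_cons h2
    refine cons (by rw [hC₁]; exact Rw.refl _) (List.pairwise_append.1 h3).1 (ih h3 h1.2 ?_)
    simpa using hl

end Run

theorem decr_car_append (t s r q p B N : ℕ) (h : p = 0 ∨ B = 0) :
    Decr (car t s r q p ++ (List.replicate B P ++ List.replicate N V)) := by
  have hr : rank V = 0 ∧ rank P = 1 ∧ rank M = 2 ∧ rank Q = 3 ∧ rank W = 4 := by decide
  simp only [car, Decr, List.pairwise_append, List.pairwise_replicate, List.mem_append,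
    List.mem_replicate, le_refl, or_true, true_and]
  grind

theorem decr_car (t s r q p : ℕ) : Decr (car t s r q p) := by
  simpa using decr_car_append t s r q p 0 0 (Or.inr rfl)

namespace Run

theorem P_zero (s r q p m : ℕ) : Run (car 0 s r q (p + m)) (List.replicate m P)
    (List.replicate m V) (car 0 s r (q + m) p) := by
  induction m generalizing q with
  | zero => exact nil _
  | succ m ih =>
    have h := ih (q + 1)
    rw [show q + 1 + m = q + (m + 1) by omega] at h
    exact cons (Rw.car_P_of_zero s r q (p + m)) (decr_car _ _ _ _ _) h

theorem P_pos (t s r q p m : ℕ) : Run (car (t + m) s r q (p + m)) (List.replicate m P)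
    (List.replicate m P) (car t (s + m) r (q + m) p) := by
  induction m generalizing s q with
  | zero => exact nil _
  | succ m ih =>
    have h := ih (s + 1) (q + 1)
    rw [show q + 1 + m = q + (m + 1) by omega, show s + 1 + m = s + (m + 1) by omega] at h
    exact cons (Rw.car_P (t + m) s r q (p + m)) (decr_car _ _ _ _ _) h

theorem W_pos (t q p m : ℕ) : Run (car t 0 0 q (p + m)) (List.replicate m W)
    (List.replicate m V) (car (t + m) 0 0 q p) := by
  induction m generalizing t with
  | zero => exact nil _
  | succ m ih =>
    have h := ih (t + 1)
    rw [show t + 1 + m = t + (m + 1) by omega] at h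
    exact cons (Rw.car_W_of_pos t q (p + m)) (decr_car _ _ _ _ _) h

theorem W_zero (t q m : ℕ) : Run (car t 0 0 (q + m) 0) (List.replicate m W)
    (List.replicate m P) (car (t + m) 0 0 q 0) := by
  induction m generalizing t with
  | zero => exact nil _
  | succ m ih =>
    have h := ih (t + 1)
    rw [show t + 1 + m = t + (m + 1) by omega] at h
    exact cons (Rw.car_W_of_zero t (q + m)) (decr_car _ _ _ _ _) h

end Run

/-! ### Uniform coordinates for the loaded carrier -/

/-- The carrier of size `l` with excess `X` after it has met `j` columns `Q` and `r` columns
`M`. -/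
def nrm (l X j r : ℕ) : List Column :=
  -- Of `X` columns `P` and `j` columns `Q`, `min X j` pairs are merged into columns `W`.
  car (min X j) (j - min X j) r (X - min X j) (l - (max X j + r))

theorem nrm_eq {l X j r t s q p : ℕ} (ht : t = min X j) (hs : s + t = j) (hq : q + t = X)
    (hp : p = l - (max X j + r)) : nrm l X j r = car t s r q p := by
  rw [nrm, ← ht, hp]
  congr 1 <;> omega

/-- `X` columns `P`, at most `m`, followed by `V` up to the length `m`. -/
def emit (X m : ℕ) : List Column := List.replicate (min X m) P ++ List.replicate (m - X) V

theorem emit_append (X m m' : ℕ) : emit X m ++ emit (X - m) m' = emit X (m + m') := by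
  rcases le_total X m with h | h
  · obtain ⟨d, rfl⟩ := Nat.exists_eq_add_of_le h
    simp only [emit, Nat.sub_eq_zero_of_le h, Nat.zero_min, List.replicate_zero, List.nil_append,
      List.append_assoc, List.replicate_append_replicate]
    congr 2 <;> omega
  · obtain ⟨d, rfl⟩ := Nat.exists_eq_add_of_le h
    simp only [emit, Nat.sub_eq_zero_of_le h, List.replicate_zero, List.append_nil,
      ← List.append_assoc, List.replicate_append_replicate]
    congr 2 <;> omega

theorem emit_zero (m : ℕ) : emit 0 m = List.replicate m V := by simp [emit]

theorem emit_succ (X m : ℕ) : emit (X + 1) (m + 1) = P :: emit X m := by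
  rw [emit, emit, Nat.succ_min_succ, List.replicate_succ, List.cons_append, Nat.add_sub_add_right]

namespace Run

/-- In these coordinates the four exchanges with a `Q` become one rule: a `P` is put down while
there is excess and a `V` afterwards, and one more `Q` is counted. -/
theorem Q_nrm {l X j m : ℕ} (hX : X ≤ l) (hj : j + m ≤ l) :
    Run (nrm l X j 0) (List.replicate m Q) (emit X m) (nrm l (X - m) (j + m) 0) := by
  induction m generalizing X j with
  | zero => simpa [emit] using nil _
  | succ m ih =>
    rw [show j + (m + 1) = j + 1 + m by omega]
    rcases X with _ | X
    · have h := ih (X := 0) (j := j + 1) (by omega) (by omega)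
      rw [Nat.zero_sub] at h ⊢
      rw [emit_zero] at h ⊢
      refine cons (C' := nrm l 0 (j + 1) 0) ?_ (decr_car _ _ _ _ _) h
      rw [nrm_eq (t := 0) (s := j) (q := 0) (p := l - j - 1 + 1) (by omega) (by omega) (by omega)
        (by omega), nrm_eq (t := 0) (s := j + 1) (q := 0) (p := l - j - 1) (by omega) (by omega)
        (by omega) (by omega)]
      exact Rw.car_Q_of_zero _ _
    · have h := ih (X := X) (j := j + 1) (by omega) (by omega)
      rw [emit_succ, Nat.add_sub_add_right]
      refine cons (C' := nrm l X (j + 1) 0) ?_ (decr_car _ _ _ _ _) h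
      rcases lt_trichotomy X j with hXj | rfl | hXj
      · rw [nrm_eq (t := X + 1) (s := j - X - 1) (q := 0) (p := l - j - 1 + 1) (by omega) (by omega)
          (by omega) (by omega), nrm_eq (t := X) (s := j - X - 1 + 2) (q := 0) (p := l - j - 1)
          (by omega) (by omega) (by omega) (by omega)]
        exact Rw.car_Q _ _ _
      · rw [nrm_eq (t := X) (s := 0) (q := 1) (p := l - X - 1) (by omega) (by omega)
          (by omega) (by omega), nrm_eq (t := X) (s := 1) (q := 0) (p := l - X - 1)
          (by omega) (by omega) (by omega) (by omega)]
        exact Rw.car_Q_of_one _ _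
      · rw [nrm_eq (t := j) (s := 0) (q := X - j - 1 + 2) (p := l - X - 1) (by omega) (by omega)
          (by omega) (by omega), nrm_eq (t := j + 1) (s := 0) (q := X - j - 1) (p := l - X - 1 + 1)
          (by omega) (by omega) (by omega) (by omega)]
        exact Rw.car_Q_of_two_le _ _ _

theorem M_nrm {l X j r m : ℕ} (hX : X + r ≤ l) (hj : j + r + m ≤ l) :
    Run (nrm l X j r) (List.replicate m M) (emit X m) (nrm l (X - m) j (r + m)) := by
  induction m generalizing X r with
  | zero => simpa [emit] using nil _
  | succ m ih =>
    rw [show r + (m + 1) = r + 1 + m by omega]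
    rcases X with _ | X
    · have h := ih (X := 0) (r := r + 1) (by omega) (by omega)
      rw [Nat.zero_sub] at h ⊢
      rw [emit_zero] at h ⊢
      refine cons (C' := nrm l 0 j (r + 1)) ?_ (decr_car _ _ _ _ _) h
      rw [nrm_eq (t := 0) (s := j) (q := 0) (p := l - j - r - 1 + 1) (by omega) (by omega)
        (by omega) (by omega), nrm_eq (t := 0) (s := j) (q := 0) (p := l - j - r - 1) (by omega)
        (by omega) (by omega) (by omega)]
      exact Rw.car_M_of_zero _ _ _
    · have h := ih (X := X) (r := r + 1) (by omega) (by omega)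
      rw [emit_succ, Nat.add_sub_add_right]
      refine cons (C' := nrm l X j (r + 1)) ?_ (decr_car _ _ _ _ _) h
      rcases lt_or_ge X j with hXj | hXj
      · rw [nrm_eq (t := X + 1) (s := j - X - 1) (q := 0) (p := l - j - r - 1 + 1) (by omega)
          (by omega) (by omega) (by omega), nrm_eq (t := X) (s := j - X - 1 + 1) (q := 0)
          (p := l - j - r - 1) (by omega) (by omega) (by omega) (by omega)]
        exact Rw.car_M _ _ _ _
      · rw [nrm_eq (t := j) (s := 0) (q := X - j + 1) (p := l - X - r - 1) (by omega) (by omega)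
          (by omega) (by omega), nrm_eq (t := j) (s := 0) (q := X - j) (p := l - X - r - 1)
          (by omega) (by omega) (by omega) (by omega)]
        exact Rw.car_M_of_pos _ _ _ _

theorem V_nrm {l X : ℕ} (hX : X ≤ l) (m : ℕ) :
    Run (nrm l X 0 0) (List.replicate m V) (emit X m) (nrm l (X - m) 0 0) := by
  have h1 : ∀ Y ≤ l, nrm l Y 0 0 = List.replicate Y P ++ List.replicate (l - Y) V := fun Y hY => by
    rw [nrm_eq (t := 0) (s := 0) (q := Y) (p := l - Y) (by omega) (by omega) (by omega) (by omega)]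
    rfl
  refine shift ?_ ?_ ?_
  · exact decr_car_append _ _ _ _ _ 0 m (Or.inr rfl)
  · rw [h1 _ hX, h1 _ (by omega), emit]
    rcases le_total X m with h | h
    · simp only [Nat.sub_eq_zero_of_le h, List.replicate_zero, List.nil_append, min_eq_left h,
        List.append_assoc, List.replicate_append_replicate]
      congr 2; omega
    · simp only [Nat.sub_eq_zero_of_le h, List.replicate_zero, List.append_nil, min_eq_right h,
        ← List.append_assoc, List.replicate_append_replicate]
      rw [List.append_assoc, List.replicate_append_replicate]
      congr 2 <;> omega
  · simp [emit]; omega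

/-- A `W` counts as a `P` and as a `Q` at once. Thus the block loads `a + h` columns `P`, as far as
there is room, and `h` columns `Q`; the surplus stays behind as `P`. -/
theorem PW {l a h : ℕ} (hh : h ≤ l) :
    Run (List.replicate l V) (List.replicate a P ++ List.replicate h W)
      (List.replicate (min (a + h) l) V ++ List.replicate (a + h - min (a + h) l) P)
      (nrm l (min (a + h) l) h 0) := by
  rcases le_total a l with ha | ha
  · have h1 := P_zero 0 0 0 (l - a) a
    rw [Nat.sub_add_cancel ha, Nat.zero_add] at h1
    rcases le_total (a + h) l with hal | hal
    · have h2 := W_pos 0 a (l - a - h) h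
      rw [show l - a - h + h = l - a by omega, Nat.zero_add] at h2
      have h3 := h1.append h2
      rw [List.replicate_append_replicate] at h3
      rw [min_eq_left hal, Nat.sub_self, List.replicate_zero, List.append_nil,
        nrm_eq (t := h) (s := 0) (q := a) (p := l - a - h) (by omega) (by omega) (by omega)
          (by omega)]
      exact h3
    · have h2 := W_pos 0 a 0 (l - a)
      have h3 := W_zero (l - a) (l - h) (a + h - l)
      rw [Nat.zero_add] at h2
      rw [show l - h + (a + h - l) = a by omega] at h3
      have h4 := h1.append (h2.append h3)
      rw [List.replicate_append_replicate, ← List.append_assoc, List.replicate_append_replicate,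
        show l - a + (a + h - l) = h by omega, show a + (l - a) = l by omega] at h4
      rw [min_eq_right hal,
        nrm_eq (t := h) (s := 0) (q := l - h) (p := 0) (by omega) (by omega) (by omega)
          (by omega)]
      exact h4
  · have h1 := P_zero 0 0 0 0 l
    rw [Nat.zero_add] at h1
    have h2 : Run (car 0 0 0 l 0) (List.replicate (a - l) P) (List.replicate (a - l) P)
        (car 0 0 0 l 0) := by
      refine shift ?_ ?_ rfl
      · simpa using decr_car_append 0 0 0 l 0 (a - l) 0 (Or.inl rfl)
      · simp only [car, List.replicate_zero, List.nil_append, List.append_nil,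
          List.replicate_append_replicate]
        congr 1; omega
    have h3 := W_zero 0 (l - h) h
    rw [Nat.sub_add_cancel hh, Nat.zero_add] at h3
    have h4 := h1.append (h2.append h3)
    rw [← List.append_assoc, List.replicate_append_replicate, List.replicate_append_replicate,
      show l + (a - l) = a by omega, show a - l + h = a + h - l by omega] at h4
    rw [min_eq_right (by omega),
      nrm_eq (t := h) (s := 0) (q := l - h) (p := 0) (by omega) (by omega) (by omega) (by omega)]
    exact h4

theorem replicate_swap {α : Type*} {a b : α} {m n : ℕ} (h : m = 0 ∨ n = 0) (L : List α) :
    List.replicate m a ++ (List.replicate n b ++ L) =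
      List.replicate n b ++ (List.replicate m a ++ L) := by
  rcases h with rfl | rfl <;> simp

/-- At the end the carrier is unloaded. -/
theorem unload {t s r q p l B N : ℕ} (hl : t + (s + (r + (q + p))) = l) (h : p = 0 ∨ B = 0)
    (hN : l ≤ N) : Run (car t s r q p) (List.replicate B P ++ List.replicate N V)
      (List.replicate t W ++ (List.replicate s Q ++ (List.replicate r M ++
        (List.replicate (q + B) P ++ List.replicate (p + (N - l)) V)))) (List.replicate l V) := by
  refine shift (decr_car_append _ _ _ _ _ _ _ h) ?_ (by simp; omega)
  simp only [car, List.append_assoc, List.replicate_append_replicate]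
  rw [replicate_swap h, ← List.append_assoc (List.replicate q P), List.replicate_append_replicate,
    List.replicate_append_replicate, show p + (N - l) + l = p + N by omega]

/-- Each of the first `m` columns `P` makes a `W` split, so that a `P` is put down and a `Q` and a
`P` stay in the carrier. By `h` either the free places or the columns `P` are then used up, and the
carrier is shifted out. -/
theorem unload_of_le {t s r q p l B N m : ℕ} (hl : t + m + (s + (r + (q + (p + m)))) = l)
    (h : p = 0 ∨ B = 0) (hN : l ≤ N) :
    Run (car (t + m) s r q (p + m)) (List.replicate (m + B) P ++ List.replicate N V)
      (List.replicate m P ++ (List.replicate t W ++ (List.replicate (s + m) Q ++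
        (List.replicate r M ++ (List.replicate (q + m + B) P ++
          List.replicate (p + (N - l)) V))))) (List.replicate l V) := by
  have h1 := (P_pos t s r q p m).append (unload (l := l) (by omega) h hN)
  rwa [← List.append_assoc, List.replicate_append_replicate] at h1

/-- Here the `W` are exhausted first. The next `m` columns `P` replace a `V` each, which opens a gap
of size `m`. -/
theorem unload_of_ge {t s r q p l B N m : ℕ} (hl : t + (s + (r + (q + (p + m + t)))) = l)
    (h : p = 0 ∨ B = 0) (hN : l ≤ N) :
    Run (car t s r q (p + m + t)) (List.replicate (t + m + B) P ++ List.replicate N V)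
      (List.replicate t P ++ (List.replicate m V ++ (List.replicate (s + t) Q ++
        (List.replicate r M ++ (List.replicate (q + t + m + B) P ++
          List.replicate (p + (N - l)) V))))) (List.replicate l V) := by
  have h0 := P_pos 0 s r q (p + m) t
  rw [Nat.zero_add] at h0
  have h1 := h0.append ((P_zero (s + t) r (q + t) p m).append (unload (l := l) (by omega) h hN))
  rw [← List.append_assoc, ← List.append_assoc, List.replicate_append_replicate,
    List.replicate_append_replicate] at h1
  simpa only [List.append_assoc, List.replicate_zero, List.nil_append] using h1

end Run

/-! ### One time step in terms of the parameters of a state -/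

/-- The states occurring in the time evolution of a highest weight pair of solitons: `A` columns
`P`, a gap of size `g` (or an overlap of size `h`), and the sequence `Q^b M^r P^B`. -/
def st (b r x A g h B N : ℕ) : List Column :=
  List.replicate x V ++ (List.replicate (A - h) P ++ (List.replicate h W ++ (List.replicate g V ++
    (List.replicate (b - h) Q ++ (List.replicate r M ++ (List.replicate B P ++
      List.replicate N V))))))

/-- The carrier picks up `min A l` columns of the first piece and puts them down one by one while it
crosses the gap and the block of `Q` and `M`, of total length `g + (b - h) + r`. -/
theorem Run.load {b r l A g h x : ℕ} (hA : h ≤ A) (hb : h ≤ b) (hbr : b + r ≤ l)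
    (hgh : g = 0 ∨ h = 0) :
    Run (List.replicate l V)
      (List.replicate x V ++ (List.replicate (A - h) P ++ (List.replicate h W ++
        (List.replicate g V ++ (List.replicate (b - h) Q ++ List.replicate r M)))))
      (List.replicate (x + min A l) V ++ (List.replicate (A - min A l) P ++
        emit (min A l) (g + (b - h) + r)))
      (nrm l (min A l - (g + (b - h) + r)) b r) := by
  have h0 : Run (List.replicate l V) (List.replicate x V) (List.replicate x V)
      (List.replicate l V) := by
    have := decr_car_append 0 0 0 0 l 0 x (Or.inr rfl)
    refine shift (by simpa [car] using this) ?_ rfl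
    rw [List.replicate_append_replicate, List.replicate_append_replicate, add_comm]
  have h1 := PW (l := l) (a := A - h) (h := h) (by omega)
  rw [Nat.sub_add_cancel hA] at h1
  have h2 : Run (nrm l (min A l) h 0) (List.replicate g V) (emit (min A l) g)
      (nrm l (min A l - g) h 0) := by
    rcases hgh with rfl | rfl
    · simpa [emit] using nil _
    · exact V_nrm (min_le_right _ _) g
  have h3 := Q_nrm (l := l) (X := min A l - g) (j := h) (m := b - h) (by omega) (by omega)
  rw [Nat.add_sub_cancel' hb] at h3
  have h4 := M_nrm (l := l) (X := min A l - g - (b - h)) (j := b) (r := 0) (m := r) (by omega)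
    (by omega)
  rw [Nat.zero_add] at h4
  have h5 := h0.append (h1.append ((h2.append h3).append h4))
  rw [emit_append, Nat.sub_sub, emit_append] at h5
  rw [Nat.sub_sub, ← List.append_assoc, List.append_assoc, ← List.replicate_append_replicate] at *
  simpa only [List.append_assoc] using h5

end BoxBall

namespace BoxBall

open Column

/-- In the proof `q₀` is the load, `T` the length over which it is put down, and `X` the part still
on board after that, with `t` of it bound in columns `W`; `p` is the number of free places and `m`
the number of trailing `P` that find one. The new overlap is `t - m`, or else a gap of `m - t` is
added. -/
theorem Run.step {b r l A g h B : ℕ} (hA : h ≤ A) (hb : h ≤ b) (hbr : b + r ≤ l)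
    (hgh : g = 0 ∨ h = 0) :
    ∃ A' g' h' B', (g' = 0 ∨ h' = 0) ∧ h' ≤ A' ∧ h' ≤ b ∧ A' + B' = A + B ∧
      A' = A - min A l + min (min A l) (g + (b - h) + r) +
        min (min A l - (g + (b - h) + r)) b ∧
      g' + min (min A l - (g + (b - h) + r)) b = (g + (b - h) + r - min A l) +
        min (l - (max (min A l - (g + (b - h) + r)) b + r)) B + h' ∧
      ∀ x N, l ≤ N → ∃ N', N ≤ N' + l ∧ Run (List.replicate l V) (st b r x A g h B N)
        (st b r (x + min A l) A' g' h' B' N') (List.replicate l V) := by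
  have hload := fun x => Run.load (x := x) hA hb hbr hgh
  set T := g + (b - h) + r with hT
  set q₀ := min A l with hq₀
  have hq₀A : q₀ ≤ A := min_le_left _ _
  have hq₀l : q₀ ≤ l := min_le_right _ _
  obtain ⟨X, hX⟩ : ∃ X, X = q₀ - T := ⟨_, rfl⟩
  obtain ⟨t, ht⟩ : ∃ t, t = min X b := ⟨_, rfl⟩
  obtain ⟨p, hp⟩ : ∃ p, p = l - (max X b + r) := ⟨_, rfl⟩
  obtain ⟨m, hm⟩ : ∃ m, m = min p B := ⟨_, rfl⟩
  rw [← hX, ← ht, ← hp, ← hm]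
  -- An old gap remains only if the whole load has been put down. So this gap and the columns
  -- produced from the remaining load never occur together, which is what the rearrangements `e4`
  -- use.
  have hZ : T - q₀ = 0 ∨ X = 0 := by omega
  rcases le_total m t with hmt | hmt
  · refine ⟨A - q₀ + min q₀ T + t, T - q₀, t - m, X - t + B, by omega, by omega, by omega,
      by omega, rfl, by omega, fun x N hN => ⟨p - m + (N - l), by omega, ?_⟩⟩
    have h1 := Run.unload_of_le (t := t - m) (s := b - t) (r := r) (q := X - t) (p := p - m)
      (l := l) (B := B - m) (N := N) (m := m) (by omega) (by omega) hN
    rw [show t - m + m = t by omega, show p - m + m = p by omega, show m + (B - m) = B by omega,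
      ← nrm_eq (l := l) (X := X) (j := b) ht (by omega) (by omega) hp] at h1
    have h2 := (hX ▸ hload x).append h1
    have e1 : A - q₀ + min q₀ T + t - (t - m) = A - q₀ + (min q₀ T + m) := by omega
    have e2 : b - (t - m) = b - t + m := by omega
    have e3 : X - t + m + (B - m) = X - t + B := by omega
    rw [st, st, e1, e2]
    rw [e3] at h2
    simp only [emit, List.append_assoc] at h2
    have e4 : ∀ L : List Column, List.replicate (min q₀ T) P ++ (List.replicate (T - q₀) V ++
        (List.replicate m P ++ (List.replicate (t - m) W ++ L))) =
        List.replicate (min q₀ T + m) P ++ (List.replicate (t - m) W ++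
          (List.replicate (T - q₀) V ++ L)) := by
      intro L
      rcases hZ with h0 | h0
      · rw [h0, List.replicate_zero, List.nil_append, List.nil_append, ← List.append_assoc,
          List.replicate_append_replicate]
      · have ht0 : t = 0 := by omega
        have hm0 : m = 0 := by omega
        rw [hm0, ht0]
        simp
    rw [e4, ← List.append_assoc (List.replicate (A - q₀) P), List.replicate_append_replicate] at h2
    exact h2
  · refine ⟨A - q₀ + min q₀ T + t, T - q₀ + (m - t), 0, X - t + B, by omega, by omega, by omega,
      by omega, rfl, by omega, fun x N hN => ⟨p - m + (N - l), by omega, ?_⟩⟩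
    have h1 := Run.unload_of_ge (t := t) (s := b - t) (r := r) (q := X - t) (p := p - m)
      (l := l) (B := B - m) (N := N) (m := m - t) (by omega) (by omega) hN
    rw [show p - m + (m - t) + t = p by omega, show t + (m - t) + (B - m) = B by omega,
      ← nrm_eq (l := l) (X := X) (j := b) ht (by omega) (by omega) hp] at h1
    have h2 := (hX ▸ hload x).append h1
    have e1 : A - q₀ + min q₀ T + t - 0 = A - q₀ + (min q₀ T + t) := by omega
    have e2 : b - 0 = b - t + t := by omega
    have e3 : X - t + t + (m - t) + (B - m) = X - t + B := by omega
    rw [st, st, e1, e2]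
    rw [e3] at h2
    simp only [emit, List.append_assoc] at h2
    have e4 : ∀ L : List Column, List.replicate (min q₀ T) P ++ (List.replicate (T - q₀) V ++
        (List.replicate t P ++ (List.replicate (m - t) V ++ L))) =
        List.replicate (min q₀ T + t) P ++ (List.replicate (T - q₀ + (m - t)) V ++ L) := by
      intro L
      rw [← List.replicate_append_replicate, ← List.replicate_append_replicate]
      rcases hZ with h0 | h0
      · rw [h0, List.replicate_zero, List.nil_append, List.nil_append, List.append_assoc]
      · have ht0 : t = 0 := by omega
        rw [ht0, List.replicate_zero, List.nil_append, List.append_nil, List.append_assoc]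
    rw [e4, ← List.append_assoc (List.replicate (A - q₀) P), List.replicate_append_replicate] at h2
    rw [List.replicate_zero, List.nil_append]
    exact h2

/-! ### The three phases of the collision -/

/-- Iterated runs of a carrier which starts and ends in the vacuum state. -/
inductive Evolves (l : ℕ) : ℕ → List Column → List Column → Prop
  | zero (S : List Column) : Evolves l 0 S S
  | succ {t : ℕ} {S S' S'' : List Column} : Evolves l t S S' →
      Run (List.replicate l V) S' S'' (List.replicate l V) → Evolves l (t + 1) S S''

/-- The first piece starts at `x` and the second at `x + A + g - h`; `z` and `y` stand for the
distances travelled at speeds `min d₁ l = d₂ + 1 + s` and `d₂`. The alternatives of `hphase` are: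
before the collision (`A = d₁`), in transition (`g + b = e + h`), and afterwards (`A = d₂`), when
the speeds are interchanged and the positions shifted. The bound `e + h ≤ b + g` makes the last
phase stable. -/
theorem phase_step {b r e d₁ d₂ l c g₀ s x A g h B A' g' h' y z : ℕ} (hd₂ : d₂ = e + b + r)
    (hd : d₂ < d₁) (hl : d₂ < l) (hs : min d₁ l = d₂ + 1 + s) (hA : h ≤ A)
    (hb : h ≤ b) (hAB : A + B = d₁ + e) (hgs : e + h ≤ b + g)
    (hA' : A' = A - min A l + min (min A l) (g + (b - h) + r) +
      min (min A l - (g + (b - h) + r)) b)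
    (hg' : g' + min (min A l - (g + (b - h) + r)) b = (g + (b - h) + r - min A l) +
      min (l - (max (min A l - (g + (b - h) + r)) b + r)) B + h')
    (hphase : (x = c + z ∧ x + A + g = c + d₁ + g₀ + y + h ∧
        (A = d₁ ∨ (g + b = e + h ∧ d₂ ≤ A ∧ A ≤ d₁))) ∨
      (A = d₂ ∧ x + 2 * d₂ = c + d₁ + g₀ + 2 * b + r + y ∧
        x + A + g + 2 * b + r = c + 2 * d₂ + z + h)) :
    e + h' ≤ b + g' ∧
    ((x + min A l = c + (z + (d₂ + 1 + s)) ∧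
        x + min A l + A' + g' = c + d₁ + g₀ + (y + d₂) + h' ∧
        (A' = d₁ ∨ (g' + b = e + h' ∧ d₂ ≤ A' ∧ A' ≤ d₁))) ∨
      (A' = d₂ ∧ x + min A l + 2 * d₂ = c + d₁ + g₀ + 2 * b + r + (y + d₂) ∧
        x + min A l + A' + g' + 2 * b + r = c + 2 * d₂ + (z + (d₂ + 1 + s)) + h')) := by
  obtain ⟨T, hT⟩ : ∃ T, T = g + (b - h) + r := ⟨_, rfl⟩
  obtain ⟨q, hq⟩ : ∃ q, q = min A l := ⟨_, rfl⟩
  rw [← hT, ← hq] at hA' hg'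
  rw [← hq]
  obtain ⟨X, hX⟩ : ∃ X, X = q - T := ⟨_, rfl⟩
  rw [← hX] at hA' hg'
  obtain ⟨t, ht⟩ : ∃ t, t = min X b := ⟨_, rfl⟩
  rw [← ht] at hA' hg'
  obtain ⟨p, hp⟩ : ∃ p, p = l - (max X b + r) := ⟨_, rfl⟩
  rw [← hp] at hg'
  obtain ⟨m, hm⟩ : ∃ m, m = min p B := ⟨_, rfl⟩
  rw [← hm] at hg'
  -- Minima and truncated differences are turned into disjunctions, so that every case below is
  -- linear.
  have hT' : T + h = g + b + r := by clear * - hT hb; omega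
  have hs' : (d₂ + 1 + s = d₁ ∧ d₁ ≤ l) ∨ (d₂ + 1 + s = l ∧ l ≤ d₁) := by clear * - hs; omega
  have hq' : (q = A ∧ A ≤ l) ∨ (q = l ∧ l ≤ A) := by clear * - hq; omega
  have hX' : (q ≤ T ∧ X = 0 ∧ t = 0 ∧ A' = A) ∨
      (T + X = q ∧ 0 < X ∧ A' + X = A + t) := by clear * - hX ht hA' hq'; omega
  have hg'' : (q ≤ T ∧ g' + t + q = T + m + h') ∨ (T ≤ q ∧ g' + t = m + h') := by
    clear * - hg'; omega
  have ht' : (t = X ∧ X ≤ b) ∨ (t = b ∧ b ≤ X) := by clear * - ht; omega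
  have hp' : (X ≤ b ∧ p + b + r = l) ∨ (b ≤ X ∧ p + X + r = l) := by
    clear * - hp hX hq' hT' hb hd₂ hl; omega
  have hm' : (m = p ∧ p ≤ B) ∨ (m = B ∧ B ≤ p) := by clear * - hm; omega
  clear hT hq hX ht hp hm hA' hg' hs
  rcases hphase with ⟨h1, h2, rfl | h3⟩ | ⟨rfl, h1, h2⟩
  · have hqs : q = d₂ + 1 + s := by omega
    have hB : B = e := by omega
    clear hs' hAB
    subst hB hqs
    have hmB : m = B := by
      have hTX : d₂ + 1 + s ≤ T + X := by clear * - hX'; omega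
      have hTX' : X = 0 ∨ T + X = d₂ + 1 + s := by clear * - hX'; omega
      have hpB : B ≤ p := by
        rcases hp' with hp' | hp'
        · clear * - hp' hd₂ hl; omega
        · rcases hTX' with hTX' | hTX'
          · clear * - hp' hTX' hd₂ hl; omega
          · clear * - hp' hTX' hT' hgs hq'; omega
      clear * - hpB hm'; omega
    subst hmB
    have hqA : d₂ + 1 + s ≤ A := by clear * - hq'; omega
    clear hp' hm' hq'
    rcases hX' with ⟨hX₁, rfl, rfl, rfl⟩ | ⟨hX₁, hX₂, hX₃⟩
    · have hg₁ : g' + (d₂ + 1 + s) = T + m + h' := by clear * - hg'' hX₁; omega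
      clear hg'' ht'
      exact ⟨by omega, Or.inl ⟨by omega, by omega, Or.inl rfl⟩⟩
    · have hg₁ : g' + t = m + h' := by clear * - hg'' hX₁ hX₂; omega
      clear hg''
      rcases ht' with ⟨rfl, ht₂⟩ | ⟨rfl, ht₂⟩
      -- As long as `X ≤ b`, everything still on board is bound in columns `W` and `A` keeps its
      -- value; otherwise the transition begins.
      · exact ⟨by omega, Or.inl ⟨by omega, by omega, Or.inl (by omega)⟩⟩
      · exact ⟨by omega, Or.inl ⟨by omega, by omega, Or.inr ⟨by omega, by omega, by omega⟩⟩⟩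
  -- In transition `T = e + r = d₂ - b`, so `A` drops by `q - d₂`. If the whole first piece fits
  -- into the carrier, this gives `A' = d₂` and the collision is over; if `l ≤ A`, the transition
  -- may last longer.
  · obtain ⟨h3, h4, h5⟩ := h3
    rcases hX' with ⟨hX₁, rfl, rfl, rfl⟩ | ⟨hX₁, hX₂, hX₃⟩
    · obtain ⟨hqd, hAd, hb0⟩ : q = d₂ ∧ A' = d₂ ∧ b = 0 := by
        clear * - hq' hX₁ hT' h3 h4 hd₂ hl; omega
      have hpl : p + r = l := by clear * - hp' hb0; omega
      have hm₁ : m + r = d₂ + 1 + s := by clear * - hm' hs' hpl hAB hd₂ hAd hb0; omega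
      have hg₁ : g' = m + h' := by clear * - hg'' hX₁ hT' h3 hd₂ hqd hb0; omega
      clear hg'' ht' hs' hq' hp' hm'
      exact ⟨by omega, Or.inr ⟨hAd, by omega, by omega⟩⟩
    · have hg₁ : g' + t = m + h' := by clear * - hg'' hX₁ hX₂; omega
      have htb : t = b ∧ b ≤ X := by clear * - ht' hX₁ hT' h3 h4 hd₂ hl hq'; omega
      obtain ⟨rfl, htX⟩ := htb
      have hpX : p + X + r = l := by clear * - hp' htX; omega
      clear hg'' hp' ht'
      rcases hq' with ⟨rfl, hq₂⟩ | ⟨rfl, hq₂⟩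
      · have hm₁ : m + q = d₂ + 1 + s + e := by
          clear * - hm' hs' hpX hX₁ hT' h3 hAB; omega
        have hem : e ≤ m := by clear * - hm₁ hs' hq₂ h5; omega
        clear hs' hm'
        exact ⟨by omega, Or.inr ⟨by omega, by omega, by omega⟩⟩
      · have hm₁ : m = e := by clear * - hm' hpX hX₁ hT' h3 hAB h5; omega
        have hs₁ : d₂ + 1 + s = q := by clear * - hs' hq₂ h5; omega
        clear hs' hm'
        exact ⟨by omega, Or.inl ⟨by omega, by omega, Or.inr ⟨by omega, by omega, by omega⟩⟩⟩
  · have hqA : q = A := by clear * - hq' hl; omega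
    subst hqA
    -- After the collision the excess is at most `e + h - g`, which the invariant bounds by `b`;
    -- hence `A` does not change any more.
    have hXb : X ≤ b := by clear * - hX' hT' hgs hd₂; omega
    have htX : t = X := by clear * - hXb ht' ; omega
    subst htX
    have hB : B + b + r = d₁ := by clear * - hAB hd₂; omega
    have hpl : p + b + r = l := by clear * - hp' hXb; omega
    have hm₁ : m + b + r = q + 1 + s := by clear * - hm' hs' hpl hB; omega
    have hA₁ : A' = q := by clear * - hX'; omega
    have hg₁ : g' + q = T + m + h' := by clear * - hX' hg''; omega
    have hgm : e + t ≤ m + b ∨ t = 0 := by clear * - hX' hT' hgs hd₂ hm₁; omega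
    clear hq' hs' hg'' hX' hp' hm' ht'
    exact ⟨by omega, Or.inr ⟨by omega, by omega, by omega⟩⟩

/-- Two-soliton scattering of a highest weight pair. -/
theorem evolves_st {b r e d₁ d₂ l c g₀ : ℕ} (hd₂ : d₂ = e + b + r) (hd : d₂ < d₁) (hl : d₂ < l)
    (hg₀ : d₂ ≤ g₀) : ∃ t₀ : ℕ, ∀ t ≥ t₀, ∃ x g : ℕ,
      (x : ℤ) = (c + d₁ + g₀ : ℕ) - (2 * d₂ - 2 * b - r : ℤ) + d₂ * (t : ℤ) ∧
      ((x + d₂ + g : ℕ) : ℤ) = c + (2 * d₂ - 2 * b - r : ℤ) + (min d₁ l : ℕ) * (t : ℤ) ∧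
      ∀ N, l * t ≤ N → ∃ N', Evolves l t (st b r c d₁ g₀ 0 e N)
        (st b r x d₂ g 0 (d₁ - b - r) N') := by
  obtain ⟨s, hs⟩ : ∃ s, min d₁ l = d₂ + 1 + s := ⟨min d₁ l - d₂ - 1, by omega⟩
  have key : ∀ t : ℕ, ∃ x A g h B : ℕ, (g = 0 ∨ h = 0) ∧ h ≤ A ∧ h ≤ b ∧ A + B = d₁ + e ∧
      e + h ≤ b + g ∧
      ((x = c + (d₂ + 1 + s) * t ∧ x + A + g = c + d₁ + g₀ + d₂ * t + h ∧
          (A = d₁ ∨ (g + b = e + h ∧ d₂ ≤ A ∧ A ≤ d₁))) ∨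
        (A = d₂ ∧ x + 2 * d₂ = c + d₁ + g₀ + 2 * b + r + d₂ * t ∧
          x + A + g + 2 * b + r = c + 2 * d₂ + (d₂ + 1 + s) * t + h)) ∧
      ∀ N, l * t ≤ N → ∃ N', N ≤ N' + l * t ∧
        Evolves l t (st b r c d₁ g₀ 0 e N) (st b r x A g h B N') := by
    intro t
    induction t with
    | zero =>
      exact ⟨c, d₁, g₀, 0, e, by omega, by omega, by omega, rfl, by omega, by left; omega,
        fun N _ => ⟨N, by omega, Evolves.zero _⟩⟩
    | succ t ih =>
      obtain ⟨x, A, g, h, B, hgh, hA, hb, hAB, hgs, hphase, hev⟩ := ih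
      obtain ⟨A', g', h', B', hgh', hA', hb', hAB', hA'eq, hg'eq, hrun⟩ :=
        Run.step (l := l) (r := r) (B := B) hA hb (by omega) hgh
      refine ⟨x + min A l, A', g', h', B', hgh', hA', hb', by omega, ?_, ?_, fun N hN => ?_⟩
      · exact (phase_step hd₂ hd hl hs hA hb hAB hgs hA'eq hg'eq hphase).1
      · rw [mul_add, mul_add, mul_one, mul_one]
        exact (phase_step hd₂ hd hl hs hA hb hAB hgs hA'eq hg'eq hphase).2
      · rw [mul_add, mul_one] at hN
        obtain ⟨N₁, hN₁, hE⟩ := hev N (by omega)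
        obtain ⟨N₂, hN₂, hR⟩ := hrun x N₁ (by omega)
        exact ⟨N₂, by rw [mul_add, mul_one]; omega, hE.succ hR⟩
  -- Before the collision the distance of the two starting points shrinks by at least one in each
  -- step, so that phase and the transition end in time. The bound is also large enough for the
  -- outgoing pieces to have a positive gap, whence `h = 0`.
  refine ⟨c + d₁ + g₀ + b + 2 * d₂ + 1, fun t ht => ?_⟩
  obtain ⟨x, A, g, h, B, hgh, hA, hb, hAB, hgs, hphase, hev⟩ := key t
  have h1 : (d₂ + 1 + s) * t = d₂ * t + t + s * t := by ring
  rw [h1] at hphase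
  have hpost : A = d₂ ∧ x + 2 * d₂ = c + d₁ + g₀ + 2 * b + r + d₂ * t ∧
      x + A + g + 2 * b + r = c + 2 * d₂ + (d₂ * t + t + s * t) + h := by
    rcases hphase with hp | hp
    · exfalso
      generalize d₂ * t = y at *
      generalize s * t = z at *
      omega
    · exact hp
  obtain ⟨rfl, h2, h3⟩ := hpost
  have hh : h = 0 := by
    generalize A * t = y at *
    generalize s * t = z at *
    omega
  subst hh
  refine ⟨x, g, ?_, ?_, fun N hN => ?_⟩
  · push_cast
    zify at h2
    linarith
  · rw [hs]
    zify at h3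
    push_cast
    linarith
  · obtain ⟨N', -, hE⟩ := hev N hN
    have : B = d₁ - b - r := by omega
    exact ⟨N', this ▸ hE⟩

end BoxBall

namespace BoxBall

/-! ### The rewriting rules are Knuth equivalences -/

/-- The `i`-sign of a column of height two. -/
def psgn (i : ℕ) (p : ℕ × ℕ) : Option Bool := csgn i [p.1, p.2]

/-- The letter `i + 1` of a column of height two is replaced by `i`. -/
def pdown (i : ℕ) (p : ℕ × ℕ) : ℕ × ℕ :=
  (if p.1 = i + 1 then i else p.1, if p.2 = i + 1 then i else p.2)

/-- The column `(1, …, m, m + p.1, m + p.2)`. -/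
def tallColumn (m : ℕ) (p : ℕ × ℕ) : List ℕ := List.range' 1 m ++ [m + p.1, m + p.2]

/-- Columns of height two with letters in `{1, 2, 3, 4}`. -/
def IsPair (p : ℕ × ℕ) : Prop := 1 ≤ p.1 ∧ p.1 < p.2 ∧ p.2 ≤ 4

instance : DecidablePred IsPair := fun _ => inferInstanceAs (Decidable (_ ∧ _ ∧ _))

theorem IsPair.strict {p : ℕ × ℕ} (h : IsPair p) (m : ℕ) :
    (tallColumn m p).Pairwise (· < ·) := by
  obtain ⟨h1, h2, -⟩ := h
  rw [tallColumn, List.pairwise_append]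
  refine ⟨List.pairwise_lt_range', by simpa using h2, fun a ha b hb => ?_⟩
  simp only [List.mem_range'_1, List.mem_cons, List.not_mem_nil, or_false] at ha hb
  omega

theorem mem_tallColumn {m j : ℕ} (hj : 1 ≤ j) {p : ℕ × ℕ} :
    m + j ∈ tallColumn m p ↔ j ∈ [p.1, p.2] := by
  simp only [tallColumn, List.mem_append, List.mem_range'_1, List.mem_cons, List.not_mem_nil,
    or_false]
  omega

theorem csgn_tallColumn {m j : ℕ} (hj : 1 ≤ j) (p : ℕ × ℕ) :
    csgn (m + j) (tallColumn m p) = psgn j p := by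
  simp only [csgn, psgn, mem_tallColumn hj, add_assoc, mem_tallColumn (show 1 ≤ j + 1 by omega)]

/-- For `i ≤ m` the column contains `i`, and for `i ≥ m + 4` the letter `i + 1` is too large to
occur. So only the indices `m + 1`, `m + 2`, `m + 3` can raise, and they act in the same way for
every `m`. -/
theorem csgn_tallColumn_ne {m i : ℕ} (hi : 1 ≤ i) (him : i ≤ m ∨ m + 4 ≤ i) {p : ℕ × ℕ}
    (hp : IsPair p) : csgn i (tallColumn m p) ≠ some false := by
  obtain ⟨h1, h2, h3⟩ := hp
  rw [Ne, csgn_eq_false]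
  simp only [tallColumn, List.mem_append, List.mem_range'_1, List.mem_cons, List.not_mem_nil,
    or_false]
  omega

theorem isBlockMap_tallColumn {m j : ℕ} (hj : 1 ≤ j) {p : ℕ × ℕ} (hp : IsPair p) :
    Sig.IsBlockMap (psgn j) (lsgn (m + j)) (tallColumn m) p := by
  have h := isBlockMap_column (m + j) (hp.strict m)
  exact ⟨by rw [← csgn_tallColumn (m := m) hj]; exact h.ep_eq,
    by rw [← csgn_tallColumn (m := m) hj]; exact h.ph_eq⟩

theorem colDown_tallColumn {m j : ℕ} (hj : 1 ≤ j) (p : ℕ × ℕ) :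
    colDown (m + j) (tallColumn m p) = tallColumn m (pdown j p) := by
  have h1 : (List.range' 1 m).map (fun c => if c = m + j + 1 then m + j else c) =
      List.range' 1 m := by
    refine map_ite_of_not_mem fun h => ?_
    rw [List.mem_range'_1] at h
    omega
  simp only [colDown, tallColumn, List.map_append, List.map_cons, List.map_nil, pdown,
    add_assoc, Nat.add_left_cancel_iff]
  congr 3 <;> split_ifs <;> rfl

theorem eWord_tallColumns {m j : ℕ} (hj : 1 ≤ j) {L : List (ℕ × ℕ)} (hL : ∀ p ∈ L, IsPair p) :
    eWord (m + j) (L.flatMap (tallColumn m)) =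
      (Sig.e (psgn j) (pdown j) L).map (·.flatMap (tallColumn m)) := by
  rw [eWord_eq]
  refine Sig.e_flatMap (fun p hp => isBlockMap_tallColumn hj (hL p hp)) fun p hp hs => ?_
  rw [← colDown_tallColumn hj]
  exact e_column ((hL p hp).strict m) (by rwa [csgn_tallColumn hj])

/-- A test for the Knuth equivalence of two words of columns, which are raised simultaneously. -/
def knuthTest : ℕ → List (ℕ × ℕ) → List (ℕ × ℕ) → Bool
  | 0, _, _ => false
  | N + 1, L, L' =>
    match Sig.e (psgn 1) (pdown 1) L, Sig.e (psgn 1) (pdown 1) L' with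
    | some A, some A' => knuthTest N A A'
    | none, none =>
      match Sig.e (psgn 2) (pdown 2) L, Sig.e (psgn 2) (pdown 2) L' with
      | some A, some A' => knuthTest N A A'
      | none, none =>
        match Sig.e (psgn 3) (pdown 3) L, Sig.e (psgn 3) (pdown 3) L' with
        | some A, some A' => knuthTest N A A'
        | none, none => decide ((L.flatMap fun p => [p.1, p.2]).Perm
            (L'.flatMap fun p => [p.1, p.2])) && decide (L.length = L'.length)
        | _, _ => false
      | _, _ => false
    | _, _ => false

theorem IsPair.pdown {j : ℕ} (hj : 1 ≤ j) {p : ℕ × ℕ} (hp : IsPair p) (hs : psgn j p = some false) :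
    IsPair (pdown j p) := by
  obtain ⟨h1, h2, h3⟩ := hp
  rw [psgn, csgn_eq_false] at hs
  simp only [List.mem_cons, List.not_mem_nil, or_false] at hs
  simp only [IsPair, BoxBall.pdown]
  split_ifs <;> omega

theorem e_isPair {j : ℕ} (hj : 1 ≤ j) {L A : List (ℕ × ℕ)} (hL : ∀ p ∈ L, IsPair p)
    (h : Sig.e (psgn j) (pdown j) L = some A) : ∀ p ∈ A, IsPair p := by
  induction L generalizing A with
  | nil => simp [Sig.e] at h
  | cons a L ih =>
    rw [List.forall_mem_cons] at hL
    simp only [Sig.e] at h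
    rcases hC : psgn j a with _ | _ | _ <;> simp only [hC] at h <;> (try split_ifs at h) <;>
      first
      | (obtain ⟨v, hv, rfl⟩ := Option.map_eq_some_iff.1 h
         exact List.forall_mem_cons.2 ⟨hL.1, ih hL.2 hv⟩)
      | (cases h; exact List.forall_mem_cons.2 ⟨hL.1.pdown hj hC, hL.2⟩)

theorem count_tallColumns (m c : ℕ) (L : List (ℕ × ℕ)) :
    (L.flatMap (tallColumn m)).count c = L.length * (List.range' 1 m).count c +
      ((L.flatMap fun p => [p.1, p.2]).map (m + ·)).count c := by
  induction L with
  | nil => simp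
  | cons p L ih =>
    simp only [List.flatMap_cons, List.count_append, ih, tallColumn, List.length_cons,
      Nat.add_one_mul, List.map_append, List.map_cons, List.map_nil]
    ring

theorem isHighest_tallColumns {m : ℕ} {L : List (ℕ × ℕ)} (hL : ∀ p ∈ L, IsPair p)
    (h : ∀ j, 1 ≤ j → j ≤ 3 → Sig.e (psgn j) (pdown j) L = none) :
    IsHighest 1 (L.flatMap (tallColumn m)) := by
  refine ⟨fun c hc => ?_, fun i hi => ?_⟩
  · obtain ⟨p, hp, hc⟩ := List.mem_flatMap.1 hc
    obtain ⟨h1, h2, -⟩ := hL p hp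
    simp only [tallColumn, List.mem_append, List.mem_range'_1, List.mem_cons, List.not_mem_nil,
      or_false] at hc
    omega
  · by_cases him : m < i ∧ i < m + 4
    · obtain ⟨j, rfl⟩ : ∃ j, i = m + j := ⟨i - m, by omega⟩
      rw [← eWord_eq_none, eWord_tallColumns (by omega) hL, h j (by omega) (by omega)]
      rfl
    · have hb : ∀ p ∈ L, Sig.IsBlockMap (fun p => csgn i (tallColumn m p)) (lsgn i) (tallColumn m) p :=
        fun p hp => ⟨(isBlockMap_column i ((hL p hp).strict m)).ep_eq,
          (isBlockMap_column i ((hL p hp).strict m)).ph_eq⟩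
      rw [eps, (Sig.ep_flatMap hb).1]
      clear hb h
      induction L with
      | nil => rfl
      | cons p L ih =>
        have h1 := ih fun q hq => hL q (by simp [hq])
        have h2 := csgn_tallColumn_ne (m := m) hi (by omega) (hL p (by simp))
        simp only [Sig.ep]
        rcases hs : csgn i (tallColumn m p) with _ | _ | _
        · exact h1
        · exact absurd hs h2
        · simp only [h1]

/-- Simultaneous raising can be undone by `f`, which respects Knuth equivalence; once both words are
of highest weight, equal content is enough. -/
theorem knuth_of_knuthTest {m N : ℕ} {L L' : List (ℕ × ℕ)} (hL : ∀ p ∈ L, IsPair p)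
    (hL' : ∀ p ∈ L', IsPair p) (h : knuthTest N L L' = true) :
    Knuth (L.flatMap (tallColumn m)) (L'.flatMap (tallColumn m)) := by
  induction N generalizing L L' with
  | zero => simp [knuthTest] at h
  | succ N ih =>
    have key : ∀ j A A', 1 ≤ j → Sig.e (psgn j) (pdown j) L = some A →
        Sig.e (psgn j) (pdown j) L' = some A' → knuthTest N A A' = true →
        Knuth (L.flatMap (tallColumn m)) (L'.flatMap (tallColumn m)) := by
      intro j A A' hj hA hA' ht
      have h1 := ih (e_isPair hj hL hA) (e_isPair hj hL' hA') ht
      have h2 := eWord_tallColumns (m := m) hj hL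
      have h3 := eWord_tallColumns (m := m) hj hL'
      rw [hA, Option.map_some] at h2
      rw [hA', Option.map_some] at h3
      obtain ⟨w, hw, hk⟩ := h1.fWord (eWord_spec h2).1
      rw [(eWord_spec h3).1, Option.some.injEq] at hw
      rwa [hw]
    rw [knuthTest] at h
    split at h
    · next A A' h1 h2 => exact key 1 A A' le_rfl h1 h2 h
    · next h1 h1' =>
      split at h
      · next A A' h1 h2 => exact key 2 A A' (by omega) h1 h2 h
      · next h2 h2' =>
        split at h
        · next A A' h1 h2 => exact key 3 A A' (by omega) h1 h2 h
        · next h3 h3' =>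
          rw [Bool.and_eq_true, decide_eq_true_iff, decide_eq_true_iff] at h
          refine (isHighest_tallColumns hL fun j hj hj' => ?_).knuth
            (isHighest_tallColumns hL' fun j hj hj' => ?_)
            (List.perm_iff_count.2 fun c => ?_)
          · interval_cases j <;> assumption
          · interval_cases j <;> assumption
          · rw [count_tallColumns, count_tallColumns, h.2, (h.1.map _).count_eq]
        · simp at h
      · simp at h
    · simp at h

/-! ### The column types as columns of height `k` -/

namespace Column

/-- The two bottom letters of a column, relative to the letter `k - 2`; the column `M` is `(1, 4)`
or `(2, 3)`. -/
def pair (μ : ℕ × ℕ) : Column → ℕ × ℕ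
  | V => (1, 2)
  | P => (1, 3)
  | M => μ
  | Q => (2, 4)
  | W => (3, 4)

/-- The letters of a column of height `k`. -/
def letters (k : ℕ) (μ : ℕ × ℕ) (c : Column) : List ℕ :=
  (List.range k).map fun i => if i + 1 = k then k + (c.pair μ).2 - 2 else
    if i + 2 = k then k + (c.pair μ).1 - 2 else i + 1

theorem letters_add_two (m : ℕ) (μ : ℕ × ℕ) (c : Column) :
    c.letters (m + 2) μ = tallColumn m (c.pair μ) := by
  rw [letters, List.range_succ, List.range_succ, tallColumn, List.range'_eq_map_range]
  simp only [List.map_append, List.map_cons, List.map_nil, List.append_assoc, List.cons_append,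
    List.nil_append]
  congr 1
  · refine List.map_congr_left fun i hi => ?_
    rw [List.mem_range] at hi
    rw [if_neg (by omega), if_neg (by omega), add_comm]
  · simp
    omega

theorem letters_one (μ : ℕ × ℕ) (c : Column) : c.letters 1 μ = [(c.pair μ).2 - 1] := by
  simp [letters, Nat.add_comm 1]

/-- The two choices of the column `M`. -/
def IsMiddle (μ : ℕ × ℕ) : Prop := μ = (1, 4) ∨ μ = (2, 3)

/-- The columns of height `k` with letters in `{1, …, n}`. -/
def Valid (n k : ℕ) (μ : ℕ × ℕ) (c : Column) : Prop :=
  k + (c.pair μ).2 ≤ n + 2 ∧ (k = 1 → (c.pair μ).1 = 1)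

theorem isPair_pair {μ : ℕ × ℕ} (hμ : IsMiddle μ) (c : Column) : IsPair (c.pair μ) := by
  rcases hμ with rfl | rfl <;> cases c <;> decide

theorem knuth_rule {μ : ℕ × ℕ} (hμ : IsMiddle μ) {k n : ℕ} (hk : 1 ≤ k)
    {L L' : List Column} (h : (L, L') ∈ rules) (hL : ∀ c ∈ L, c.Valid n k μ) :
    Knuth (L.flatMap (letters k μ)) (L'.flatMap (letters k μ)) := by
  obtain ⟨m, rfl⟩ | rfl : (∃ m, k = m + 2) ∨ k = 1 := by
    rcases k with _ | _ | m
    · omega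
    · exact Or.inr rfl
    · exact Or.inl ⟨m, rfl⟩
  · have key : ∀ L : List Column, L.flatMap (letters (m + 2) μ) =
        (L.map (pair μ)).flatMap (tallColumn m) := by
      intro L
      rw [List.flatMap_map]
      exact List.flatMap_congr fun c _ => letters_add_two m μ c
    have hp : ∀ L : List Column, ∀ p ∈ L.map (pair μ), IsPair p := by
      intro L p hp
      obtain ⟨c, -, rfl⟩ := List.mem_map.1 hp
      exact isPair_pair hμ c
    rw [key, key]
    -- The test does not involve the height, so one finite computation settles all `k ≥ 2`. The
    -- number `16` is a sufficient bound for the raising steps.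
    refine knuth_of_knuthTest (N := 16) (hp _) (hp _) ?_
    rcases hμ with rfl | rfl
    · exact (by decide : ∀ r ∈ rules, knuthTest 16 (r.1.map (pair (1, 4)))
        (r.2.map (pair (1, 4))) = true) _ h
    · exact (by decide : ∀ r ∈ rules, knuthTest 16 (r.1.map (pair (2, 3)))
        (r.2.map (pair (2, 3))) = true) _ h
  -- For `k = 1` a column is a single letter. The columns whose pair does not begin with `1` are
  -- excluded, and the remaining rules are elementary Knuth relations.
  · have h1 : ∀ c ∈ L, (c.pair μ).1 = 1 := fun c hc => (hL c hc).2 rfl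
    have h2 : ∀ L : List Column, L.flatMap (letters 1 μ) = L.map fun c => (c.pair μ).2 - 1 := by
      intro L
      rw [← List.flatMap_singleton' (L.map _), List.flatMap_map]
      exact List.flatMap_congr fun c _ => letters_one μ c
    rw [h2, h2]
    clear hL h2
    simp only [rules, List.mem_cons, List.not_mem_nil, or_false, Prod.mk.injEq] at h
    rcases hμ with rfl | rfl <;>
      rcases h with h | h | h | h | h | h | h | h | h | h | h | h | h | h | h | h | h | h | h | h |
        h | h | h | h <;> obtain ⟨rfl, rfl⟩ := h <;>
      first
      | exact absurd h1 (by decide)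
      | exact (Knuth.left (by decide) (by decide)).symm
      | exact (Knuth.right (by decide) (by decide)).symm

theorem valid_rule {μ : ℕ × ℕ} (hμ : IsMiddle μ) {k n : ℕ} {L L' : List Column}
    (h : (L, L') ∈ rules) (hL : ∀ c ∈ L, c.Valid n k μ) : ∀ c ∈ L', c.Valid n k μ := by
  have h1 : ∀ r ∈ rules, ∀ c ∈ r.2, ∃ d ∈ r.1, (c.pair μ).2 ≤ (d.pair μ).2 := by
    rcases hμ with rfl | rfl <;> decide
  have h2 : ∀ r ∈ rules, (∀ d ∈ r.1, (d.pair μ).1 = 1) → ∀ c ∈ r.2, (c.pair μ).1 = 1 := by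
    rcases hμ with rfl | rfl <;> decide
  intro c hc
  obtain ⟨d, hd, hcd⟩ := h1 _ h c hc
  exact ⟨(Nat.add_le_add_left hcd k).trans (hL d hd).1,
    fun hk => h2 _ h (fun d hd => (hL d hd).2 hk) c hc⟩

theorem isCol_letters {μ : ℕ × ℕ} (hμ : IsMiddle μ) {k n : ℕ} {c : Column} (hc : c.Valid n k μ) :
    IsCol 1 n k (c.letters k μ) := by
  obtain ⟨h1, h2⟩ := hc
  obtain ⟨h3, h4, h5⟩ := isPair_pair hμ c
  refine ⟨by simp [letters], ?_, ?_⟩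
  · rw [letters, List.pairwise_map]
    refine List.pairwise_lt_range.imp_of_mem fun {i j} hi hj hij => ?_
    rw [List.mem_range] at hi hj
    split_ifs <;> omega
  · intro x hx
    obtain ⟨i, hi, rfl⟩ := List.mem_map.1 hx
    rw [List.mem_range] at hi
    split_ifs <;> omega

theorem colGE_letters {μ : ℕ × ℕ} (hμ : IsMiddle μ) {k : ℕ} {c d : Column}
    (h : d.rank ≤ c.rank) : ColGE (c.letters k μ) (d.letters k μ) := by
  have h1 : (d.pair μ).1 ≤ (c.pair μ).1 ∧ (d.pair μ).2 ≤ (c.pair μ).2 := by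
    rcases hμ with rfl | rfl <;> cases c <;> cases d <;> revert h <;> decide
  rw [colGE_iff]
  refine ⟨by simp [letters], fun i hi hi' => ?_⟩
  simp only [letters, List.getElem_map, List.getElem_range]
  split_ifs <;> omega

end Column

open Column

theorem Rw.sound {μ : ℕ × ℕ} (hμ : IsMiddle μ) {k n : ℕ} (hk : 1 ≤ k) {L L' : List Column}
    (h : Rw L L') (hL : ∀ c ∈ L, c.Valid n k μ) :
    Knuth (L.flatMap (letters k μ)) (L'.flatMap (letters k μ)) ∧ ∀ c ∈ L', c.Valid n k μ := by
  induction h with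
  | refl => exact ⟨Knuth.refl _, hL⟩
  | @step L L' K A B hr _ ih =>
    have hL₀ : ∀ c ∈ L, c.Valid n k μ := fun c hc => hL c (by simp [hc])
    obtain ⟨h1, h2⟩ := ih fun c hc => by
      simp only [List.mem_append] at hc
      rcases hc with (hc | hc) | hc
      · exact hL c (by simp [hc])
      · exact valid_rule hμ hr hL₀ c hc
      · exact hL c (by simp [hc])
    refine ⟨Knuth.trans ?_ h1, h2⟩
    simp only [List.flatMap_append]
    exact (knuth_rule hμ hk hr hL₀).context _ _

end BoxBall

namespace BoxBall

open Column

/-! ### From columns to tableaux -/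

variable {n k l : ℕ} {μ : ℕ × ℕ}

theorem Column.letters_V (hk : 1 ≤ k) : letters k μ V = vacCol 1 k := by
  rw [letters, vacCol, List.range'_eq_map_range]
  refine List.map_congr_left fun i hi => ?_
  rw [List.mem_range] at hi
  simp only [pair]
  split_ifs <;> omega

theorem Column.valid_V (h : k ≤ n) : V.Valid n k μ := ⟨by simp only [pair]; omega, fun _ => rfl⟩

theorem isColList_letters (hμ : IsMiddle μ) {C : List Column} (hC : ∀ c ∈ C, c.Valid n k μ)
    (hd : Decr C) : IsColList 1 n k C.length (C.map (letters k μ)) := by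
  refine ⟨by simp, fun D hD => ?_, List.Pairwise.isChain ?_⟩
  · obtain ⟨c, hc, rfl⟩ := List.mem_map.1 hD
    exact isCol_letters hμ (hC c hc)
  · rw [List.pairwise_map]
    exact hd.imp fun h => colGE_letters hμ h

/-- Each exchange is a Knuth equivalence whose result is again a pair of tableaux, thanks to `Decr`.
By the characterisation of $R$ it is the value of $R$. -/
theorem Run.carry {R : Tab 1 n k l × Tab 1 n k 1 → Tab 1 n k 1 × Tab 1 n k l}
    (hR : ∀ p q, R p = q ↔ Knuth (tensorWord p) (tensorWord q)) (hμ : IsMiddle μ) (hk : 1 ≤ k)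
    {C S O C' : List Column} (hr : Run C S O C') {x : Tab 1 n k l} {p : List (Tab 1 n k 1)}
    (hx : x.cols = C.map (letters k μ)) (hp : p.map Tab.columnWord = S.map (letters k μ))
    (hC : ∀ c ∈ C, c.Valid n k μ) (hS : ∀ c ∈ S, c.Valid n k μ) :
    (carry R x p).1.map Tab.columnWord = O.map (letters k μ) ∧
      (carry R x p).2.cols = C'.map (letters k μ) ∧ ∀ c ∈ O, c.Valid n k μ := by
  induction hr generalizing x p with
  | nil C =>
    obtain rfl := List.map_eq_nil_iff.1 hp
    exact ⟨rfl, hx, by simp⟩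
  | @cons C C' C'' S O c o hrw hd _ ih =>
    rcases p with _ | ⟨q, p⟩
    · simp at hp
    rw [List.map_cons, List.map_cons, List.cons.injEq] at hp
    rw [List.forall_mem_cons] at hS
    obtain ⟨h1, h2⟩ := hrw.sound hμ hk (n := n) (by simpa [or_imp, forall_and] using ⟨hC, hS.1⟩)
    rw [List.forall_mem_cons] at h2
    have hlen : C.length = l := by
      rw [← List.length_map (letters k μ), ← hx, x.isColList.length_eq]
    have hlen' : C'.length = l := by
      have := hrw.length_eq
      simp only [List.length_append, List.length_cons, List.length_nil] at this
      omega
    obtain ⟨y, hy⟩ := exists_tab (hlen' ▸ isColList_letters hμ h2.2 hd)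
    obtain ⟨z, hz⟩ := exists_tab (l := 1) (isColList_letters hμ (C := [o]) (by simpa using h2.1)
      (List.pairwise_singleton _ _))
    have hRz : R (x, q) = (z, y) := (hR _ _).2 (by
      rw [tensorWord, tensorWord, x.columnWord_eq, z.columnWord_eq, y.columnWord_eq, hx, hy, hz,
        hp.1]
      simpa [List.flatMap_def] using h1)
    obtain ⟨h3, h4, h5⟩ := ih hy hp.2 h2.2 hS.2
    rw [BoxBall.carry, hRz]
    refine ⟨?_, h4, List.forall_mem_cons.2 ⟨h2.1, h5⟩⟩
    rw [List.map_cons, List.map_cons, h3, z.columnWord_eq, hz]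
    simp

theorem Evolves.timeEvolution {h : k ≤ n}
    {R : Tab 1 n k l × Tab 1 n k 1 → Tab 1 n k 1 × Tab 1 n k l}
    (hR : ∀ p q, R p = q ↔ Knuth (tensorWord p) (tensorWord q)) (hμ : IsMiddle μ) (hk : 1 ≤ k)
    {t : ℕ} {S S' : List Column} (hE : Evolves l t S S') {p : List (Tab 1 n k 1)}
    (hp : p.map Tab.columnWord = S.map (letters k μ)) (hS : ∀ c ∈ S, c.Valid n k μ) :
    ((timeEvolution h R)^[t] p).map Tab.columnWord = S'.map (letters k μ) ∧
      (∀ c ∈ S', c.Valid n k μ) ∧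
      ∀ s < t, finalCarrier h R ((timeEvolution h R)^[s] p) = vacuum h l := by
  induction hE with
  | zero => exact ⟨hp, hS, by simp⟩
  | @succ t S S' S'' _ hrun ih =>
    obtain ⟨h1, h2, h3⟩ := ih hp hS
    have hv : (vacuum h l).cols = (List.replicate l V).map (letters k μ) := by
      rw [cols_vacuum, List.map_replicate, letters_V hk]
    obtain ⟨h4, h5, h6⟩ := hrun.carry hR hμ hk hv h1 (fun c hc => by
      rw [List.eq_of_mem_replicate hc]; exact valid_V h) h2
    refine ⟨?_, h6, fun s hs => ?_⟩
    · rw [Function.iterate_succ_apply']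
      exact h4
    · rcases Nat.lt_succ_iff_lt_or_eq.1 hs with hs | rfl
      · exact h3 s hs
      · exact Tab.cols_injective (h5.trans hv.symm)

end BoxBall

namespace BoxBall

/-! ### Highest weight pairs of solitons -/

section

variable {a b K l l' : ℕ}

/-- An upward closed subset of `Finset.range d` is a final segment, known from its size. -/
theorem iff_le_add_card_filter {d : ℕ} {P : ℕ → Prop} [DecidablePred P]
    (hP : ∀ i j, i < j → j < d → P i → P j) {j : ℕ} (hj : j < d) :
    P j ↔ d ≤ j + ((Finset.range d).filter P).card := by
  constructor
  · intro h
    have h1 : Finset.Ico j d ⊆ (Finset.range d).filter P := fun i hi => by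
      rw [Finset.mem_Ico] at hi
      rw [Finset.mem_filter, Finset.mem_range]
      rcases hi.1.eq_or_lt with rfl | h'
      · exact ⟨hi.2, h⟩
      · exact ⟨hi.2, hP j i h' hi.2 h⟩
    have := Finset.card_le_card h1
    rw [Nat.card_Ico] at this
    omega
  · intro h
    by_contra hn
    have h1 : (Finset.range d).filter P ⊆ Finset.Ico (j + 1) d := fun i hi => by
      rw [Finset.mem_filter, Finset.mem_range] at hi
      rw [Finset.mem_Ico]
      refine ⟨?_, hi.1⟩
      by_contra hij
      rcases (show i ≤ j by omega).eq_or_lt with rfl | h'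
      · exact hn hi.2
      · exact hn (hP i j h' hj hi.2)
    have := Finset.card_le_card h1
    rw [Nat.card_Ico] at this
    omega

theorem Tab.count_columnWord (T : Tab a b K l) (x : ℕ) : T.columnWord.count x =
    ∑ j ∈ Finset.range l, ((List.range K).map fun i => T.entry i j).count x := by
  rw [Tab.columnWord, List.count_flatMap]
  exact (List.reverse_perm _).map _ |>.sum_eq

theorem Tab.count_columnWord_le (T : Tab a b K l) (x : ℕ) : T.columnWord.count x ≤ l := by
  rw [T.count_columnWord]
  refine (Finset.sum_le_card_nsmul _ _ 1 fun j hj => ?_).trans (by simp)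
  have h := (T.isColList.isCol _ (List.mem_map.2 ⟨j, by simpa using hj, rfl⟩)).strict
  exact List.nodup_iff_count_le_one.1 (h.imp fun h => h.ne) x

theorem Tab.count_columnWord_last {T : Tab a b (K + 1) l}
    (hrow : ∀ i, i < K → ∀ j < l, T.entry i j = a + i) :
    T.columnWord.count (a + (K + 1)) =
      ((Finset.range l).filter fun j => T.entry K j = a + (K + 1)).card := by
  rw [T.count_columnWord, Finset.card_filter]
  refine Finset.sum_congr rfl fun j hj => ?_
  rw [Finset.mem_range] at hj
  rw [List.range_succ, List.map_append, List.count_append, List.count_eq_zero.2, Nat.zero_add,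
    List.map_singleton, List.count_singleton]
  · simp
  · intro h
    obtain ⟨i, hi, h⟩ := List.mem_map.1 h
    rw [List.mem_range] at hi
    rw [hrow i hi j hj] at h
    omega

theorem Tab.mem_columnWord_entry (T : Tab a b K l) {i j : ℕ} (hi : i < K) (hj : j < l) :
    T.entry i j ∈ T.columnWord :=
  List.mem_flatMap.2 ⟨j, by simpa using hj, List.mem_map.2 ⟨i, by simpa using hi, rfl⟩⟩

/-- Only the last row is undetermined. It is weakly increasing with the two possible letters `a + K
- 1` and `a + K`, so the multiplicity of the larger one fixes it. -/
theorem Tab.entry_eq_ite {T : Tab a b K l}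
    (hrow : ∀ i, i + 1 < K → ∀ j < l, T.entry i j = a + i)
    (hle : ∀ c ∈ T.columnWord, c ≤ a + K) {i j : ℕ} (hi : i < K) (hj : j < l) :
    T.entry i j = if i + 1 = K ∧ l ≤ j + T.columnWord.count (a + K) then a + i + 1 else a + i := by
  rcases K with _ | K
  · omega
  rcases (show i ≤ K by omega).lt_or_eq with hiK | rfl
  · rw [if_neg (by omega), hrow i (by omega) j hj]
  have h0 : ∀ j < l, a + i ≤ T.entry i j ∧ T.entry i j ≤ a + (i + 1) := by
    refine fun j hj => ⟨?_, hle _ (T.mem_columnWord_entry hi hj)⟩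
    rcases i with _ | i
    · exact (T.entry_bounds hi hj).1
    · have h1 := T.entry_col (Nat.lt_add_one i) hi hj
      rw [hrow i (by omega) j hj] at h1
      omega
  rw [Tab.count_columnWord_last fun i' hi' => hrow i' (by omega)]
  have h1 := iff_le_add_card_filter (P := fun j => T.entry i j = a + (i + 1)) (d := l)
    (fun j₁ j₂ h h' h1 => by
      have := T.entry_row hi h h'
      have := h0 j₂ h'
      omega) hj
  have := h0 j hj
  split_ifs with h
  · exact h1.2 h.2
  · have : T.entry i j ≠ a + (i + 1) := fun h' => h ⟨rfl, h1.1 h'⟩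
    omega

theorem entry_fst_of_isHighest {k' : ℕ} {p : Tab a b K l × Tab a b k' l'}
    (hp : IsHighest a (tensorWord p)) {i j : ℕ} (hi : i < K) (hj : j < l) :
    p.1.entry i j = a + i := by
  have h1 : ((List.range K).map fun i => p.1.entry i j) ∈ p.1.cols :=
    List.mem_map.2 ⟨j, by simpa using hj, rfl⟩
  rw [cols_fst_of_isHighest hp] at h1
  have h2 := List.eq_of_mem_replicate h1
  rw [vacCol, List.range'_eq_map_range] at h2
  exact List.map_inj_left.1 h2 i (by simpa using hi)

theorem count_fst_of_isHighest {k' : ℕ} {p : Tab a b K l × Tab a b k' l'}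
    (hp : IsHighest a (tensorWord p)) (j : ℕ) :
    p.1.columnWord.count (a + j) = if j < K then l else 0 := by
  have h1 : ∀ L : List ℕ, ((List.replicate l L).flatten).count (a + j) = l * L.count (a + j) := by
    intro L
    simp [List.count_flatten]
  rw [p.1.columnWord_eq, cols_fst_of_isHighest hp, h1]
  split_ifs with h
  · rw [List.count_eq_one_of_mem (List.nodup_range' ..) (by rw [List.mem_range'_1]; omega), mul_one]
  · rw [List.count_eq_zero.2 (by rw [List.mem_range'_1]; omega), mul_zero]

theorem sum_count_eq_length {w : List ℕ} {N : ℕ} (hw : ∀ c ∈ w, a ≤ c ∧ c < a + N) :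
    ∑ j ∈ Finset.range N, w.count (a + j) = w.length := by
  induction w with
  | nil => simp
  | cons c w ih =>
    rw [List.forall_mem_cons] at hw
    simp only [List.count_cons, Finset.sum_add_distrib, ih hw.2, List.length_cons]
    congr 1
    rw [Finset.sum_eq_single (c - a)]
    · simp; omega
    · intro j _ hj
      rw [if_neg]
      simp; omega
    · intro h
      rw [Finset.mem_range] at h
      omega

/-- The rows of the tableau of a highest weight word are as long as the multiplicities of the
letters. For `j < K` the letter `a + j` fills `l` cells with its copies in the first factor, so its
copies in the second lie east of column `l`; the letter `a + K` does not reach that far. This leaves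
`K * l'` cells minus the multiplicity of `a + K`. -/
theorem energy_of_isHighest {p : Tab a b K l × Tab a b K l'} (hp : IsHighest a (tensorWord p))
    (hle : ∀ c ∈ tensorWord p, c ≤ a + K) (hl : l' < l) :
    energy p.1 p.2 = -((tensorWord p).count (a + K) : ℤ) := by
  have h1 := hp.eastNum (m := max l l') (N := K + 1) fun c hc => by have := hle c hc; omega
  have h2 := sum_count_eq_length (w := p.2.columnWord) (a := a) (N := K + 1) fun c hc =>
    ⟨(p.2.mem_columnWord hc).1, by
      have := hle c (List.mem_append_right _ hc)
      omega⟩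
  have h3 : ∀ j, (tensorWord p).count (a + j) =
      (if j < K then l else 0) + p.2.columnWord.count (a + j) := fun j => by
    rw [tensorWord, List.count_append, count_fst_of_isHighest hp]
  have h4 := p.2.count_columnWord_le (a + K)
  rw [Finset.sum_range_succ, p.2.length_columnWord] at h2
  rw [Finset.sum_range_succ, h3 K, if_neg (lt_irrefl K), Finset.sum_congr rfl fun j hj => by
    rw [h3 j, if_pos (Finset.mem_range.1 hj), max_eq_left hl.le, Nat.add_sub_cancel_left],
    max_eq_left hl.le] at h1
  rw [energy, eastCells_eq, max_eq_left hl.le]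
  change (eastNum l (tensorWord p) : ℤ) - _ = _
  rw [h3 K, if_neg (lt_irrefl K), h1, min_self, min_eq_right (by omega : (l' : ℤ) ≤ l)]
  have h5 : (l' : ℤ) * K = K * l' := mul_comm _ _
  zify at h2
  push_cast
  have h6 : ((0 + p.2.columnWord.count (a + K) - l : ℕ) : ℤ) = 0 := by omega
  rw [h6]
  linarith

/-- The largest letter of the second row is read directly after the letters `a` of the first. If it
exceeded `a + 1`, nothing could cancel it. -/
theorem le_of_isHighest_row {p : Tab a b 1 l × Tab a b 1 l'} (hp : IsHighest a (tensorWord p)) :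
    ∀ c ∈ tensorWord p, c ≤ a + 1 := by
  have hw : p.1.columnWord = List.replicate l a := by
    rw [p.1.columnWord_eq, cols_fst_of_isHighest hp]
    exact List.eq_replicate_iff.2 ⟨by simp, by simp [vacCol]⟩
  intro c hc
  rcases List.mem_append.1 hc with hc | hc
  · rw [hw] at hc
    rw [List.eq_of_mem_replicate hc]
    omega
  · rcases l' with _ | l'
    · simp [Tab.columnWord] at hc
    have h1 : c ≤ p.2.entry 0 l' := by
      obtain ⟨j, hj, hc⟩ := List.mem_flatMap.1 hc
      obtain ⟨i, hi, rfl⟩ := List.mem_map.1 hc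
      obtain rfl : i = 0 := by simpa using hi
      have hj : j < l' + 1 := by simpa using hj
      rcases (show j ≤ l' by omega).eq_or_lt with rfl | h
      · exact le_rfl
      · exact p.2.entry_row Nat.zero_lt_one h (Nat.lt_succ_self _)
    refine h1.trans (not_lt.1 fun h2 => ?_)
    obtain ⟨w, hw'⟩ : ∃ w, p.2.columnWord = [p.2.entry 0 l'] ++ w := by
      simp [Tab.columnWord, List.range_succ]
    have h3 : IsHighest a (List.replicate l a ++ [p.2.entry 0 l']) := by
      refine IsHighest.of_append_left (v := w) ?_
      rw [List.append_assoc, ← hw', ← hw]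
      exact hp
    generalize p.2.entry 0 l' = x at *
    obtain ⟨y, rfl⟩ : ∃ y, x = y + 1 := ⟨x - 1, by omega⟩
    have h4 := h3.eps_eq y (by omega)
    rw [eps_append, (eps_phi_eq_zero (i := y) fun c hc => by
      rw [List.eq_of_mem_replicate hc]; omega).2] at h4
    simp [eps, Sig.ep, lsgn_succ] at h4

end

namespace Soliton

open Column

variable {n k d : ℕ}

/-- The last `α` columns end in `k + 2`, and the last `β` have `k` above their bottom entry. Where
both hold the column is `Q`, where neither holds it is `P`; `M` is the column where just one of them
holds, and `μ` records which one. The sites begin with the last column. -/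
theorem map_columnWord_sites {h : k ≤ n} {μ : ℕ × ℕ} {α β b r : ℕ} (hk : 1 ≤ k) (hα : α ≤ d)
    (hβ : β ≤ d) (hb : b = min α β) (hr : r = max α β - b)
    (hμ : μ = (1, 4) ∧ β ≤ α ∨ μ = (2, 3) ∧ α ≤ β) (u : Soliton n k d)
    (hU : ∀ i < k - 1, ∀ j < d, u.upper.entry i j =
      if i + 1 = k - 1 ∧ d ≤ j + β then 1 + i + 1 else 1 + i)
    (hL : ∀ i < 1, ∀ j < d, u.lower.entry i j =
      if i + 1 = 1 ∧ d ≤ j + α then k + 1 + i + 1 else k + 1 + i) :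
    (u.tableau h).sites.map Tab.columnWord =
      (List.replicate b Q ++ (List.replicate r M ++ List.replicate (d - b - r) P)).map
        (letters k μ) := by
  refine List.ext_getElem (by simp [Tab.length_sites]; omega) fun s hs hs' => ?_
  have hsd : s < d := by simpa [Tab.length_sites] using hs
  simp only [Tab.sites, List.getElem_map, List.getElem_ofFn, Tab.columnWord_column,
    List.getElem_append, List.length_replicate, List.getElem_replicate, letters]
  refine List.map_congr_left fun i hi => ?_
  rw [List.mem_range] at hi
  rw [tableau, Tab.entry_mk, if_pos ⟨hi, by omega⟩, hL 0 Nat.zero_lt_one _ (by omega)]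
  by_cases hik : i < k - 1
  · rw [if_pos hik, hU i hik _ (by omega), if_neg (show ¬ i + 1 = k by omega)]
    rcases hμ with ⟨rfl, hμ⟩ | ⟨rfl, hμ⟩ <;> split_ifs <;> (try simp only [pair]) <;> omega
  · rw [if_neg hik, if_pos (show i + 1 = k by omega)]
    rcases hμ with ⟨rfl, hμ⟩ | ⟨rfl, hμ⟩ <;> split_ifs <;> (try simp only [pair]) <;> omega

end Soliton

end BoxBall

/-! ### Scattering of a highest weight pair and the theorem -/

namespace BoxBall

open Column

variable {n k d₁ d₂ l : ℕ} {h : k ≤ n}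

theorem map_columnWord_solitonPair {d d' : ℕ} {μ : ℕ × ℕ} {b r x g e N : ℕ} (hk : 1 ≤ k)
    {u : Soliton n k d} {v : Soliton n k d'}
    (hu : (u.tableau h).sites.map Tab.columnWord = (List.replicate d P).map (letters k μ))
    (hv : (v.tableau h).sites.map Tab.columnWord =
      (List.replicate b Q ++ (List.replicate r M ++ List.replicate e P)).map (letters k μ)) :
    (solitonPair h x u g v N).map Tab.columnWord = (st b r x d g 0 e N).map (letters k μ) := by
  have h1 : ∀ m, (List.replicate m (vacuum h 1)).map Tab.columnWord =
      (List.replicate m V).map (letters k μ) := fun m => by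
    rw [List.map_replicate, List.map_replicate, letters_V hk, Tab.columnWord_eq, cols_vacuum]
    simp
  simp only [solitonPair, st, List.map_append, hu, hv, h1, List.append_assoc, Nat.sub_zero,
    List.replicate_zero, List.nil_append]

/-- The outgoing pair is again of highest weight and has the same content. So `v'` consists of
columns `P` only, and `u'` inherits the `Q` and `M` of `v`, as in the final state of `evolves_st`.
-/
theorem scatters_isHighest (hk : 1 ≤ k) (hkn : k < n) (hd : d₂ < d₁) (hl : d₂ < l)
    {R : Tab 1 n k l × Tab 1 n k 1 → Tab 1 n k 1 × Tab 1 n k l}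
    (hR : ∀ p q, R p = q ↔ Knuth (tensorWord p) (tensorWord q))
    (u u' : Soliton n k d₁) (v v' : Soliton n k d₂)
    (hU : IsHighest 1 (tensorWord (u.upper, v.upper)))
    (hL : IsHighest (k + 1) (tensorWord (u.lower, v.lower)))
    (hkU : Knuth (tensorWord (u.upper, v.upper)) (tensorWord (v'.upper, u'.upper)))
    (hkL : Knuth (tensorWord (u.lower, v.lower)) (tensorWord (v'.lower, u'.lower))) :
    Scatters hkn.le R u v u' v' (phaseShift u v) := by
  obtain ⟨K, rfl⟩ : ∃ K, k = K + 1 := ⟨k - 1, by omega⟩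
  have hU' := hU.congr hkU
  have hL' := hL.congr hkL
  have hleU : ∀ c ∈ tensorWord (u.upper, v.upper), c ≤ 1 + K := fun c hc => by
    have := (mem_tensorWord hc).2; omega
  have hleL := le_of_isHighest_row hL
  have hleL' := le_of_isHighest_row hL'
  have heU : energy u.upper v.upper = -((tensorWord (u.upper, v.upper)).count (1 + K) : ℤ) :=
    energy_of_isHighest hU hleU hd
  have heL : energy u.lower v.lower =
      -((tensorWord (u.lower, v.lower)).count (K + 1 + 1 + 1) : ℤ) :=
    energy_of_isHighest hL hleL hd
  -- The first factor of a highest weight pair has no letter `k` in its upper part and no letter `k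
  -- + 2` in its lower part, so these letters sit in the second factor, before and after.
  have cU : v.upper.columnWord.count (1 + K) =
      (tensorWord (u.upper, v.upper)).count (1 + K) := by
    rw [tensorWord, List.count_append, count_fst_of_isHighest hU, if_neg (show ¬K < K + 1 - 1 by omega), zero_add]
  have cL : v.lower.columnWord.count (K + 1 + 1 + 1) =
      (tensorWord (u.lower, v.lower)).count (K + 1 + 1 + 1) := by
    rw [tensorWord, List.count_append, count_fst_of_isHighest hL, if_neg (lt_irrefl 1), zero_add]
  have cU' : u'.upper.columnWord.count (1 + K) = v.upper.columnWord.count (1 + K) := by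
    rw [cU, hkU.perm.count_eq, tensorWord, List.count_append, count_fst_of_isHighest hU',
      if_neg (show ¬K < K + 1 - 1 by omega), zero_add]
  have cL' : u'.lower.columnWord.count (K + 1 + 1 + 1) =
      v.lower.columnWord.count (K + 1 + 1 + 1) := by
    rw [cL, hkL.perm.count_eq, tensorWord, List.count_append, count_fst_of_isHighest hL',
      if_neg (lt_irrefl 1), zero_add]
  have eU := fun i (hi : i < K) j (hj : j < d₂) => v.upper.entry_eq_ite
    (fun i hi j hj => (entry_of_isHighest hU hi hj).trans (add_comm i 1))
    (fun c hc => hleU c (List.mem_append_right _ hc)) hi hj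
  have eL := fun i (hi : i < 1) j (hj : j < d₂) => v.lower.entry_eq_ite
    (fun i hi => absurd hi (by omega))
    (fun c hc => hleL c (List.mem_append_right _ hc)) hi hj
  have eU' := fun i (hi : i < K) j (hj : j < d₁) => u'.upper.entry_eq_ite
    (fun i hi j hj => (entry_of_isHighest hU' hi hj).trans (add_comm i 1))
    (fun c hc => by have := (u'.upper.mem_columnWord hc).2; omega) hi hj
  have eL' := fun i (hi : i < 1) j (hj : j < d₁) => u'.lower.entry_eq_ite
    (fun i hi => absurd hi (by omega))
    (fun c hc => hleL' c (List.mem_append_right _ hc)) hi hj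
  rw [← cU] at heU
  rw [← cL] at heL
  simp only [Nat.add_sub_cancel] at eU eU'
  rw [cU'] at eU'
  rw [cL'] at eL'
  have hβ := v.upper.count_columnWord_le (1 + K)
  have hα := v.lower.count_columnWord_le (K + 1 + 1 + 1)
  -- A letter `k + 2` requires `k + 2 ≤ n`, and an upper letter `k` requires `k ≥ 2`. This makes the
  -- columns `M` and `Q` admissible whenever they occur.
  have hα0 : v.lower.columnWord.count (K + 1 + 1 + 1) ≠ 0 → K + 3 ≤ n := fun h =>
    (v.lower.mem_columnWord (List.count_pos_iff.1 (Nat.pos_of_ne_zero h))).2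
  have hβ0 : v.upper.columnWord.count (1 + K) ≠ 0 → K ≠ 0 := by
    rintro h rfl
    have h1 := List.count_le_length (a := 1 + 0) (l := v.upper.columnWord)
    rw [v.upper.length_columnWord] at h1
    omega
  clear cU cL cU' cL' hleU hleL hleL' hkU hkL
  generalize v.upper.columnWord.count (1 + K) = β at *
  generalize v.lower.columnWord.count (K + 1 + 1 + 1) = α at *
  obtain ⟨b, hb⟩ : ∃ b, b = min α β := ⟨_, rfl⟩
  obtain ⟨r, hr⟩ : ∃ r, r = max α β - b := ⟨_, rfl⟩
  obtain ⟨e, he⟩ : ∃ e, d₂ = e + b + r := ⟨d₂ - b - r, by omega⟩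
  obtain ⟨μ, hμ⟩ : ∃ μ : ℕ × ℕ, μ = (1, 4) ∧ β ≤ α ∨ μ = (2, 3) ∧ α ≤ β := by
    rcases le_total β α with h | h
    · exact ⟨_, Or.inl ⟨rfl, h⟩⟩
    · exact ⟨_, Or.inr ⟨rfl, h⟩⟩
  have hμ₀ : μ = (1, 4) ∧ 0 ≤ 0 ∨ μ = (2, 3) ∧ 0 ≤ 0 := hμ.imp (fun h => ⟨h.1, le_rfl⟩)
    (fun h => ⟨h.1, le_rfl⟩)
  have hμ' : IsMiddle μ := hμ.imp And.left And.left
  have su := u.map_columnWord_sites (h := hkn.le) (μ := μ) (α := 0) (β := 0) (b := 0) (r := 0) hk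
    (Nat.zero_le _) (Nat.zero_le _) rfl rfl hμ₀
    (fun i hi j hj => by rw [if_neg (by omega)]; exact entry_fst_of_isHighest hU hi hj)
    (fun i hi j hj => by rw [if_neg (by omega)]; exact entry_fst_of_isHighest hL hi hj)
  have sv' := v'.map_columnWord_sites (h := hkn.le) (μ := μ) (α := 0) (β := 0) (b := 0) (r := 0) hk
    (Nat.zero_le _) (Nat.zero_le _) rfl rfl hμ₀
    (fun i hi j hj => by rw [if_neg (by omega)]; exact entry_fst_of_isHighest hU' hi hj)
    (fun i hi j hj => by rw [if_neg (by omega)]; exact entry_fst_of_isHighest hL' hi hj)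
  have sv := v.map_columnWord_sites (h := hkn.le) hk hα hβ hb hr hμ eU eL
  have su' := u'.map_columnWord_sites (h := hkn.le) hk (hα.trans hd.le) (hβ.trans hd.le) hb hr hμ
    eU' eL'
  rw [show d₂ - b - r = e by omega] at sv
  simp only [List.replicate_zero, List.nil_append, Nat.sub_zero] at su sv'
  -- The energies are `-α` and `-β`, and `2 * b + r = α + β`.
  have hδ : phaseShift u v = 2 * d₂ - 2 * b - r := by
    rw [phaseShift]
    rw [heL, heU]
    omega
  rw [hδ]
  intro c g₀ hg₀
  obtain ⟨t₀, ht₀⟩ := evolves_st (c := c) he hd hl hg₀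
  refine ⟨t₀, fun t ht => ?_⟩
  obtain ⟨x, g, hx, hg, hE⟩ := ht₀ t ht
  refine ⟨x, g, by rw [min_eq_left hl.le]; exact hx, hg, c + d₁ + g₀ + d₂ + l * t,
    fun L hLt => ?_⟩
  obtain ⟨N, rfl⟩ : ∃ N, L = c + d₁ + g₀ + d₂ + N := ⟨L - (c + d₁ + g₀ + d₂), by omega⟩
  obtain ⟨N', hE⟩ := hE N (by omega)
  have hvalid : ∀ z ∈ st b r c d₁ g₀ 0 e N, z.Valid n (K + 1) μ := by
    have hV := valid_V (μ := μ) hkn.le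
    have hP : P.Valid n (K + 1) μ := ⟨by simp only [pair]; omega, fun _ => rfl⟩
    have hM : r ≠ 0 → M.Valid n (K + 1) μ := fun h => by
      rcases hμ with ⟨rfl, hμ⟩ | ⟨rfl, hμ⟩
      · have := hα0 (by omega)
        exact ⟨by simp only [pair]; omega, fun _ => rfl⟩
      · have := hβ0 (by omega)
        exact ⟨by simp only [pair]; omega, fun h => by omega⟩
    have hQ : b ≠ 0 → Q.Valid n (K + 1) μ := fun h => by
      have := hα0 (by omega)
      have := hβ0 (by omega)
      exact ⟨by simp only [pair]; omega, fun h => by omega⟩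
    intro z hz
    simp only [st, List.mem_append, List.mem_replicate] at hz
    rcases hz with ⟨_, rfl⟩ | ⟨_, rfl⟩ | ⟨hz, rfl⟩ | ⟨_, rfl⟩ | ⟨hz, rfl⟩ | ⟨hz, rfl⟩ | ⟨_, rfl⟩ |
      ⟨_, rfl⟩
    · exact hV
    · exact hP
    · exact absurd rfl hz
    · exact hV
    · exact hQ hz
    · exact hM hz
    · exact hP
    · exact hV
  obtain ⟨h1, -, h3⟩ := hE.timeEvolution (h := hkn.le) hR hμ' hk
    (map_columnWord_solitonPair hk su sv) hvalid
  have h4 := map_columnWord_solitonPair (x := x) (g := g) (N := N') hk sv' su'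
  have h5 := List.map_injective_iff.2 Tab.columnWord_injective (h1.trans h4.symm)
  refine ⟨N, N', rfl, ?_, h3, h5⟩
  have h6 := congrArg List.length h5
  rw [length_timeEvolution_iterate, length_solitonPair, length_solitonPair] at h6
  exact h6.symm

end BoxBall

open BoxBall
theorem theorem3p5 (n k d₁ d₂ l : ℕ) (hk : 1 ≤ k) (hkn : k < n) (hd₂ : 1 ≤ d₂) (hd : d₂ < d₁)
    (hl : d₂ < l) :
    -- the three combinatorial `R`'s exist and are unique
    (∃! R : Tab 1 n k l × Tab 1 n k 1 → Tab 1 n k 1 × Tab 1 n k l, IsCombinatorialR R) ∧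
    (∃! R' : Tab 1 k (k - 1) d₁ × Tab 1 k (k - 1) d₂ → Tab 1 k (k - 1) d₂ × Tab 1 k (k - 1) d₁,
      IsCombinatorialR R') ∧
    (∃! R'' : Tab (k + 1) n 1 d₁ × Tab (k + 1) n 1 d₂ → Tab (k + 1) n 1 d₂ × Tab (k + 1) n 1 d₁,
      IsCombinatorialR R'') ∧
    -- and they describe the scattering
    ∀ (R : Tab 1 n k l × Tab 1 n k 1 → Tab 1 n k 1 × Tab 1 n k l)
      (R' : Tab 1 k (k - 1) d₁ × Tab 1 k (k - 1) d₂ → Tab 1 k (k - 1) d₂ × Tab 1 k (k - 1) d₁)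
      (R'' : Tab (k + 1) n 1 d₁ × Tab (k + 1) n 1 d₂ → Tab (k + 1) n 1 d₂ × Tab (k + 1) n 1 d₁),
      IsCombinatorialR R → IsCombinatorialR R' → IsCombinatorialR R'' →
      ∀ (u : Soliton n k d₁) (v : Soliton n k d₂) (u' : Soliton n k d₁) (v' : Soliton n k d₂),
        R' (u.upper, v.upper) = (v'.upper, u'.upper) →
        R'' (u.lower, v.lower) = (v'.lower, u'.lower) →
        ∀ c₁ c₂ : ℕ, c₁ + d₁ + d₂ ≤ c₂ →
          ∃ t₀ : ℕ, ∀ t ≥ t₀, ∃ L₀ : ℕ, ∀ L ≥ L₀,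
            (∀ s < t, finalCarrier hkn.le R
              ((timeEvolution hkn.le R)^[s] (twoSolitonState hkn.le L c₁ u c₂ v)) =
                vacuum hkn.le l) ∧
            (timeEvolution hkn.le R)^[t] (twoSolitonState hkn.le L c₁ u c₂ v) =
              twoSolitonState hkn.le L
                ((c₂ : ℤ) - phaseShift u v + (min d₂ l : ℕ) * (t : ℤ)) v'
                ((c₁ : ℤ) + phaseShift u v + (min d₁ l : ℕ) * (t : ℤ)) u' := by
  -- With `k = K + 1` the upper tableaux have `K` rows and `K + 1` letters, the corank one case.
  obtain ⟨K, rfl⟩ : ∃ K, k = K + 1 := ⟨k - 1, by omega⟩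
  obtain ⟨hR₁, hR⟩ := combinatorialR_column (a := 1) (b := n) (k := K + 1) (l := l) (by omega)
  obtain ⟨hU₁, hU⟩ := combinatorialR_corank_one (K := K) hd.le
  obtain ⟨hL₁, hL⟩ := combinatorialR_row (a := K + 1 + 1) (b := n) hd.le
  refine ⟨hR₁, hU₁, hL₁, fun R R' R'' h h' h'' u v u' v' hu hl' c₁ c₂ hc => ?_⟩
  obtain ⟨g₀, rfl⟩ : ∃ g₀, c₂ = c₁ + d₁ + g₀ := ⟨c₂ - c₁ - d₁, by omega⟩
  obtain ⟨t₀, ht₀⟩ := scatters_of_isHighest (h := hkn.le) hk (hR R h)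
    (scatters_isHighest hk hkn hd hl (hR R h)) u u' v v' ((hU R' h' _ _).1 hu)
    ((hL R'' h'' _ _).1 hl') c₁ g₀ (by omega)
  refine ⟨t₀, fun t ht => ?_⟩
  obtain ⟨x, g, hx, hg, L₀, hL₀⟩ := ht₀ t ht
  refine ⟨L₀, fun L hLt => ?_⟩
  obtain ⟨N, N', rfl, hN', hf, hT⟩ := hL₀ L hLt
  -- The integer positions of the statement are natural numbers here, so both states can be written
  -- as blocks.
  rw [← hx, ← hg, twoSolitonState_eq, ← hN', twoSolitonState_eq]
  exact ⟨hf, hT⟩
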